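/- Let $d\ge 1$, let $\mathcal O$ be either $\mathbb R^d$ or a flat torus $\mathbb T^d=(\mathbb R/L\mathbb Z)^d$ with $L>0$, and let $d<p<\infty$, $\nu>0$, $\theta\in(0,1)$, $0<T_{max}<T$. Write $\mathbb L^r(\mathcal O)=L^r(\mathcal O,\mathbb R^d)$, let $\mathbb H^{1,r}(\mathcal O)$ be the Sobolev space of all $f\in\mathbb L^r(\mathcal O)$ with weak first-order derivatives in $\mathbb L^r(\mathcal O)$, let $F(f)=(f\cdot\nabla)f$ for $f\in\mathbb H^{1,p}(\mathcal O)$, and let $S^\nu_t=e^{t\nu\Delta}$ be the heat semigroup on $\mathbb L^p(\mathcal O)$. Let $u_0\in\mathbb L^p(\mathcal O)$ and let $z:[0,T]\to\mathbb L^p(\mathcal O)$ satisfy $z\in L^\infty(0,T;\mathbb H^{1,2p}(\mathcal O)\cap\mathbb H^{1,p}(\mathcal O))$ and $z\in C^\theta(0,T;\mathbb L^p(\mathcal O))$, that is, $z$ is Hölder continuous of order $\theta$ on $(0,T)$ with values in $\mathbb L^p(\mathcal O)$. For $0<T'\le T$, a function $u$ is called a mild solution of the Burgers equation on $[0,T']$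 if $u\in C([0,T'];\mathbb L^p(\mathcal O))$, $u(s)\in\mathbb H^{1,p}(\mathcal O)$ for a.e. $s\in(0,T')$, $F(u(\cdot))\in L^1(0,T';\mathbb L^p(\mathcal O))$, and $v=u-z$ satisfies $$v(t)=S^\nu_t u_0+\int_0^t S^\nu_{t-s}F(v(s)+z(s))\,ds,\qquad t\in[0,T'].$$ Let $u\in C([0,T_{max});\mathbb L^p(\mathcal O))$ be a maximal local mild solution: it is a mild solution on $[0,T']$ for every $0<T'<T_{max}$, and for no $T'\in(T_{max},T]$ is there a mild solution on $[0,T']$ that agrees with $u$ on $[0,T_{max})$. Then $$\limsup_{t\nearrow T_{max}}|u(t)|^2_{\mathbb L^p(\mathcal O)}=\infty .$$ -/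

import Mathlib

open MeasureTheory Set Filter Topology
open scoped ENNReal NNReal

namespace Burgers

/-- The Euclidean space `ℝᵈ`. -/
abbrev RVec (d : ℕ) : Type := EuclideanSpace ℝ (Fin d)

/-- The flat torus `𝕋ᵈ = (ℝ / Lℤ)ᵈ`. -/
abbrev Torus (L : ℝ) (d : ℕ) : Type := Fin d → AddCircle L

/-- The quotient map `ℝᵈ → 𝕋ᵈ`. -/
def torusProj (L : ℝ) (d : ℕ) : RVec d → Torus L d := fun x i => (x i : AddCircle L)

/-- `𝕃ʳ(G) = Lʳ(G, ℝᵈ)`. -/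
abbrev LVec (G : Type) [MeasureSpace G] (d : ℕ) (r : ℝ≥0∞) : Type :=
  Lp (RVec d) r (volume : Measure G)

instance fact_one_le_two_mul (p : ℝ≥0∞) [h : Fact (1 ≤ p)] : Fact (1 ≤ 2 * p) :=
  ⟨h.out.trans (le_mul_of_one_le_left zero_le one_le_two)⟩

section Domain

/- Below, `G` is the spatial domain and `π : ℝᵈ → G` its covering map: the identity of `ℝᵈ`
if `G = ℝᵈ`, and the quotient map `torusProj L d` if `G = 𝕋ᵈ`. -/
variable {G : Type} [AddCommGroup G] [TopologicalSpace G] [MeasureSpace G] {d : ℕ}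

/-- The partial derivative `∂ᵢφ` of a scalar function on `G`. -/
noncomputable def partialDeriv (π : RVec d → G) (i : Fin d) (φ : G → ℝ) (x : G) : ℝ :=
  deriv (fun s : ℝ => φ (x + π (EuclideanSpace.single i s))) 0

/-- `φ ∈ C_c^∞(G)`. -/
def IsTestFunction (π : RVec d → G) (φ : G → ℝ) : Prop :=
  HasCompactSupport φ ∧ ContDiff ℝ ((⊤ : ℕ∞) : WithTop ℕ∞) (φ ∘ π)

/-- `g` is the weak partial derivative `∂ᵢf` of the vector field `f`. -/
def IsWeakPartial (π : RVec d → G) (i : Fin d) (f g : G → RVec d) : Prop :=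
  ∀ φ : G → ℝ, IsTestFunction π φ →
    ∫ x, partialDeriv π i φ x • f x = - ∫ x, φ x • g x

/-- `z ∈ L^∞(0,T; ℍ^{1,r}(G))`, where `ℍ^{1,r}(G)` is the Sobolev space of vector fields in
`𝕃ʳ(G)` whose weak first-order partial derivatives are in `𝕃ʳ(G)`: the function `z` and its
weak spatial derivatives define elements of `L^∞(0,T; 𝕃ʳ(G))`. -/
def MemLinftySobolev (π : RVec d → G) (T : ℝ) (r : ℝ≥0∞) [Fact (1 ≤ r)]
    (z : ℝ → G → RVec d) : Prop :=
  ∃ (w : ℝ → LVec G d r) (D : Fin d → ℝ → LVec G d r),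
    MemLp w ∞ (volume.restrict (Ioo 0 T)) ∧
    (∀ i, MemLp (D i) ∞ (volume.restrict (Ioo 0 T))) ∧
    ∀ᵐ t ∂(volume.restrict (Ioo 0 T)),
      (w t =ᵐ[volume] z t) ∧ ∀ i, IsWeakPartial π i (w t) (D i t)

/-- `f ∈ ℍ^{1,p}(G)` and `w = F(f) = (f · ∇) f = ∑ⱼ fⱼ ∂ⱼf ∈ 𝕃ᵖ(G)`. -/
def IsConvection (π : RVec d → G) {p : ℝ≥0∞} (f w : LVec G d p) : Prop :=
  ∃ D : Fin d → LVec G d p,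
    (∀ j, IsWeakPartial π j f (D j)) ∧
    w =ᵐ[volume] fun x => ∑ j, (f x) j • (D j x)

/-- The heat kernel `(4πνt)^{-d/2} exp(-|y|² / (4νt))` on `ℝᵈ`. -/
noncomputable def heatKernel (ν t : ℝ) (y : RVec d) : ℝ :=
  (4 * Real.pi * ν * t) ^ (-(d : ℝ) / 2) * Real.exp (-‖y‖ ^ 2 / (4 * ν * t))

variable [MeasurableAdd G] [(volume : Measure G).IsAddRightInvariant]

/-- The translate `x ↦ f (x - a)` of `f ∈ 𝕃ᵖ(G)`. -/
noncomputable def translate {p : ℝ≥0∞} (a : G) (f : LVec G d p) : LVec G d p :=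
  Lp.compMeasurePreserving (fun x : G => x - a) (measurePreserving_sub_right volume a) f

/-- The heat semigroup `S_t^ν = e^{tνΔ}` on `𝕃ᵖ(G)`: `S_0^ν f = f`, and for `t > 0`
`(S_t^ν f)(x) = ∫ k(y) f(x - π y) dy` over `ℝᵈ` with the heat kernel `k`, the integral being
taken in `𝕃ᵖ(G)`. On the torus this is the convolution with the periodized heat kernel. -/
noncomputable def heatSemigroup (π : RVec d → G) (ν : ℝ) {p : ℝ≥0∞} [Fact (1 ≤ p)] (t : ℝ)
    (f : LVec G d p) : LVec G d p :=
  if t = 0 then f else ∫ y : RVec d, heatKernel ν t y • translate (π y) f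

/-- `u` is a mild solution on `[0,T']` of the Burgers equation with viscosity `ν`, initial
condition `u₀` and driving path `z`: `u ∈ C([0,T']; 𝕃ᵖ)`, `F(u) ∈ L¹(0,T'; 𝕃ᵖ)`, and `v = u - z`
satisfies `v(t) = S_t^ν u₀ + ∫₀ᵗ S_{t-s}^ν F(v(s) + z(s)) ds` for `t ∈ [0,T']`. -/
def IsMildSolution (π : RVec d → G) (ν : ℝ) {p : ℝ≥0∞} [Fact (1 ≤ p)] (T' : ℝ)
    (u₀ : LVec G d p) (z u : ℝ → LVec G d p) : Prop :=
  ContinuousOn u (Icc 0 T') ∧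
  ∃ N : ℝ → LVec G d p,
    IntegrableOn N (Ioc 0 T') ∧
    (∀ᵐ s ∂(volume.restrict (Ioc 0 T')), IsConvection π (u s) (N s)) ∧
    ∀ t ∈ Icc 0 T',
      u t - z t = heatSemigroup π ν t u₀ + ∫ s in (0 : ℝ)..t, heatSemigroup π ν (t - s) (N s)

/-- `u`, restricted to `[0,Tmax)`, is a maximal local mild solution of the Burgers equation on the
time horizon `[0,T]`: it is a mild solution on `[0,T']` for all `T' < Tmax`, and no mild solution
on an interval `[0,T']` with `Tmax < T' ≤ T` extends it. -/
def IsMaximalMildSolution (π : RVec d → G) (ν : ℝ) {p : ℝ≥0∞} [Fact (1 ≤ p)] (T Tmax : ℝ)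
    (u₀ : LVec G d p) (z u : ℝ → LVec G d p) : Prop :=
  0 < Tmax ∧
  (∀ T' ∈ Ioo 0 Tmax, IsMildSolution π ν T' u₀ z u) ∧
  ∀ T' ∈ Ioc Tmax T, ∀ u' : ℝ → LVec G d p,
    IsMildSolution π ν T' u₀ z u' → ¬ EqOn u' u (Ico 0 Tmax)

end Domain

end Burgers

/-! The unknown is the nonlinearity `N = F(u)` in `L¹(0,τ; Lᵖ)` rather than `u` itself. For `t ≤ 1`
the heat semigroup maps `Lᵖ` to `L²ᵖ` with norm of order `t^{-d/(4p)}`, and its gradient with norm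
of order `t^{-1/2-d/(4p)}` (`exists_smoothingFamilies`). By Hölder, `(f, D) ↦ ∑ⱼ fⱼ Dⱼ` maps `L²ᵖ ×
L²ᵖ` to `Lᵖ`, so the mild equation becomes a fixed point equation `N = Φ(N)` with `Φ` quadratic
(`ae_isConvection_iff`).

The two singularities add up to `1/2 + d/(2p)`, which is less than `1` exactly because `d < p`. The
key estimate `lintegral_conv_mul_conv_le` bounds the `L¹` norm of a product of two singular
convolutions by a positive power of `τ` times the product of the total masses. If the initial datum
and the path `z` are counted as an atom of mass `K` at time `0`, this reads `‖Φ(N)‖₁ ≤ κ(τ) (K +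
‖N‖₁)²` with `κ(τ) → 0`. Two consequences follow on any interval whose length depends only on `K`:
`Φ` has a fixed point (`exists_picardMap_fixedPoint`), and every fixed point has `L¹` norm at most
`K + 1`, by a continuity argument in the upper end of the interval (`lintegral_le_of_forall_le_sq`).

If the limsup were finite, `u - z` would be bounded near `Tmax`. Restarting at a time `t₀` so close
to `Tmax` that the remaining interval is shorter than the `τ` belonging to this bound, the a priori
estimate makes `N` integrable up to `Tmax` (`integrableOn_nonlinearity_of_bounded`). Then the
Duhamel formula defines `v(Tmax)`, a local solution started from it is glued on
(`exists_continuation`), and maximality fails. Uniqueness of mild solutions plays no role.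

The whole space and the torus are treated together through a covering map `π : ℝᵈ → G` with the
properties `IsHeatCovering`. -/

set_option linter.unusedSectionVars false

namespace Burgers

/-! ### Power kernels and the bilinear convolution estimate. -/

section SingularKernel

/-- The kernel `r ↦ r^{-α}` on `(0,∞)`, extended by zero. -/
noncomputable def powKernel (α r : ℝ) : ℝ≥0∞ := if 0 < r then ENNReal.ofReal (r ^ (-α)) else 0

lemma measurable_powKernel (α : ℝ) : Measurable (powKernel α) := by
  unfold powKernel
  exact Measurable.ite measurableSet_Ioi (by fun_prop) measurable_const

/-- On `(0,1]` the kernel dominates constants; this lets the bounded path `z` be charged to the atom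
at time `0`. -/
lemma one_le_powKernel {α r : ℝ} (hα : 0 ≤ α) (h0 : 0 < r) (h1 : r ≤ 1) : 1 ≤ powKernel α r := by
  rw [powKernel, if_pos h0, ENNReal.one_le_ofReal]
  exact Real.one_le_rpow_of_pos_of_le_one_of_nonpos h0 h1 (by linarith)

lemma powKernel_antitone_of_pos {α r s : ℝ} (hα : 0 ≤ α) (hr : 0 < r) (hrs : r ≤ s) :
    powKernel α s ≤ powKernel α r := by
  rw [powKernel, powKernel, if_pos hr, if_pos (hr.trans_le hrs)]
  exact ENNReal.ofReal_le_ofReal (Real.rpow_le_rpow_of_nonpos hr hrs (by linarith))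

lemma powKernel_mul (α β r : ℝ) : powKernel α r * powKernel β r = powKernel (α + β) r := by
  unfold powKernel
  split_ifs with h
  · rw [← ENNReal.ofReal_mul (by positivity), ← Real.rpow_add h]
    congr 2
    ring
  · simp

/-- The distance from `t` to `max s s'` is the smaller of the two distances, and replacing each
argument by it only enlarges the factors. If `t` does not exceed the maximum, one factor vanishes.
-/
lemma powKernel_sub_mul_sub_le {α β : ℝ} (hα : 0 ≤ α) (hβ : 0 ≤ β) (s s' t : ℝ) :
    powKernel α (t - s) * powKernel β (t - s') ≤ powKernel (α + β) (t - max s s') := by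
  by_cases h : max s s' < t
  · rw [← powKernel_mul]
    gcongr
    · exact powKernel_antitone_of_pos hα (by linarith) (by linarith [le_max_left s s'])
    · exact powKernel_antitone_of_pos hβ (by linarith) (by linarith [le_max_right s s'])
  · have : t ≤ s ∨ t ≤ s' := le_max_iff.1 (not_lt.1 h)
    rcases this with h | h
    · simp [powKernel, not_lt.2 h]
    · simp [powKernel, not_lt.2 h]

/-- The bound is uniform in `σ`: for `σ ≥ 0` the points of `(0,τ]` where the shifted kernel is
nonzero are sent by `t ↦ t - σ` into `(0,τ]` again, so the shift can only lose mass. -/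
lemma lintegral_powKernel_sub_le {γ τ σ : ℝ} (hγ : γ < 1) (hτ : 0 ≤ τ) (hσ : 0 ≤ σ) :
    ∫⁻ t in Ioc 0 τ, powKernel γ (t - σ) ≤ ENNReal.ofReal (τ ^ (1 - γ) / (1 - γ)) := by
  calc ∫⁻ t in Ioc 0 τ, powKernel γ (t - σ)
      = ∫⁻ t, (Ioc 0 τ).indicator (fun t => powKernel γ (t - σ)) t :=
        (lintegral_indicator measurableSet_Ioc _).symm
    _ ≤ ∫⁻ t, (Ioc 0 τ).indicator (powKernel γ) (t - σ) := by
        refine lintegral_mono fun t => ?_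
        by_cases ht : t ∈ Ioc 0 τ
        · by_cases h : 0 < t - σ
          · have : t - σ ∈ Ioc 0 τ := ⟨h, by linarith [ht.2]⟩
            simp [ht, this]
          · rw [indicator_of_mem ht, powKernel, if_neg h]
            exact zero_le
        · simp [ht]
    _ = ∫⁻ t in Ioc 0 τ, powKernel γ t := by
        rw [lintegral_sub_right_eq_self (fun t => (Ioc 0 τ).indicator (powKernel γ) t) σ,
          lintegral_indicator measurableSet_Ioc]
    _ = ∫⁻ t in Ioc 0 τ, ENNReal.ofReal (t ^ (-γ)) := by
        refine setLIntegral_congr_fun measurableSet_Ioc fun t ht => ?_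
        simp [powKernel, ht.1]
    _ = ENNReal.ofReal (∫ t in (0 : ℝ)..τ, t ^ (-γ)) := by
        rw [intervalIntegral.integral_of_le hτ, ofReal_integral_eq_lintegral_ofReal]
        · exact ((intervalIntegrable_iff_integrableOn_Ioc_of_le hτ).1
            (intervalIntegral.intervalIntegrable_rpow' (by linarith)))
        · filter_upwards [ae_restrict_mem measurableSet_Ioc] with t ht
          exact Real.rpow_nonneg ht.1.le _
    _ = ENNReal.ofReal (τ ^ (1 - γ) / (1 - γ)) := by
        rw [integral_rpow (Or.inl (by linarith)), Real.zero_rpow (by linarith)]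
        congr 1
        rw [sub_zero, neg_add_eq_sub]

/-- The key estimate: a product of two convolutions of finite measures with singular kernels is
integrable, with a small constant for small times. -/
lemma lintegral_conv_mul_conv_le {α β τ : ℝ} (hα : 0 ≤ α) (hβ : 0 ≤ β) (hαβ : α + β < 1)
    (hτ : 0 ≤ τ) {m₁ m₂ : Measure ℝ} [SFinite m₁] [SFinite m₂]
    (h₁ : ∀ᵐ s ∂m₁, 0 ≤ s) :
    ∫⁻ t in Ioc 0 τ, (∫⁻ s, powKernel α (t - s) ∂m₁) * (∫⁻ s, powKernel β (t - s) ∂m₂) ≤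
      ENNReal.ofReal (τ ^ (1 - (α + β)) / (1 - (α + β))) * (m₁ univ * m₂ univ) := by
  have mα := measurable_powKernel α
  have mβ := measurable_powKernel β
  calc ∫⁻ t in Ioc 0 τ, (∫⁻ s, powKernel α (t - s) ∂m₁) * (∫⁻ s, powKernel β (t - s) ∂m₂)
      = ∫⁻ t in Ioc 0 τ, ∫⁻ s, ∫⁻ s', powKernel α (t - s) * powKernel β (t - s') ∂m₂ ∂m₁ := by
        refine lintegral_congr fun t => ?_
        rw [← lintegral_mul_const _ (by fun_prop)]
        refine lintegral_congr fun s => ?_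
        rw [lintegral_const_mul _ (by fun_prop)]
    _ = ∫⁻ s, (∫⁻ t in Ioc 0 τ, ∫⁻ s', powKernel α (t - s) * powKernel β (t - s') ∂m₂) ∂m₁ := by
        refine lintegral_lintegral_swap (Measurable.aemeasurable ?_)
        refine Measurable.lintegral_prod_right' (ν := m₂)
          (f := fun q : (ℝ × ℝ) × ℝ => powKernel α (q.1.1 - q.1.2) * powKernel β (q.1.1 - q.2)) ?_
        fun_prop
    _ = ∫⁻ s, (∫⁻ s', (∫⁻ t in Ioc 0 τ, powKernel α (t - s) * powKernel β (t - s')) ∂m₂) ∂m₁ := by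
        refine lintegral_congr fun s => lintegral_lintegral_swap (Measurable.aemeasurable ?_)
        fun_prop
    -- For fixed `s, s'` the time integral is bounded independently of both. Nonnegativity of `s`
    -- alone suffices, since only `max s s' ≥ 0` is needed.
    _ ≤ ∫⁻ _, ∫⁻ _, ENNReal.ofReal (τ ^ (1 - (α + β)) / (1 - (α + β))) ∂m₂ ∂m₁ := by
        refine lintegral_mono_ae ?_
        filter_upwards [h₁] with s hs
        refine lintegral_mono fun s' => ?_
        exact (lintegral_mono fun t => powKernel_sub_mul_sub_le hα hβ s s' t).trans
          (lintegral_powKernel_sub_le hαβ hτ (hs.trans (le_max_left _ _)))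
    _ = _ := by
        simp only [lintegral_const]
        ring

end SingularKernel

/-! ### Operator families with a power singularity at time zero. -/

section Duhamel

variable {E F : Type*} [NormedAddCommGroup E] [NormedSpace ℝ E]
  [NormedAddCommGroup F] [NormedSpace ℝ F]

/-- A strongly continuous family of operators `U t`, `t > 0`, extended by zero, whose norm has a
singularity of order `t^{-α}` at `0`. -/
structure IsSmoothingFamily (U : ℝ → E →L[ℝ] F) (α : ℝ) (C : ℝ≥0) : Prop where
  eq_zero : ∀ t ≤ 0, U t = 0
  continuousOn : ∀ f, ContinuousOn (fun t => U t f) (Ioi 0)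
  bound : ∀ t ≤ 1, ∀ f, ‖U t f‖ₑ ≤ C * powKernel α t * ‖f‖ₑ

/-- The family `U` is only strongly measurable, so `N` is approximated by simple functions. On these
the composite is a finite sum of orbits `x ↦ U x c` cut off to measurable sets. -/
lemma _root_.MeasureTheory.StronglyMeasurable.apply_strongly {X : Type*} [MeasurableSpace X]
    {U : X → E →L[ℝ] F} (hU : ∀ f, StronglyMeasurable fun x => U x f)
    {N : X → E} (hN : StronglyMeasurable N) : StronglyMeasurable fun x => U x (N x) := by
  refine stronglyMeasurable_of_tendsto (f := fun n x => U x (hN.approx n x)) atTop (fun n => ?_)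
    (tendsto_pi_nhds.2 fun x => ((U x).continuous.tendsto _).comp (hN.tendsto_approx x))
  have : (fun x => U x (hN.approx n x)) = fun x => ∑ c ∈ (hN.approx n).range,
      ((hN.approx n) ⁻¹' {c}).indicator (fun x => U x c) x := by
    ext x
    rw [Finset.sum_eq_single (hN.approx n x)]
    · simp
    · intro c _ hc
      exact indicator_of_notMem (fun h => hc (by simpa using h.symm)) _
    · intro h
      exact absurd (SimpleFunc.mem_range_self _ _) h
  rw [this]
  exact Finset.stronglyMeasurable_fun_sum _ fun c _ =>
    (hU c).indicator ((hN.approx n).measurableSet_preimage _)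

namespace IsSmoothingFamily

variable {U : ℝ → E →L[ℝ] F} {α : ℝ} {C : ℝ≥0}

lemma stronglyMeasurable (hU : IsSmoothingFamily U α C) (f : E) :
    StronglyMeasurable fun t => U t f := by
  have : (fun t => U t f) = (Ioi (0 : ℝ)).indicator fun t => U t f := by
    ext t
    by_cases ht : 0 < t
    · simp [ht]
    · simp [hU.eq_zero t (not_lt.1 ht), ht]
  rw [this]
  obtain ⟨g, hg, hgU⟩ := (MeasurableEmbedding.subtype_coe
    (measurableSet_Ioi (a := (0 : ℝ)))).exists_stronglyMeasurable_extend
    (continuousOn_iff_continuous_domRestrict.1 (hU.continuousOn f)).stronglyMeasurable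
    (fun _ => ⟨0⟩)
  convert! hg.indicator (measurableSet_Ioi (a := (0 : ℝ))) using 1
  refine indicator_congr fun t ht => ?_
  exact (congrFun hgU ⟨t, ht⟩).symm

lemma aestronglyMeasurable_prod (hU : IsSmoothingFamily U α C) {μ ν : Measure ℝ} [SFinite ν]
    {N : ℝ → E} (hN : AEStronglyMeasurable N ν) :
    AEStronglyMeasurable (fun q : ℝ × ℝ => U (q.1 - q.2) (N q.2)) (μ.prod ν) := by
  obtain ⟨N', hN', h⟩ := hN
  refine ⟨fun q => U (q.1 - q.2) (N' q.2), StronglyMeasurable.apply_strongly (fun f => ?_)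
    (hN'.comp_measurable measurable_snd), ?_⟩
  · exact (hU.stronglyMeasurable f).comp_measurable (measurable_fst.sub measurable_snd)
  · filter_upwards [Measure.quasiMeasurePreserving_snd.ae h] with q hq
    rw [hq]

lemma aestronglyMeasurable_apply (hU : IsSmoothingFamily U α C) {ν : Measure ℝ}
    {N : ℝ → E} (hN : AEStronglyMeasurable N ν) (t : ℝ) :
    AEStronglyMeasurable (fun s => U (t - s) (N s)) ν := by
  obtain ⟨N', hN', h⟩ := hN
  refine ⟨fun s => U (t - s) (N' s), StronglyMeasurable.apply_strongly (fun f => ?_) hN', ?_⟩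
  · exact (hU.stronglyMeasurable f).comp_measurable (measurable_const.sub measurable_id)
  · filter_upwards [h] with q hq
    rw [hq]

lemma lintegral_enorm_le (hU : IsSmoothingFamily U α C) {τ : ℝ} (hτ : τ ≤ 1) (N : ℝ → E)
    {t : ℝ} (ht : t ≤ τ) :
    ∫⁻ s in Ioc 0 τ, ‖U (t - s) (N s)‖ₑ ≤
      C * ∫⁻ s in Ioc 0 τ, powKernel α (t - s) * ‖N s‖ₑ := by
  rw [← lintegral_const_mul' _ _ ENNReal.coe_ne_top]
  refine lintegral_mono_ae ?_
  filter_upwards [ae_restrict_mem measurableSet_Ioc] with s hs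
  rw [← mul_assoc]
  exact hU.bound _ (by linarith [hs.1]) _

end IsSmoothingFamily

end Duhamel

/-! ### Initial data and forcing combined in one measure in time. -/

section DataMeasure

variable {E : Type*} [NormedAddCommGroup E]

/-- The measure `K δ₀ + ‖N(s)‖ ds` on `[0,τ]`. -/
noncomputable def dataMeasure (K : ℝ≥0) (τ : ℝ) (N : ℝ → E) : Measure ℝ :=
  K • Measure.dirac 0 + (volume.restrict (Ioc 0 τ)).withDensity fun s => ‖N s‖ₑ

instance (K : ℝ≥0) (τ : ℝ) (N : ℝ → E) : SFinite (dataMeasure K τ N) := by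
  unfold dataMeasure
  infer_instance

lemma dataMeasure_univ (K : ℝ≥0) (τ : ℝ) (N : ℝ → E) :
    dataMeasure K τ N univ = K + ∫⁻ s in Ioc 0 τ, ‖N s‖ₑ := by
  rw [dataMeasure, Measure.add_apply, withDensity_apply _ MeasurableSet.univ]
  simp

lemma dataMeasure_nonneg (K : ℝ≥0) (τ : ℝ) (N : ℝ → E) :
    ∀ᵐ s ∂(dataMeasure K τ N), 0 ≤ s := by
  rw [dataMeasure, ae_add_measure_iff]
  constructor
  · refine Measure.ae_smul_measure ?_ K
    rw [ae_dirac_iff measurableSet_Ici]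
  · refine (withDensity_absolutelyContinuous _ _).ae_le ?_
    filter_upwards [ae_restrict_mem measurableSet_Ioc] with s hs using hs.1.le

lemma lintegral_dataMeasure (K : ℝ≥0) {τ : ℝ} {N : ℝ → E}
    (hN : AEStronglyMeasurable N (volume.restrict (Ioc 0 τ))) {k : ℝ → ℝ≥0∞}
    (hk : Measurable k) :
    ∫⁻ s, k s ∂(dataMeasure K τ N) = K * k 0 + ∫⁻ s in Ioc 0 τ, k s * ‖N s‖ₑ := by
  rw [dataMeasure, lintegral_add_measure, lintegral_smul_measure, lintegral_dirac' _ hk,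
    lintegral_withDensity_eq_lintegral_mul₀ hN.enorm hk.aemeasurable]
  simp only [Pi.mul_apply, ENNReal.smul_def, smul_eq_mul, mul_comm]

end DataMeasure

/-! ### Bounds for the mild formula. -/

section MildPart

variable {E F : Type*} [NormedAddCommGroup E] [NormedSpace ℝ E]
  [NormedAddCommGroup F] [NormedSpace ℝ F]

/-- `z(t) + U(t) v₀ + ∫₀^τ U(t-s) N(s) ds`; for `t ≤ τ` the integral runs over `(0,t)` only if
`U` vanishes for nonpositive times. -/
noncomputable def mildPart (U : ℝ → E →L[ℝ] F) (τ : ℝ) (v₀ : E) (z : ℝ → F) (N : ℝ → E) (t : ℝ) :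
    F :=
  z t + (U t v₀ + ∫ s in Ioc 0 τ, U (t - s) (N s))

namespace IsSmoothingFamily

variable {U : ℝ → E →L[ℝ] F} {α : ℝ} {C : ℝ≥0}

lemma setIntegral_Ioc_eq (hU : IsSmoothingFamily U α C) (N : ℝ → E) {t τ : ℝ} (ht : t ≤ τ) :
    ∫ s in Ioc 0 τ, U (t - s) (N s) = ∫ s in Ioc 0 t, U (t - s) (N s) := by
  refine (setIntegral_eq_of_subset_of_forall_sdiff_eq_zero measurableSet_Ioc
    (Ioc_subset_Ioc_right ht) fun s hs => ?_)
  have : t < s := by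
    by_contra! h
    exact hs.2 ⟨hs.1.1, h⟩
  rw [hU.eq_zero _ (by linarith)]
  rfl

lemma aestronglyMeasurable_mildPart (hU : IsSmoothingFamily U α C) {τ : ℝ} (v₀ : E) {z : ℝ → F}
    {N : ℝ → E} (hz : AEStronglyMeasurable z (volume.restrict (Ioc 0 τ)))
    (hN : AEStronglyMeasurable N (volume.restrict (Ioc 0 τ))) :
    AEStronglyMeasurable (mildPart U τ v₀ z N) (volume.restrict (Ioc 0 τ)) :=
  hz.add ((hU.stronglyMeasurable v₀).aestronglyMeasurable.add
    (hU.aestronglyMeasurable_prod hN).integral_prod_right')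

lemma enorm_integral_le (hU : IsSmoothingFamily U α C) {τ : ℝ} (hτ : τ ≤ 1)
    {N : ℝ → E} (hN : AEStronglyMeasurable N (volume.restrict (Ioc 0 τ)))
    {t : ℝ} (ht : t ∈ Ioc 0 τ) :
    ‖∫ s in Ioc 0 τ, U (t - s) (N s)‖ₑ ≤ C * ∫⁻ s, powKernel α (t - s) ∂(dataMeasure 0 τ N) := by
  have hm := measurable_powKernel α
  rw [lintegral_dataMeasure _ hN (by fun_prop), ENNReal.coe_zero, zero_mul, zero_add]
  exact (enorm_integral_le_lintegral_enorm _).trans (hU.lintegral_enorm_le hτ N ht.2)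

/-- The datum and the path together are dominated by `C K t^{-α}`, the contribution of the atom at
`0`: for `v₀` this is the smoothing bound, for `z` it holds because `C t^{-α} ≥ 1` on `(0,1]`. -/
lemma enorm_mildPart_le (hU : IsSmoothingFamily U α C) (hα : 0 ≤ α) (hC : 1 ≤ C) {τ : ℝ}
    (hτ : τ ≤ 1) (v₀ : E) {z : ℝ → F} {N : ℝ → E}
    (hN : AEStronglyMeasurable N (volume.restrict (Ioc 0 τ)))
    {t : ℝ} (ht : t ∈ Ioc 0 τ) {Z : ℝ≥0} (hz : ‖z t‖ₑ ≤ Z) {K : ℝ≥0} (hK : Z + ‖v₀‖₊ ≤ K) :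
    ‖mildPart U τ v₀ z N t‖ₑ ≤ C * ∫⁻ s, powKernel α (t - s) ∂(dataMeasure K τ N) := by
  have hm := measurable_powKernel α
  have h1 := one_le_powKernel hα ht.1 (ht.2.trans hτ)
  rw [lintegral_dataMeasure _ hN (by fun_prop), mul_add, sub_zero]
  calc ‖mildPart U τ v₀ z N t‖ₑ
      ≤ ‖z t‖ₑ + (‖U t v₀‖ₑ + ‖∫ s in Ioc 0 τ, U (t - s) (N s)‖ₑ) :=
        (enorm_add_le _ _).trans (add_le_add le_rfl (enorm_add_le _ _))
    _ ≤ C * powKernel α t * Z + (C * powKernel α t * ‖v₀‖ₑ +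
          C * ∫⁻ s in Ioc 0 τ, powKernel α (t - s) * ‖N s‖ₑ) := by
        gcongr
        · refine hz.trans (le_mul_of_one_le_left zero_le ?_)
          exact one_le_mul (by exact_mod_cast hC) h1
        · exact hU.bound _ (ht.2.trans hτ) _
        · exact (enorm_integral_le_lintegral_enorm _).trans (hU.lintegral_enorm_le hτ N ht.2)
    _ = C * (↑(Z + ‖v₀‖₊) * powKernel α t) +
          C * ∫⁻ s in Ioc 0 τ, powKernel α (t - s) * ‖N s‖ₑ := by
        rw [ENNReal.coe_add, ← enorm_eq_nnnorm]
        ring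
    _ ≤ _ := by gcongr

lemma ae_integrable (hU : IsSmoothingFamily U α C) (hα : 0 ≤ α) (hα1 : α < 1) {τ : ℝ}
    (hτ : τ ∈ Ioc (0 : ℝ) 1) {N : ℝ → E} (hN : IntegrableOn N (Ioc 0 τ)) :
    ∀ᵐ t ∂(volume.restrict (Ioc 0 τ)), IntegrableOn (fun s => U (t - s) (N s)) (Ioc 0 τ) := by
  have hm := measurable_powKernel α
  -- With `β = 0` and a Dirac mass at `0` the second convolution equals `1` for `t > 0`, so the
  -- bilinear estimate reduces to integrability of a single convolution, which is therefore finite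
  -- for almost every `t`.
  have key := lintegral_conv_mul_conv_le (α := α) (β := 0) hα le_rfl (by linarith) hτ.1.le
    (m₁ := dataMeasure 0 τ N) (m₂ := Measure.dirac 0) (dataMeasure_nonneg _ _ _)
  rw [dataMeasure_univ] at key
  have hfin : ∫⁻ t in Ioc 0 τ, (∫⁻ s, powKernel α (t - s) ∂(dataMeasure 0 τ N)) *
      (∫⁻ s, powKernel 0 (t - s) ∂(Measure.dirac 0)) ≠ ∞ := by
    refine (key.trans_lt ?_).ne
    refine ENNReal.mul_lt_top ENNReal.ofReal_lt_top (ENNReal.mul_lt_top ?_ (by simp))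
    simpa [HasFiniteIntegral] using hN.2
  have hmeas : Measurable fun t => (∫⁻ s, powKernel α (t - s) ∂(dataMeasure 0 τ N)) *
      (∫⁻ s, powKernel 0 (t - s) ∂(Measure.dirac 0)) := by
    have hm0 := measurable_powKernel 0
    refine Measurable.mul ?_ ?_
    · exact Measurable.lintegral_prod_right' (f := fun q : ℝ × ℝ => powKernel α (q.1 - q.2))
        (by fun_prop)
    · exact Measurable.lintegral_prod_right' (f := fun q : ℝ × ℝ => powKernel 0 (q.1 - q.2))
        (by fun_prop)
  filter_upwards [ae_lt_top' hmeas.aemeasurable hfin, ae_restrict_mem measurableSet_Ioc]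
    with t ht htm
  refine ⟨hU.aestronglyMeasurable_apply hN.1 t, ?_⟩
  refine (hU.lintegral_enorm_le hτ.2 N htm.2).trans_lt (ENNReal.mul_lt_top (by simp) ?_)
  have hm0 := measurable_powKernel 0
  rw [lintegral_dirac' _ (by fun_prop), sub_zero, powKernel.eq_1 0, if_pos htm.1, neg_zero, Real.rpow_zero, ENNReal.ofReal_one, mul_one,
    lintegral_dataMeasure _ hN.1 (by fun_prop)] at ht
  simpa using ht

/-- Datum and path cancel in the difference, hence the measure without atom. The bound is almost
everywhere because linearity of the Bochner integral needs integrability of both integrands. -/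
lemma ae_enorm_mildPart_sub_le (hU : IsSmoothingFamily U α C) (hα : 0 ≤ α) (hα1 : α < 1) {τ : ℝ}
    (hτ : τ ∈ Ioc (0 : ℝ) 1) (v₀ : E) (z : ℝ → F) {N N' : ℝ → E}
    (hN : IntegrableOn N (Ioc 0 τ)) (hN' : IntegrableOn N' (Ioc 0 τ)) :
    ∀ᵐ t ∂(volume.restrict (Ioc 0 τ)), ‖mildPart U τ v₀ z N t - mildPart U τ v₀ z N' t‖ₑ ≤
      C * ∫⁻ s, powKernel α (t - s) ∂(dataMeasure 0 τ (N - N')) := by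
  filter_upwards [hU.ae_integrable hα hα1 hτ hN, hU.ae_integrable hα hα1 hτ hN',
    ae_restrict_mem measurableSet_Ioc] with t h h' ht
  have : mildPart U τ v₀ z N t - mildPart U τ v₀ z N' t =
      ∫ s in Ioc 0 τ, U (t - s) ((N - N') s) := by
    simp only [mildPart, add_sub_add_left_eq_sub, Pi.sub_apply, map_sub]
    exact (integral_sub h h').symm
  rw [this]
  exact hU.enorm_integral_le hτ.2 (hN.1.sub hN'.1) ht

end IsSmoothingFamily

end MildPart

/-! ### Local solvability and the a priori bound for the quadratic fixed point equation. -/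

section FixedPoint

variable {E A B : Type*} [NormedAddCommGroup E] [NormedSpace ℝ E]
  [NormedAddCommGroup A] [NormedSpace ℝ A] [NormedAddCommGroup B] [NormedSpace ℝ B]
  {UA : ℝ → E →L[ℝ] A} {UB : ℝ → E →L[ℝ] B} {α β : ℝ} {C : ℝ≥0}

/-- The constant of the bilinear estimate on `(0,τ)`. -/
noncomputable def bilinConst (b : A →L[ℝ] B →L[ℝ] E) (C : ℝ≥0) (α β τ : ℝ) : ℝ≥0∞ :=
  ‖b‖ₑ * C * C * ENNReal.ofReal (τ ^ (1 - (α + β)) / (1 - (α + β)))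

lemma bilinConst_mono (b : A →L[ℝ] B →L[ℝ] E) (C : ℝ≥0) (hαβ : α + β < 1) {τ τ' : ℝ}
    (h0 : 0 ≤ τ') (h : τ' ≤ τ) : bilinConst b C α β τ' ≤ bilinConst b C α β τ := by
  have hγ : 0 < 1 - (α + β) := by linarith
  unfold bilinConst
  gcongr

/-- The exponent `1 - (α + β)` is positive, so the constant tends to `0` with `τ`. The factor `16`
is chosen to give Lipschitz constant `1/4` on the ball of radius `K + 1`. -/
lemma exists_bilinConst_mul_le (b : A →L[ℝ] B →L[ℝ] E) (C : ℝ≥0) (hαβ : α + β < 1) (K : ℝ≥0) :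
    ∃ τ ∈ Ioc (0 : ℝ) 1, bilinConst b C α β τ * (16 * (K + 1)) ≤ 1 := by
  have hγ : 0 < 1 - (α + β) := by linarith
  have h : Tendsto (fun τ : ℝ => (‖b‖ * C * C * (16 * (K + 1))) *
      (τ ^ (1 - (α + β)) / (1 - (α + β)))) (𝓝[>] 0) (𝓝 0) := by
    have : ContinuousAt (fun τ : ℝ => (‖b‖ * C * C * (16 * (K + 1))) *
      (τ ^ (1 - (α + β)) / (1 - (α + β)))) 0 :=
      ((Real.continuousAt_rpow_const _ _ (Or.inr hγ.le)).div_const _).const_mul _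
    have h2 := this.tendsto
    rw [Real.zero_rpow hγ.ne', zero_div, mul_zero] at h2
    exact h2.mono_left nhdsWithin_le_nhds
  obtain ⟨τ, h1, h2⟩ := ((h.eventually (ge_mem_nhds one_pos)).and
    (Ioc_mem_nhdsGT (one_pos : (0 : ℝ) < 1))).exists
  refine ⟨τ, h2, ?_⟩
  calc bilinConst b C α β τ * (16 * (K + 1))
      = ENNReal.ofReal ((‖b‖ * C * C * (16 * (K + 1))) *
      (τ ^ (1 - (α + β)) / (1 - (α + β)))) := by
        rw [bilinConst, ENNReal.ofReal_mul (by positivity), ENNReal.ofReal_mul (by positivity),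
          ENNReal.ofReal_mul (by positivity), ENNReal.ofReal_mul (by positivity),
          ENNReal.ofReal_mul (by positivity), ENNReal.ofReal_add (by positivity) (by positivity),
          show ENNReal.ofReal ‖b‖ = ‖b‖ₑ from ofReal_norm b, ENNReal.ofReal_coe_nnreal,
          ENNReal.ofReal_coe_nnreal]
        norm_num
        ring
    _ ≤ 1 := ENNReal.ofReal_le_one.2 h1

lemma lintegral_bilin_le (b : A →L[ℝ] B →L[ℝ] E) (hα : 0 ≤ α) (hβ : 0 ≤ β) (hαβ : α + β < 1)
    {τ : ℝ} (hτ : 0 ≤ τ) {m₁ m₂ : Measure ℝ} [SFinite m₁] [SFinite m₂] (h₁ : ∀ᵐ s ∂m₁, 0 ≤ s)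
    {f : ℝ → A} {g : ℝ → B}
    (hf : ∀ᵐ t ∂(volume.restrict (Ioc 0 τ)), ‖f t‖ₑ ≤ C * ∫⁻ s, powKernel α (t - s) ∂m₁)
    (hg : ∀ᵐ t ∂(volume.restrict (Ioc 0 τ)), ‖g t‖ₑ ≤ C * ∫⁻ s, powKernel β (t - s) ∂m₂) :
    ∫⁻ t in Ioc 0 τ, ‖b (f t) (g t)‖ₑ ≤ bilinConst b C α β τ * (m₁ univ * m₂ univ) := by
  calc ∫⁻ t in Ioc 0 τ, ‖b (f t) (g t)‖ₑ
      ≤ ∫⁻ t in Ioc 0 τ, (‖b‖ₑ * C * C) * ((∫⁻ s, powKernel α (t - s) ∂m₁) *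
          (∫⁻ s, powKernel β (t - s) ∂m₂)) := by
        refine lintegral_mono_ae ?_
        filter_upwards [hf, hg] with t h1 h2
        calc ‖b (f t) (g t)‖ₑ ≤ ‖b‖ₑ * ‖f t‖ₑ * ‖g t‖ₑ :=
              ((b (f t)).le_opENorm _).trans (mul_le_mul_left (b.le_opENorm _) _)
          _ ≤ ‖b‖ₑ * (C * ∫⁻ s, powKernel α (t - s) ∂m₁) *
              (C * ∫⁻ s, powKernel β (t - s) ∂m₂) := by gcongr
          _ = _ := by ring
    _ = (‖b‖ₑ * C * C) * ∫⁻ t in Ioc 0 τ, ((∫⁻ s, powKernel α (t - s) ∂m₁) *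
          (∫⁻ s, powKernel β (t - s) ∂m₂)) := by
        rw [lintegral_const_mul' _ _ (by finiteness)]
    _ ≤ _ := by
        rw [bilinConst, mul_assoc _ (ENNReal.ofReal _)]
        gcongr
        exact lintegral_conv_mul_conv_le hα hβ hαβ hτ h₁

/-- The fixed point map: the nonlinearity along the path driven by `N`. -/
noncomputable def picardMap (b : A →L[ℝ] B →L[ℝ] E) (UA : ℝ → E →L[ℝ] A) (UB : ℝ → E →L[ℝ] B)
    (τ : ℝ) (v₀ : E) (zA : ℝ → A) (zB : ℝ → B) (N : ℝ → E) (t : ℝ) : E :=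
  b (mildPart UA τ v₀ zA N t) (mildPart UB τ v₀ zB N t)

section Picard

variable {τ : ℝ} {v₀ : E} {zA : ℝ → A} {zB : ℝ → B} {Z K : ℝ≥0}

lemma lintegral_picardMap_le (b : A →L[ℝ] B →L[ℝ] E) (hα : 0 ≤ α) (hβ : 0 ≤ β) (hαβ : α + β < 1)
    (hC : 1 ≤ C) (hUA : IsSmoothingFamily UA α C) (hUB : IsSmoothingFamily UB β C)
    (hτ : τ ∈ Icc (0 : ℝ) 1) (hK : Z + ‖v₀‖₊ ≤ K)
    (hzA : ∀ᵐ t ∂(volume.restrict (Ioc 0 τ)), ‖zA t‖ₑ ≤ Z)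
    (hzB : ∀ᵐ t ∂(volume.restrict (Ioc 0 τ)), ‖zB t‖ₑ ≤ Z)
    {N : ℝ → E} (hN : AEStronglyMeasurable N (volume.restrict (Ioc 0 τ))) :
    ∫⁻ t in Ioc 0 τ, ‖picardMap b UA UB τ v₀ zA zB N t‖ₑ ≤
      bilinConst b C α β τ * (K + ∫⁻ t in Ioc 0 τ, ‖N t‖ₑ) ^ 2 := by
  rw [sq, ← dataMeasure_univ]
  refine lintegral_bilin_le b hα hβ hαβ hτ.1 (dataMeasure_nonneg _ _ _) ?_ ?_
  · filter_upwards [hzA, ae_restrict_mem measurableSet_Ioc] with t hz ht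
    exact hUA.enorm_mildPart_le hα hC hτ.2 v₀ hN ht hz hK
  · filter_upwards [hzB, ae_restrict_mem measurableSet_Ioc] with t hz ht
    exact hUB.enorm_mildPart_le hβ hC hτ.2 v₀ hN ht hz hK

lemma lintegral_picardMap_sub_le (b : A →L[ℝ] B →L[ℝ] E) (hα : 0 ≤ α) (hβ : 0 ≤ β)
    (hαβ : α + β < 1)
    (hC : 1 ≤ C) (hUA : IsSmoothingFamily UA α C) (hUB : IsSmoothingFamily UB β C)
    (hτ : τ ∈ Ioc (0 : ℝ) 1) (hK : Z + ‖v₀‖₊ ≤ K)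
    (hzA : ∀ᵐ t ∂(volume.restrict (Ioc 0 τ)), ‖zA t‖ₑ ≤ Z)
    (hzB : ∀ᵐ t ∂(volume.restrict (Ioc 0 τ)), ‖zB t‖ₑ ≤ Z)
    (hzAm : AEStronglyMeasurable zA (volume.restrict (Ioc 0 τ)))
    (hzBm : AEStronglyMeasurable zB (volume.restrict (Ioc 0 τ)))
    {N N' : ℝ → E} (hN : IntegrableOn N (Ioc 0 τ)) (hN' : IntegrableOn N' (Ioc 0 τ)) :
    ∫⁻ t in Ioc 0 τ, ‖picardMap b UA UB τ v₀ zA zB N t - picardMap b UA UB τ v₀ zA zB N' t‖ₑ ≤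
      bilinConst b C α β τ * ((∫⁻ t in Ioc 0 τ, ‖N t - N' t‖ₑ) *
        ((K + ∫⁻ t in Ioc 0 τ, ‖N t‖ₑ) + (K + ∫⁻ t in Ioc 0 τ, ‖N' t‖ₑ))) := by
  -- Polarization `b(f,g) - b(f',g') = b(f - f', g) + b(f', g - g')`: each term carries one
  -- difference, whose measure has no atom.
  have e : ∀ t, picardMap b UA UB τ v₀ zA zB N t - picardMap b UA UB τ v₀ zA zB N' t =
      b (mildPart UA τ v₀ zA N t - mildPart UA τ v₀ zA N' t) (mildPart UB τ v₀ zB N t) +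
      b (mildPart UA τ v₀ zA N' t) (mildPart UB τ v₀ zB N t - mildPart UB τ v₀ zB N' t) := by
    intro t
    simp only [picardMap, map_sub, sub_apply]
    abel
  have hd : ∫⁻ t in Ioc 0 τ, ‖N t - N' t‖ₑ = dataMeasure 0 τ (N - N') univ := by
    rw [dataMeasure_univ]
    simp
  have hA1 := hUA.ae_enorm_mildPart_sub_le hα (by linarith) hτ v₀ zA hN hN'
  have hB1 := hUB.ae_enorm_mildPart_sub_le hβ (by linarith) hτ v₀ zB hN hN'
  have hA2 : ∀ᵐ t ∂(volume.restrict (Ioc 0 τ)), ‖mildPart UA τ v₀ zA N' t‖ₑ ≤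
      C * ∫⁻ s, powKernel α (t - s) ∂(dataMeasure K τ N') := by
    filter_upwards [hzA, ae_restrict_mem measurableSet_Ioc] with t hz ht
    exact hUA.enorm_mildPart_le hα hC hτ.2 v₀ hN'.1 ht hz hK
  have hB2 : ∀ᵐ t ∂(volume.restrict (Ioc 0 τ)), ‖mildPart UB τ v₀ zB N t‖ₑ ≤
      C * ∫⁻ s, powKernel β (t - s) ∂(dataMeasure K τ N) := by
    filter_upwards [hzB, ae_restrict_mem measurableSet_Ioc] with t hz ht
    exact hUB.enorm_mildPart_le hβ hC hτ.2 v₀ hN.1 ht hz hK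
  have h1 := lintegral_bilin_le b hα hβ hαβ hτ.1.le (dataMeasure_nonneg _ _ _) hA1 hB2
  have h2 := lintegral_bilin_le b hα hβ hαβ hτ.1.le (dataMeasure_nonneg _ _ _) hA2 hB1
  have mA := hUA.aestronglyMeasurable_mildPart (τ := τ) v₀ hzAm hN.1
  have mA' := hUA.aestronglyMeasurable_mildPart (τ := τ) v₀ hzAm hN'.1
  have mB := hUB.aestronglyMeasurable_mildPart (τ := τ) v₀ hzBm hN.1
  have hm : AEStronglyMeasurable (fun t => b (mildPart UA τ v₀ zA N t - mildPart UA τ v₀ zA N' t)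
      (mildPart UB τ v₀ zB N t)) (volume.restrict (Ioc 0 τ)) :=
    b.aestronglyMeasurable_comp₂ (mA.sub mA') mB
  simp only [e]
  calc _ ≤ _ := lintegral_mono fun t => enorm_add_le _ _
    _ = _ := lintegral_add_left' hm.enorm _
    _ ≤ _ := add_le_add h1 h2
    _ = _ := by
      rw [hd, dataMeasure_univ K τ N, dataMeasure_univ K τ N']
      ring

/-- Local existence: the Picard map has an integrable fixed point on a short time interval. -/
lemma exists_picardMap_fixedPoint [CompleteSpace E] (b : A →L[ℝ] B →L[ℝ] E) (hα : 0 ≤ α)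
    (hβ : 0 ≤ β) (hαβ : α + β < 1)
    (hC : 1 ≤ C) (hUA : IsSmoothingFamily UA α C) (hUB : IsSmoothingFamily UB β C)
    (hτ : τ ∈ Ioc (0 : ℝ) 1) (hK : Z + ‖v₀‖₊ ≤ K)
    (hτK : bilinConst b C α β τ * (16 * (K + 1)) ≤ 1)
    (hzA : ∀ᵐ t ∂(volume.restrict (Ioc 0 τ)), ‖zA t‖ₑ ≤ Z)
    (hzB : ∀ᵐ t ∂(volume.restrict (Ioc 0 τ)), ‖zB t‖ₑ ≤ Z)
    (hzAm : AEStronglyMeasurable zA (volume.restrict (Ioc 0 τ)))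
    (hzBm : AEStronglyMeasurable zB (volume.restrict (Ioc 0 τ))) :
    ∃ N : ℝ → E, IntegrableOn N (Ioc 0 τ) ∧
      ∀ᵐ t ∂(volume.restrict (Ioc 0 τ)), N t = picardMap b UA UB τ v₀ zA zB N t := by
  set μ : Measure ℝ := volume.restrict (Ioc 0 τ) with hμ
  set κ := bilinConst b C α β τ with hκ
  have hint : ∀ N : Lp E 1 μ, Integrable (picardMap b UA UB τ v₀ zA zB N) μ := by
    intro N
    have hN := L1.integrable_coeFn N
    refine ⟨b.aestronglyMeasurable_comp₂ (hUA.aestronglyMeasurable_mildPart v₀ hzAm hN.1)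
      (hUB.aestronglyMeasurable_mildPart v₀ hzBm hN.1), ?_⟩
    refine (lintegral_picardMap_le b hα hβ hαβ hC hUA hUB ⟨hτ.1.le, hτ.2⟩ hK hzA hzB
      hN.1).trans_lt (ENNReal.mul_lt_top ?_ ?_)
    · rw [bilinConst]
      finiteness
    · have : ∫⁻ t in Ioc 0 τ, ‖N t‖ₑ < ∞ := hN.2
      exact ENNReal.pow_lt_top (by finiteness)
  let Φ : Lp E 1 μ → Lp E 1 μ := fun N => (hint N).toL1 _
  have hnorm : ∀ N : Lp E 1 μ, edist N 0 = ∫⁻ t, ‖N t‖ₑ ∂μ := by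
    intro N
    rw [edist_zero_right, Lp.enorm_def, eLpNorm_one_eq_lintegral_enorm]
  -- On the ball of radius `K + 1` the total mass `K + ‖N‖₁` is at most `2 (K + 1)`, so both the
  -- quadratic bound and the Lipschitz bound are controlled by `κ (K + 1)`.
  let s : Set (Lp E 1 μ) := Metric.closedEBall 0 (K + 1)
  have hs : ∀ N ∈ s, ∫⁻ t, ‖N t‖ₑ ∂μ ≤ K + 1 := fun N hN => (hnorm N).symm.trans_le hN
  have hmaps : MapsTo Φ s s := by
    intro N hN
    change edist (Φ N) 0 ≤ _
    rw [hnorm]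
    calc ∫⁻ t, ‖Φ N t‖ₑ ∂μ = ∫⁻ t, ‖picardMap b UA UB τ v₀ zA zB N t‖ₑ ∂μ := by
          refine lintegral_congr_ae ?_
          filter_upwards [(hint N).coeFn_toL1] with t ht
          rw [ht]
      _ ≤ κ * (K + ∫⁻ t in Ioc 0 τ, ‖N t‖ₑ) ^ 2 :=
          lintegral_picardMap_le b hα hβ hαβ hC hUA hUB ⟨hτ.1.le, hτ.2⟩ hK hzA hzB
            (L1.integrable_coeFn N).1
      _ ≤ κ * ((K + 1) + (K + 1)) ^ 2 := by
          gcongr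
          · exact le_self_add
          · exact hs N hN
      _ ≤ κ * (16 * (K + 1)) * (K + 1) := by
          rw [mul_assoc]
          gcongr
          ring_nf
          gcongr <;> norm_num
      _ ≤ 1 * (K + 1) := by gcongr
      _ = _ := one_mul _
  have hcontr : ContractingWith (1 / 4) (hmaps.restrict Φ s s) := by
    refine ⟨by rw [← NNReal.coe_lt_coe]; norm_num, fun N N' => ?_⟩
    change edist (Φ N) (Φ N') ≤ _ * edist (N : Lp E 1 μ) N'
    have e1 : edist (N : Lp E 1 μ) N' = ∫⁻ t, ‖(N : Lp E 1 μ) t - (N' : Lp E 1 μ) t‖ₑ ∂μ := by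
      rw [Lp.edist_def, eLpNorm_one_eq_lintegral_enorm]
      rfl
    have e2 : edist (Φ N) (Φ N') = ∫⁻ t, ‖picardMap b UA UB τ v₀ zA zB N t -
        picardMap b UA UB τ v₀ zA zB N' t‖ₑ ∂μ := by
      rw [Lp.edist_def, eLpNorm_one_eq_lintegral_enorm]
      refine lintegral_congr_ae ?_
      filter_upwards [(hint N).coeFn_toL1, (hint N').coeFn_toL1] with t h h'
      rw [Pi.sub_apply, h, h']
    rw [e1, e2]
    refine (lintegral_picardMap_sub_le b hα hβ hαβ hC hUA hUB hτ hK hzA hzB hzAm hzBm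
      (L1.integrable_coeFn (N : Lp E 1 μ)) (L1.integrable_coeFn (N' : Lp E 1 μ))).trans ?_
    set D := ∫⁻ t in Ioc 0 τ, ‖(N : Lp E 1 μ) t - (N' : Lp E 1 μ) t‖ₑ
    -- The factor `4 (K + 1)` bounds the sum of the total masses of `N` and `N'`.
    have h16 : κ * (4 * (K + 1)) ≤ (1 / 4 : ℝ≥0) := by
      have : (16 : ℝ≥0∞) = 4 * 4 := by norm_num
      rw [this, mul_assoc, mul_left_comm] at hτK
      rw [one_div, ENNReal.coe_inv (by norm_num), ENNReal.le_inv_iff_mul_le, mul_comm]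
      simpa using hτK
    calc κ * (D * ((K + ∫⁻ t in Ioc 0 τ, ‖(N : Lp E 1 μ) t‖ₑ) +
          (K + ∫⁻ t in Ioc 0 τ, ‖(N' : Lp E 1 μ) t‖ₑ)))
        ≤ κ * (D * (((K + 1) + (K + 1)) + ((K + 1) + (K + 1)))) := by
          gcongr
          · exact le_self_add
          · exact hs N N.2
          · exact le_self_add
          · exact hs N' N'.2
      _ = κ * (4 * (K + 1)) * D := by ring
      _ ≤ _ := by gcongr
  have h0 : (0 : Lp E 1 μ) ∈ s := by
    change edist _ _ ≤ _
    simp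
  obtain ⟨N, -, hN, -⟩ := hcontr.exists_fixedPoint' Metric.isClosed_closedEBall.isComplete hmaps h0
    (edist_ne_top _ _)
  refine ⟨N, L1.integrable_coeFn N, ?_⟩
  have hN' : Φ N = N := hN
  have h := (hint N).coeFn_toL1
  change (Φ N : ℝ → E) =ᵐ[μ] _ at h
  rw [hN'] at h
  exact h

end Picard

/-- A priori bound: an integrable function whose integral on `(0,t]` is controlled by the square of
the total mass stays bounded as long as the constant of that estimate is small. -/
lemma lintegral_le_of_forall_le_sq {E : Type*} [NormedAddCommGroup E] {g : ℝ → E} {t₁ : ℝ} (ht₁ : 0 ≤ t₁)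
    (hg : IntegrableOn g (Ioc 0 t₁)) {κ : ℝ≥0∞} {K : ℝ≥0} (hκ : κ * (16 * (K + 1)) ≤ 1)
    (h : ∀ t ∈ Icc 0 t₁, ∫⁻ s in Ioc 0 t, ‖g s‖ₑ ≤ κ * (K + ∫⁻ s in Ioc 0 t, ‖g s‖ₑ) ^ 2) :
    ∫⁻ s in Ioc 0 t₁, ‖g s‖ₑ ≤ K + 1 := by
  have hI : ∀ t ∈ Icc 0 t₁, ∫⁻ s in Ioc 0 t, ‖g s‖ₑ = ENNReal.ofReal (∫ s in Ioc 0 t, ‖g s‖) := by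
    intro t ht
    rw [ofReal_integral_norm_eq_lintegral_enorm (hg.mono_set (Ioc_subset_Ioc_right ht.2))]
  have hcont : ContinuousOn (fun t => ∫ s in Ioc 0 t, ‖g s‖) (Icc 0 t₁) :=
    intervalIntegral.continuousOn_primitive ((integrableOn_Icc_iff_integrableOn_Ioc (by simp)).2 hg).norm
  by_contra! hlt
  rw [hI t₁ ⟨ht₁, le_rfl⟩] at hlt
  have hlt' : (K + 1 : ℝ) < ∫ s in Ioc 0 t₁, ‖g s‖ := by
    have : ENNReal.ofReal (K + 1 : ℝ) = K + 1 := by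
      rw [ENNReal.ofReal_add (by positivity) (by positivity)]
      simp
    rw [← this] at hlt
    exact (ENNReal.ofReal_lt_ofReal_iff_of_nonneg (by positivity)).1 hlt
  -- The mass on `(0,t]` is continuous and starts at `0`, so exceeding `K + 1` would force equality
  -- at some `t`. There the quadratic estimate gives `K + 1 ≤ κ (2K + 1)² ≤ (K + 1) / 4`, which is
  -- absurd.
  obtain ⟨t, ht, hte⟩ := intermediate_value_Icc ht₁ hcont
    (show (K + 1 : ℝ) ∈ _ from ⟨by simp; positivity, hlt'.le⟩)
  have h2 := h t ht
  have e : ∫⁻ s in Ioc 0 t, ‖g s‖ₑ = K + 1 := by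
    rw [hI t ht]
    simp only at hte
    rw [hte, ENNReal.ofReal_add (by positivity) (by positivity)]
    simp
  rw [e] at h2
  have h3 : (K + 1 : ℝ≥0∞) ≤ κ * (4 * (K + 1)) * (K + 1) := by
    refine h2.trans ?_
    calc κ * (K + (K + 1)) ^ 2 ≤ κ * ((K + 1) + (K + 1)) ^ 2 := by
          gcongr
          exact le_self_add
      _ = _ := by ring
  have h4 : κ * (4 * (K + 1)) * 4 ≤ 1 := by
    refine le_trans (le_of_eq ?_) hκ
    ring
  have h5 : (K + 1 : ℝ≥0∞) * 4 ≤ K + 1 := by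
    calc (K + 1 : ℝ≥0∞) * 4 ≤ κ * (4 * (K + 1)) * (K + 1) * 4 := by gcongr
      _ = κ * (4 * (K + 1)) * 4 * (K + 1) := by ring
      _ ≤ 1 * (K + 1) := by gcongr
      _ = _ := one_mul _
  have h6 : (K + 1 : ℝ≥0) * 4 ≤ K + 1 := by exact_mod_cast h5
  have h7 : (0 : ℝ≥0) < K + 1 := by positivity
  rw [← NNReal.coe_le_coe] at h6
  rw [← NNReal.coe_lt_coe] at h7
  push_cast at h6 h7
  linarith

end FixedPoint
-- Translations on `Lᵖ`.
section Translate

variable {G : Type} [AddCommGroup G] [TopologicalSpace G] [MeasureSpace G] {d : ℕ}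
  [IsTopologicalAddGroup G] [BorelSpace G] [SecondCountableTopology G]
  [(volume : Measure G).IsAddHaarMeasure] {p : ℝ≥0∞}

lemma coeFn_translate (a : G) (f : LVec G d p) :
    translate a f =ᵐ[volume] fun x => f (x - a) :=
  Lp.coeFn_compMeasurePreserving f (measurePreserving_sub_right volume a)

lemma translate_zero (f : LVec G d p) : translate (0 : G) f = f := by
  refine Lp.ext ((coeFn_translate 0 f).trans ?_)
  simp

lemma translate_translate (a b : G) (f : LVec G d p) :
    translate a (translate b f) = translate (a + b) f := by
  refine Lp.ext ((coeFn_translate a _).trans ?_)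
  have h := (measurePreserving_sub_right (volume : Measure G) a).quasiMeasurePreserving.ae_eq_comp
    (coeFn_translate b f)
  filter_upwards [h, coeFn_translate (a + b) f] with x h1 h2
  rw [h2]
  simpa [sub_sub] using h1

variable [Fact (1 ≤ p)]

/-- Translation as a linear isometry of `Lᵖ`. -/
noncomputable def translateL (p : ℝ≥0∞) [Fact (1 ≤ p)] (a : G) :
    LVec G d p →ₗᵢ[ℝ] LVec G d p :=
  Lp.compMeasurePreservingₗᵢ ℝ (fun x : G => x - a) (measurePreserving_sub_right volume a)

lemma translateL_apply (a : G) (f : LVec G d p) : translateL p a f = translate a f := rfl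

lemma norm_translate (a : G) (f : LVec G d p) : ‖translate a f‖ = ‖f‖ :=
  (translateL p a).norm_map f

lemma continuous_translate [LocallyCompactSpace G] [T2Space G]
    (hp : p ≠ ∞) (f : LVec G d p) : Continuous fun a : G => translate a f := by
  -- Currying makes `a ↦ (x ↦ x - a)` continuous for the compact-open topology, which is the input
  -- for continuity of composition in `Lᵖ`.
  let g : C(G, C(G, G)) := (ContinuousMap.mk (fun q : G × G => q.2 - q.1)
    (by fun_prop)).curry
  exact (continuous_const (y := f)).compMeasurePreservingLp g.continuous
    (fun a => measurePreserving_sub_right volume a) hp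

end Translate

/-! ### Duality pairings with scalar functions. -/

section Pairing

variable {G : Type} [MeasureSpace G] {d : ℕ} {p : ℝ≥0∞} [Fact (1 ≤ p)]

instance fact_one_le_conjExponent : Fact (1 ≤ p.conjExponent) :=
  ⟨ENNReal.HolderConjugate.one_le _ p⟩

/-- Integration against a fixed scalar function of the dual exponent, as a functional on `Lᵖ`. -/
noncomputable def pairing {φ : G → ℝ} (hφ : MemLp φ p.conjExponent) :
    LVec G d p →L[ℝ] RVec d :=
  (ContinuousLinearMap.lsmul ℝ ℝ).lpPairing volume p.conjExponent p (hφ.toLp φ)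

lemma pairing_apply {φ : G → ℝ} (hφ : MemLp φ p.conjExponent) (f : LVec G d p) :
    pairing hφ f = ∫ x, φ x • f x := by
  rw [pairing, ContinuousLinearMap.lpPairing_eq_integral]
  refine integral_congr_ae ?_
  filter_upwards [hφ.coeFn_toLp] with x hx
  rw [hx]
  rfl

lemma memLp_indicator_one {s : Set G} (hs : MeasurableSet s) (hμ : volume s ≠ ∞) (q : ℝ≥0∞) :
    MemLp (s.indicator fun _ => (1 : ℝ)) q :=
  memLp_indicator_const q hs 1 (Or.inr hμ)

lemma pairing_indicator {s : Set G} (hs : MeasurableSet s) (hμ : volume s ≠ ∞)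
    (f : LVec G d p) : pairing (memLp_indicator_one hs hμ _) f = ∫ x in s, f x := by
  rw [pairing_apply, ← integral_indicator hs]
  refine integral_congr_ae (Eventually.of_forall fun x => ?_)
  by_cases hx : x ∈ s <;> simp [hx]

/-- Compares elements of two different Lebesgue spaces. Integrals over sets of finite measure are
continuous functionals on both, so they pass through Bochner integrals. -/
lemma ae_eq_of_forall_setIntegral_eq_of_lp {q : ℝ≥0∞} [Fact (1 ≤ q)] 
    [SigmaFinite (volume : Measure G)] (f : LVec G d p) (g : LVec G d q)
    (h : ∀ s, MeasurableSet s → volume s < ∞ → ∫ x in s, f x = ∫ x in s, g x) :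
    f =ᵐ[volume] g := by
  refine ae_eq_of_forall_setIntegral_eq_of_sigmaFinite ?_ ?_ h
  · intro s _ hμ
    have : IsFiniteMeasure (volume.restrict s) := ⟨by simpa⟩
    exact ((Lp.memLp f).restrict s).integrable Fact.out
  · intro s _ hμ
    have : IsFiniteMeasure (volume.restrict s) := ⟨by simpa⟩
    exact ((Lp.memLp g).restrict s).integrable Fact.out

end Pairing

/-! ### Convolution with integrable kernels along the covering map. -/

section Conv

variable {G : Type} [AddCommGroup G] [TopologicalSpace G] [MeasureSpace G] {d : ℕ}
  [IsTopologicalAddGroup G] [BorelSpace G] [SecondCountableTopology G]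
  [LocallyCompactSpace G] [T2Space G]
  [(volume : Measure G).IsAddHaarMeasure] {p : ℝ≥0∞} [Fact (1 ≤ p)]
  {π : RVec d → G} {a : RVec d → ℝ}

lemma integrable_smul_translate (hp : p ≠ ∞) (hπ : Continuous π) (ha : Integrable a)
    (f : LVec G d p) : Integrable fun y => a y • translate (π y) f := by
  refine (ha.norm.mul_const ‖f‖).mono'
    (ha.1.smul ((continuous_translate hp f).comp hπ).aestronglyMeasurable)
    (Eventually.of_forall fun y => ?_)
  rw [norm_smul, norm_translate]

/-- The operator `f ↦ ∫ a(y) f(· - π y) dy` on `Lᵖ(G)`. -/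
noncomputable def convL (hp : p ≠ ∞) (hπ : Continuous π) (ha : Integrable a) :
    LVec G d p →L[ℝ] LVec G d p :=
  LinearMap.mkContinuous
    { toFun := fun f => ∫ y, a y • translate (π y) f
      map_add' := fun f g => by
        rw [← integral_add (integrable_smul_translate hp hπ ha f)
          (integrable_smul_translate hp hπ ha g)]
        simp only [← translateL_apply, map_add, smul_add]
      map_smul' := fun c f => by
        rw [RingHom.id_apply, ← integral_smul]
        simp only [← translateL_apply, map_smul, smul_comm c] }
    (∫ y, ‖a y‖) fun f => by
      refine (norm_integral_le_integral_norm _).trans_eq ?_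
      rw [← integral_mul_const]
      simp only [norm_smul, norm_translate]

lemma convL_apply (hp : p ≠ ∞) (hπ : Continuous π) (ha : Integrable a) (f : LVec G d p) :
    convL hp hπ ha f = ∫ y, a y • translate (π y) f := rfl

lemma norm_convL_le (hp : p ≠ ∞) (hπ : Continuous π) (ha : Integrable a) (f : LVec G d p) :
    ‖convL hp hπ ha f‖ ≤ (∫ y, ‖a y‖) * ‖f‖ :=
  ((convL hp hπ ha).le_opNorm f).trans (mul_le_mul_of_nonneg_right
    (LinearMap.mkContinuous_norm_le _ (by positivity) _) (norm_nonneg f))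

/-- Integrability on the product `G × ℝᵈ` from uniform bounds on the slices. -/
lemma integrable_prod_of_forall_integral_le {h : G × RVec d → RVec d}
    (hm : AEStronglyMeasurable h (volume.prod volume)) {M : ℝ} (ha : Integrable a)
    (hi : ∀ y, Integrable fun x => h (x, y)) (hM : ∀ y, ∫ x, ‖h (x, y)‖ ≤ ‖a y‖ * M) :
    Integrable h (volume.prod volume) := by
  rw [integrable_prod_iff' hm]
  refine ⟨Eventually.of_forall hi, (ha.norm.mul_const M).mono' hm.norm.prod_swap.integral_prod_right'
    (Eventually.of_forall fun y => ?_)⟩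
  rw [Real.norm_of_nonneg (by positivity)]
  exact hM y

lemma integrable_smul_lp {φ : G → ℝ} (hφ : MemLp φ p.conjExponent) (f : LVec G d p) :
    Integrable fun x => φ x • f x := by
  have h : MemLp (φ • (f : G → RVec d)) 1 volume :=
    MemLp.smul (p := p.conjExponent) (q := p) (Lp.memLp f) hφ
  exact memLp_one_iff_integrable.1 h

lemma integral_norm_smul_le {φ : G → ℝ} (hφ : MemLp φ p.conjExponent) (f : LVec G d p) :
    ∫ x, ‖φ x • f x‖ ≤ (eLpNorm φ p.conjExponent volume).toReal * ‖f‖ := by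
  rw [integral_norm_eq_lintegral_enorm (integrable_smul_lp hφ f).1, Lp.norm_def,
    ← ENNReal.toReal_mul, ← eLpNorm_one_eq_lintegral_enorm]
  have h : eLpNorm (φ • (f : G → RVec d)) 1 volume ≤
      eLpNorm φ p.conjExponent volume * eLpNorm f p volume :=
    eLpNorm_smul_le_mul_eLpNorm (p := p.conjExponent) (q := p) (Lp.memLp f).1 hφ.1
  exact ENNReal.toReal_mono (ENNReal.mul_ne_top hφ.2.ne (Lp.memLp f).2.ne) h

lemma memLp_comp_add {φ : G → ℝ} {q : ℝ≥0∞} (hφ : MemLp φ q) (b : G) :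
    MemLp (fun x => φ (x + b)) q :=
  hφ.comp_measurePreserving (measurePreserving_add_right volume b)

lemma eLpNorm_comp_add {φ : G → ℝ} {q : ℝ≥0∞} (hφ : MemLp φ q) (b : G) :
    eLpNorm (fun x => φ (x + b)) q volume = eLpNorm φ q volume :=
  eLpNorm_comp_measurePreserving hφ.1 (measurePreserving_add_right volume b)

lemma pairing_translate (φ : G → ℝ) (b : G) (f : LVec G d p) :
    ∫ x, φ x • translate b f x = ∫ x, φ (x + b) • f x := by
  rw [← integral_add_right_eq_self (fun x => φ x • translate b f x) b]
  refine integral_congr_ae ?_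
  have h := (measurePreserving_add_right (volume : Measure G) b).quasiMeasurePreserving.ae_eq_comp
    (coeFn_translate b f)
  filter_upwards [h] with x hx
  have hx' : translate b f (x + b) = f x := by simpa using hx
  rw [hx']

/-- Convolution is moved to the test function. -/
lemma integral_smul_convL (hp : p ≠ ∞) (hπ : Continuous π) (ha : Integrable a) {φ : G → ℝ}
    (hφm : StronglyMeasurable φ) (hφ : MemLp φ p.conjExponent) (f : LVec G d p) :
    ∫ x, φ x • convL hp hπ ha f x = ∫ x, (∫ y, a y * φ (x + π y)) • f x := by
  have hint : Integrable (fun q : G × RVec d => a q.2 • φ (q.1 + π q.2) • f q.1)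
      (volume.prod volume) := by
    refine integrable_prod_of_forall_integral_le (M := (eLpNorm φ p.conjExponent volume).toReal * ‖f‖)
      ?_ ha (fun y => ?_) (fun y => ?_)
    · refine (ha.1.comp_snd (μ := (volume : Measure G))).smul ?_
      refine (hφm.comp_measurable ?_).aestronglyMeasurable.smul (Lp.memLp f).1.comp_fst
      exact (measurable_fst.add (hπ.measurable.comp measurable_snd))
    · exact (integrable_smul_lp (memLp_comp_add hφ (π y)) f).smul (a y)
    · simp only [norm_smul (a y)]
      rw [integral_const_mul, ← eLpNorm_comp_add hφ (π y)]
      exact mul_le_mul_of_nonneg_left (integral_norm_smul_le (memLp_comp_add hφ (π y)) f)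
        (norm_nonneg _)
  calc ∫ x, φ x • convL hp hπ ha f x
      = pairing hφ (∫ y, a y • translate (π y) f) := (pairing_apply hφ _).symm
    _ = ∫ y, a y • ∫ x, φ (x + π y) • f x := by
        rw [← ContinuousLinearMap.integral_comp_comm _ (integrable_smul_translate hp hπ ha f)]
        refine integral_congr_ae (Eventually.of_forall fun y => ?_)
        simp only [map_smul, pairing_apply]
        rw [pairing_translate]
    _ = ∫ y, ∫ x, a y • φ (x + π y) • f x := by simp only [integral_smul]
    _ = ∫ x, ∫ y, a y • φ (x + π y) • f x := (integral_integral_swap hint).symm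
    _ = ∫ x, (∫ y, a y * φ (x + π y)) • f x := by
        refine integral_congr_ae (Eventually.of_forall fun x => ?_)
        simp only [smul_smul]
        rw [integral_smul_const]

/-- The pointwise representation of `convL`. -/
lemma convL_ae_eq (hp : p ≠ ∞) (hπ : Continuous π) (ha : Integrable a) (f : LVec G d p) :
    convL hp hπ ha f =ᵐ[volume] fun x => ∫ y, a y • f (x - π y) := by
  have hfm := Lp.stronglyMeasurable f
  have htr : ∀ y, (fun x => f (x - π y)) =ᵐ[volume] translate (π y) f :=
    fun y => (coeFn_translate _ _).symm
  have hint : ∀ s : Set G, MeasurableSet s → volume s < ∞ →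
      Integrable (fun q : G × RVec d => a q.2 • f (q.1 - π q.2))
        ((volume.restrict s).prod volume) := by
    intro s hs hμ
    have hφ := memLp_indicator_one hs hμ.ne p.conjExponent
    have h : Integrable (fun q : G × RVec d =>
        a q.2 • s.indicator (fun _ => (1 : ℝ)) q.1 • f (q.1 - π q.2)) (volume.prod volume) := by
      refine integrable_prod_of_forall_integral_le
        (M := (eLpNorm (s.indicator fun _ => (1 : ℝ)) p.conjExponent volume).toReal * ‖f‖)
        ?_ ha (fun y => ?_) (fun y => ?_)
      · refine (ha.1.comp_snd (μ := (volume : Measure G))).smul ?_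
        refine hφ.1.comp_fst.smul (hfm.comp_measurable ?_).aestronglyMeasurable
        exact (measurable_fst.sub (hπ.measurable.comp measurable_snd))
      · refine ((integrable_smul_lp hφ (translate (π y) f)).congr ?_).smul (a y)
        filter_upwards [htr y] with x hx
        rw [hx]
      · simp only [norm_smul (a y)]
        rw [integral_const_mul, ← norm_translate (π y) f]
        refine mul_le_mul_of_nonneg_left ((integral_congr_ae ?_).trans_le
          (integral_norm_smul_le hφ (translate (π y) f))) (norm_nonneg _)
        filter_upwards [htr y] with x hx
        rw [hx]
    have e : (volume.restrict s).prod (volume : Measure (RVec d)) =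
        ((volume : Measure G).prod volume).restrict (s ×ˢ univ) := by
      rw [← Measure.prod_restrict, Measure.restrict_univ]
    rw [e]
    refine (h.mono_measure Measure.restrict_le_self).congr ?_
    filter_upwards [ae_restrict_mem (hs.prod MeasurableSet.univ)] with q hq
    simp [hq.1]
  -- The operator is a Bochner integral in `Lᵖ`, without pointwise meaning a priori. Testing with
  -- sets of finite measure turns both sides into scalar-weighted iterated integrals that Fubini
  -- identifies.
  refine ae_eq_of_forall_setIntegral_eq_of_sigmaFinite ?_ ?_ ?_
  · intro s _ hμ
    have : IsFiniteMeasure (volume.restrict s) := ⟨by simpa⟩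
    exact ((Lp.memLp _).restrict s).integrable Fact.out
  · intro s hs hμ
    exact (hint s hs hμ).integral_prod_left
  · intro s hs hμ
    rw [← pairing_indicator hs hμ.ne, convL_apply,
      ← ContinuousLinearMap.integral_comp_comm _ (integrable_smul_translate hp hπ ha f),
      integral_integral_swap (hint s hs hμ)]
    refine integral_congr_ae (Eventually.of_forall fun y => ?_)
    beta_reduce
    rw [map_smul, pairing_indicator hs hμ.ne, integral_smul]
    congr 1
    exact setIntegral_congr_ae hs ((htr y).mono fun x hx _ => hx.symm)

end Conv
-- The Gaussian kernel and its gradient.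
section HeatKernel

variable {d : ℕ} {ν : ℝ}

lemma heatKernel_eq (ν t : ℝ) (y : RVec d) : heatKernel ν t y =
    (4 * Real.pi * ν * t) ^ (-(d : ℝ) / 2) * Real.exp (-(4 * ν * t)⁻¹ * ‖y‖ ^ 2) := by
  rw [heatKernel]
  congr 2
  ring

lemma heatKernel_nonneg (hν : 0 < ν) {t : ℝ} (ht : 0 < t) (y : RVec d) : 0 ≤ heatKernel ν t y := by
  unfold heatKernel
  positivity

lemma continuous_heatKernel (ν t : ℝ) : Continuous (heatKernel ν t : RVec d → ℝ) := by
  unfold heatKernel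
  fun_prop

lemma integral_exp_neg_mul_sq_norm {b : ℝ} (hb : 0 < b) :
    ∫ y : RVec d, Real.exp (-b * ‖y‖ ^ 2) = (Real.pi / b) ^ ((d : ℝ) / 2) := by
  simpa using GaussianFourier.integral_rexp_neg_mul_sq_norm (V := RVec d) hb

lemma integrable_exp_neg_mul_sq_norm {b : ℝ} (hb : 0 < b) :
    Integrable fun y : RVec d => Real.exp (-b * ‖y‖ ^ 2) := by
  -- A nonintegrable function has Bochner integral `0`, so the nonzero value of the Gaussian
  -- integral already proves integrability.
  refine Integrable.of_integral_ne_zero ?_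
  rw [integral_exp_neg_mul_sq_norm hb]
  positivity

lemma integrable_heatKernel (hν : 0 < ν) {t : ℝ} (ht : 0 < t) :
    Integrable (heatKernel ν t : RVec d → ℝ) := by
  simp only [funext (heatKernel_eq ν t)]
  exact (integrable_exp_neg_mul_sq_norm (by positivity)).const_mul _

lemma integral_heatKernel (hν : 0 < ν) {t : ℝ} (ht : 0 < t) :
    ∫ y : RVec d, heatKernel ν t y = 1 := by
  simp only [heatKernel_eq]
  rw [integral_const_mul, integral_exp_neg_mul_sq_norm (by positivity), neg_div,
    Real.rpow_neg (by positivity), div_inv_eq_mul]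
  rw [show Real.pi * (4 * ν * t) = 4 * Real.pi * ν * t by ring]
  exact inv_mul_cancel₀ (by positivity)

lemma integral_norm_heatKernel (hν : 0 < ν) {t : ℝ} (ht : 0 < t) :
    ∫ y : RVec d, ‖heatKernel ν t y‖ = 1 := by
  simp only [Real.norm_of_nonneg (heatKernel_nonneg hν ht _)]
  exact integral_heatKernel hν ht

/-- The heat kernels form a convolution semigroup. -/
lemma integral_heatKernel_mul_heatKernel_sub (hν : 0 < ν) {s t : ℝ} (hs : 0 < s) (ht : 0 < t)
    (w : RVec d) :
    ∫ y, heatKernel ν s y * heatKernel ν t (w - y) = heatKernel ν (s + t) w := by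
  set b := (4 * ν * s)⁻¹ with hb
  set c := (4 * ν * t)⁻¹ with hc
  have hb0 : 0 < b := by positivity
  have hc0 : 0 < c := by positivity
  -- Completing the square in `y`; the leftover coefficient of `‖w‖²` is `bc/(b+c) = (4ν(s+t))⁻¹`.
  have key : ∀ y : RVec d, -b * ‖y‖ ^ 2 + -c * ‖w - y‖ ^ 2 =
      -(4 * ν * (s + t))⁻¹ * ‖w‖ ^ 2 + -(b + c) * ‖y - (c / (b + c)) • w‖ ^ 2 := by
    intro y
    have e1 : (4 * ν * (s + t))⁻¹ = b * c / (b + c) := by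
      rw [hb, hc]
      field_simp
      ring
    rw [e1, norm_sub_sq_real, norm_sub_sq_real, norm_smul, inner_smul_right,
      Real.norm_of_nonneg (by positivity), real_inner_comm]
    field_simp
    ring
  have e2 : ∀ y : RVec d, heatKernel ν s y * heatKernel ν t (w - y) =
      ((4 * Real.pi * ν * s) ^ (-(d : ℝ) / 2) * (4 * Real.pi * ν * t) ^ (-(d : ℝ) / 2) *
        Real.exp (-(4 * ν * (s + t))⁻¹ * ‖w‖ ^ 2)) *
          Real.exp (-(b + c) * ‖y - (c / (b + c)) • w‖ ^ 2) := by
    intro y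
    rw [heatKernel_eq, heatKernel_eq, mul_assoc _ (Real.exp _) (Real.exp _), ← Real.exp_add, ← key,
      Real.exp_add]
    ring
  simp only [e2]
  rw [integral_const_mul, integral_sub_right_eq_self
    (fun y : RVec d => Real.exp (-(b + c) * ‖y‖ ^ 2)),
    integral_exp_neg_mul_sq_norm (by positivity), heatKernel_eq]
  have e3 : Real.pi / (b + c) = (4 * Real.pi * ν * s) * (4 * Real.pi * ν * t) /
      (4 * Real.pi * ν * (s + t)) := by
    rw [hb, hc]
    field_simp
    ring
  rw [e3, neg_div, Real.rpow_neg (by positivity), Real.rpow_neg (by positivity),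
    Real.rpow_neg (by positivity), Real.div_rpow (by positivity) (by positivity),
    Real.mul_rpow (x := 4 * Real.pi * ν * s) (by positivity) (by positivity)]
  have h1 : (4 * Real.pi * ν * s) ^ ((d : ℝ) / 2) ≠ 0 := by positivity
  have h2 : (4 * Real.pi * ν * t) ^ ((d : ℝ) / 2) ≠ 0 := by positivity
  field_simp

/-- The substitution `y = √t w` moves the time from the kernel into the argument, which removes the
singularity at `t = 0`. -/
lemma integral_heatKernel_smul {E : Type*} [NormedAddCommGroup E] [NormedSpace ℝ E] (hν : 0 < ν)
    {t : ℝ} (ht : 0 < t) (F : RVec d → E) :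
    ∫ y, heatKernel ν t y • F y = ∫ w, heatKernel ν 1 w • F (√t • w) := by
  have h := Measure.integral_comp_smul (volume : Measure (RVec d))
    (fun y => heatKernel ν 1 ((√t)⁻¹ • y) • F y) (√t)
  have hst : 0 < √t := Real.sqrt_pos.2 ht
  simp only [smul_smul, inv_mul_cancel₀ hst.ne', one_smul] at h
  rw [h, ← integral_smul]
  refine integral_congr_ae (Eventually.of_forall fun y => ?_)
  simp only [smul_smul]
  congr 1
  rw [heatKernel_eq, heatKernel_eq, norm_smul, finrank_euclideanSpace, Fintype.card_fin,
    abs_of_pos (by positivity), norm_inv, Real.norm_of_nonneg hst.le, mul_pow, inv_pow,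
    Real.sq_sqrt ht.le, mul_one, mul_one, Real.mul_rpow (by positivity) ht.le]
  have e : (√t ^ d)⁻¹ = t ^ (-(d : ℝ) / 2) := by
    rw [neg_div, Real.rpow_neg ht.le, Real.sqrt_eq_rpow, ← Real.rpow_natCast, ← Real.rpow_mul ht.le]
    congr 2
    ring
  rw [e]
  have e2 : -(4 * ν)⁻¹ * (t⁻¹ * ‖y‖ ^ 2) = -(4 * ν * t)⁻¹ * ‖y‖ ^ 2 := by
    rw [mul_inv (4 * ν) t]
    ring
  rw [e2]
  ring

/-- The partial derivative of the heat kernel. -/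
noncomputable def heatKernelDeriv (ν : ℝ) (j : Fin d) (t : ℝ) (y : RVec d) : ℝ :=
  -(y j / (2 * ν * t)) * heatKernel ν t y

lemma hasLineDerivAt_heatKernel (hν : 0 < ν) {t : ℝ} (ht : 0 < t) (j : Fin d) (y : RVec d) :
    HasLineDerivAt ℝ (heatKernel ν t) (heatKernelDeriv ν j t y) y (EuclideanSpace.single j 1) := by
  have h1 : HasDerivAt (fun s : ℝ => ‖y + s • EuclideanSpace.single j (1 : ℝ)‖ ^ 2) (2 * y j) 0 := by
    have e : ∀ s : ℝ, ‖y + s • EuclideanSpace.single j (1 : ℝ)‖ ^ 2 =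
        ‖y‖ ^ 2 + (2 * y j) * s + s ^ 2 := by
      intro s
      rw [norm_add_sq_real, inner_smul_right, norm_smul, EuclideanSpace.inner_single_right]
      simp
      ring
    simp only [e]
    have := (((hasDerivAt_id (0 : ℝ)).const_mul (2 * y j)).const_add (‖y‖ ^ 2)).add
      ((hasDerivAt_id (0 : ℝ)).pow 2)
    convert! this using 1
    simp
  have h2 := ((h1.const_mul (-(4 * ν * t)⁻¹)).exp).const_mul ((4 * Real.pi * ν * t) ^ (-(d : ℝ) / 2))
  unfold HasLineDerivAt
  simp only [heatKernel_eq]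
  convert! h2 using 1
  rw [heatKernelDeriv, heatKernel_eq]
  simp only [zero_smul, add_zero]
  field_simp
  ring

lemma continuous_heatKernelDeriv (ν : ℝ) (j : Fin d) (t : ℝ) :
    Continuous (heatKernelDeriv ν j t : RVec d → ℝ) := by
  unfold heatKernelDeriv
  have := continuous_heatKernel (d := d) ν t
  fun_prop

/-- The constant in the pointwise bound of the gradient of the heat kernel. -/
noncomputable def heatDerivConst (d : ℕ) (ν : ℝ) : ℝ := 2 ^ ((d : ℝ) / 2) * √(2 / ν)

/-- Half of the Gaussian exponent absorbs the linear factor: with `r = ‖y‖ / √(8νt)` one has `r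
exp(-r²) ≤ 1`, and the other half is the heat kernel at time `2t` up to normalization. -/
lemma abs_heatKernelDeriv_le (hν : 0 < ν) {t : ℝ} (ht : 0 < t) (j : Fin d) (y : RVec d) :
    |heatKernelDeriv ν j t y| ≤ heatDerivConst d ν * t ^ (-(1 / 2) : ℝ) * heatKernel ν (2 * t) y := by
  set r := ‖y‖ / √(8 * ν * t) with hr
  have h8 : 0 < √(8 * ν * t) := Real.sqrt_pos.2 (by positivity)
  have hy : ‖y‖ = r * √(8 * ν * t) := by rw [hr, div_mul_cancel₀ _ h8.ne']
  have hr0 : 0 ≤ r := by positivity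
  have hyj : |y j| ≤ ‖y‖ := PiLp.norm_apply_le y j
  have hre : r * Real.exp (-r ^ 2) ≤ 1 := by
    rw [Real.exp_neg, ← div_eq_mul_inv, div_le_one (Real.exp_pos _)]
    nlinarith [Real.add_one_le_exp (r ^ 2), sq_nonneg (r - 1)]
  have hr2 : r ^ 2 = ‖y‖ ^ 2 / (8 * ν * t) := by
    rw [hr, div_pow, Real.sq_sqrt (by positivity)]
  have e1 : heatKernel ν t y = 2 ^ ((d : ℝ) / 2) * heatKernel ν (2 * t) y * Real.exp (-r ^ 2) := by
    have ee : Real.exp (-(4 * ν * t)⁻¹ * ‖y‖ ^ 2) =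
        Real.exp (-(4 * ν * (2 * t))⁻¹ * ‖y‖ ^ 2) * Real.exp (-r ^ 2) := by
      rw [← Real.exp_add, hr2]
      congr 1
      field_simp
      ring
    have eA : (4 * Real.pi * ν * t) ^ (-(d : ℝ) / 2) =
        2 ^ ((d : ℝ) / 2) * (4 * Real.pi * ν * (2 * t)) ^ (-(d : ℝ) / 2) := by
      rw [show 4 * Real.pi * ν * (2 * t) = 2 * (4 * Real.pi * ν * t) by ring,
        Real.mul_rpow (x := 2) (by positivity) (by positivity), ← mul_assoc,
        ← Real.rpow_add (by positivity), show (d : ℝ) / 2 + -(d : ℝ) / 2 = 0 by ring, Real.rpow_zero, one_mul]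
    rw [heatKernel_eq, heatKernel_eq, ee, eA]
    ring
  have e2 : √(8 * ν * t) / (2 * ν * t) = √(2 / ν) * t ^ (-(1 / 2) : ℝ) := by
    rw [Real.rpow_neg ht.le, ← Real.sqrt_eq_rpow, ← Real.sqrt_inv, ← Real.sqrt_mul (by positivity),
      div_eq_iff (by positivity)]
    rw [Real.sqrt_eq_iff_mul_self_eq (by positivity) (by positivity), mul_mul_mul_comm,
      Real.mul_self_sqrt (by positivity)]
    field_simp
    ring
  have hk := heatKernel_nonneg (d := d) hν (t := 2 * t) (by positivity) y
  calc |heatKernelDeriv ν j t y|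
      = |y j| / (2 * ν * t) * heatKernel ν t y := by
        rw [heatKernelDeriv, abs_mul, abs_neg, abs_div, abs_of_pos (show 0 < 2 * ν * t by positivity),
          abs_of_nonneg (heatKernel_nonneg hν ht y)]
    _ ≤ ‖y‖ / (2 * ν * t) * heatKernel ν t y := by
        have := heatKernel_nonneg hν ht y
        gcongr
    _ = (r * Real.exp (-r ^ 2)) * (2 ^ ((d : ℝ) / 2) * (√(8 * ν * t) / (2 * ν * t)) *
          heatKernel ν (2 * t) y) := by
        rw [e1, hy]
        ring
    _ ≤ 1 * (2 ^ ((d : ℝ) / 2) * (√(8 * ν * t) / (2 * ν * t)) * heatKernel ν (2 * t) y) := by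
        gcongr
    _ = _ := by
        rw [e2, heatDerivConst]
        ring

lemma integrable_heatKernelDeriv (hν : 0 < ν) {t : ℝ} (ht : 0 < t) (j : Fin d) :
    Integrable (heatKernelDeriv ν j t : RVec d → ℝ) :=
  ((integrable_heatKernel hν (t := 2 * t) (by positivity)).const_mul _).mono'
    (continuous_heatKernelDeriv ν j t).aestronglyMeasurable
    (Eventually.of_forall fun y => abs_heatKernelDeriv_le hν ht j y)

end HeatKernel
-- The heat semigroup on `Lᵖ` and the Duhamel formula.
section HeatSemigroup

variable {G : Type} [AddCommGroup G] [TopologicalSpace G] [MeasureSpace G] {d : ℕ}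
  [IsTopologicalAddGroup G] [BorelSpace G] [SecondCountableTopology G]
  [LocallyCompactSpace G] [T2Space G]
  [(volume : Measure G).IsAddHaarMeasure] {p : ℝ≥0∞} [Fact (1 ≤ p)]
  {π : RVec d → G} {a b c : RVec d → ℝ} {ν : ℝ}

/-- Additivity of `π` makes translations along it compose additively; after shifting the inner
variable, Fubini leaves the convolution of the two kernels. -/
lemma convL_convL (hp : p ≠ ∞) (hπ : Continuous π) (hadd : ∀ x y, π (x + y) = π x + π y)
    (ha : Integrable a) (hb : Integrable b) (hc : Integrable c)
    (habc : ∀ w, ∫ y, a y * b (w - y) = c w) (f : LVec G d p) :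
    convL hp hπ ha (convL hp hπ hb f) = convL hp hπ hc f := by
  have hint : Integrable (fun q : RVec d × RVec d => (a q.2 * b (q.1 - q.2)) • translate (π q.1) f)
      (volume.prod volume) := by
    have h := ha.convolution_integrand (ContinuousLinearMap.mul ℝ ℝ) hb
    refine (h.norm.mul_const ‖f‖).mono' ?_ (Eventually.of_forall fun q => ?_)
    · exact h.1.smul ((continuous_translate hp f).comp (hπ.comp continuous_fst)).aestronglyMeasurable
    · rw [norm_smul, norm_translate]
      rfl
  calc convL hp hπ ha (convL hp hπ hb f)
      = ∫ y, a y • translateL p (π y) (∫ w, b w • translate (π w) f) := rfl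
    _ = ∫ y, ∫ w, (a y * b (w - y)) • translate (π w) f := by
        refine integral_congr_ae (Eventually.of_forall fun y => ?_)
        beta_reduce
        rw [← LinearIsometry.coe_toContinuousLinearMap, ← ContinuousLinearMap.integral_comp_comm _
          (integrable_smul_translate hp hπ hb f), ← integral_smul,
          ← integral_sub_right_eq_self _ y]
        refine integral_congr_ae (Eventually.of_forall fun w => ?_)
        beta_reduce
        rw [map_smul, LinearIsometry.coe_toContinuousLinearMap, translateL_apply,
          translate_translate, ← hadd, add_sub_cancel, smul_smul]
    _ = ∫ w, ∫ y, (a y * b (w - y)) • translate (π w) f := (integral_integral_swap hint).symm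
    _ = ∫ w, c w • translate (π w) f := by
        refine integral_congr_ae (Eventually.of_forall fun w => ?_)
        beta_reduce
        rw [integral_smul_const, habc]

/-- The heat semigroup for positive times as a bounded operator, extended by zero. -/
noncomputable def heatL (hp : p ≠ ∞) (hπ : Continuous π) (hν : 0 < ν) (t : ℝ) :
    LVec G d p →L[ℝ] LVec G d p :=
  if h : 0 < t then convL hp hπ (integrable_heatKernel hν h) else 0

lemma heatL_of_pos (hp : p ≠ ∞) (hπ : Continuous π) (hν : 0 < ν) {t : ℝ} (ht : 0 < t) :
    (heatL hp hπ hν t : LVec G d p →L[ℝ] LVec G d p) =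
      convL hp hπ (integrable_heatKernel hν ht) := dif_pos ht

lemma heatSemigroup_zero (f : LVec G d p) : heatSemigroup π ν 0 f = f := if_pos rfl

lemma heatSemigroup_of_pos (hp : p ≠ ∞) (hπ : Continuous π) (hν : 0 < ν) {t : ℝ} (ht : 0 < t)
    (f : LVec G d p) : heatSemigroup π ν t f = heatL hp hπ hν t f := by
  rw [heatL_of_pos hp hπ hν ht, heatSemigroup, if_neg ht.ne']
  rfl

lemma heatSemigroup_eq_integral (hadd : ∀ x y, π (x + y) = π x + π y) (hν : 0 < ν) {t : ℝ} (ht : 0 ≤ t) (f : LVec G d p) :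
    heatSemigroup π ν t f = ∫ w, heatKernel ν 1 w • translate (π (√t • w)) f := by
  rcases ht.eq_or_lt with rfl | ht
  · have h0 : π 0 = 0 := by simpa using hadd 0 0
    simp only [Real.sqrt_zero, zero_smul, h0, translate_zero, heatSemigroup_zero]
    rw [integral_smul_const, integral_heatKernel hν one_pos, one_smul]
  · rw [heatSemigroup, if_neg ht.ne', integral_heatKernel_smul hν ht]

/-- In the rescaled formula time enters only through the translation, so dominated convergence and
continuity of translations in `Lᵖ` also cover `t = 0`. -/
lemma continuousOn_heatSemigroup (hp : p ≠ ∞) (hπ : Continuous π)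
    (hadd : ∀ x y, π (x + y) = π x + π y) (hν : 0 < ν) (f : LVec G d p) :
    ContinuousOn (fun t => heatSemigroup π ν t f) (Ici 0) := by
  have h : Continuous fun t : ℝ => ∫ w, heatKernel ν 1 w • translate (π (√t • w)) f := by
    refine continuous_of_dominated (bound := fun w => ‖heatKernel ν 1 w‖ * ‖f‖) (fun t => ?_)
      (fun t => Eventually.of_forall fun w => ?_)
      ((integrable_heatKernel hν one_pos).norm.mul_const _) (Eventually.of_forall fun w => ?_)
    · exact ((continuous_heatKernel ν 1).smul ((continuous_translate hp f).comp
        (hπ.comp (continuous_const_smul (√t))))).aestronglyMeasurable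
    · rw [norm_smul, norm_translate]
    · exact (continuous_const (y := heatKernel ν 1 w)).smul ((continuous_translate hp f).comp
        (hπ.comp (Real.continuous_sqrt.smul continuous_const)))
  exact h.continuousOn.congr fun t ht => heatSemigroup_eq_integral hadd hν ht f

lemma norm_heatSemigroup_le (hp : p ≠ ∞) (hπ : Continuous π) (hν : 0 < ν) {t : ℝ} (ht : 0 ≤ t)
    (f : LVec G d p) : ‖heatSemigroup π ν t f‖ ≤ ‖f‖ := by
  rcases ht.eq_or_lt with rfl | ht
  · rw [heatSemigroup_zero]
  · rw [heatSemigroup_of_pos hp hπ hν ht, heatL_of_pos hp hπ hν ht]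
    refine (norm_convL_le hp hπ (integrable_heatKernel hν ht) f).trans_eq ?_
    rw [integral_norm_heatKernel hν ht, one_mul]

lemma norm_heatL_le (hp : p ≠ ∞) (hπ : Continuous π) (hν : 0 < ν) (t : ℝ) (f : LVec G d p) :
    ‖heatL hp hπ hν t f‖ ≤ ‖f‖ := by
  by_cases ht : 0 < t
  · rw [← heatSemigroup_of_pos hp hπ hν ht]
    exact norm_heatSemigroup_le hp hπ hν ht.le f
  · simp [heatL, ht]

lemma heatSemigroup_add (hp : p ≠ ∞) (hπ : Continuous π)
    (hadd : ∀ x y, π (x + y) = π x + π y) (hν : 0 < ν) {s t : ℝ} (hs : 0 ≤ s) (ht : 0 ≤ t)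
    (f : LVec G d p) :
    heatSemigroup π ν (s + t) f = heatSemigroup π ν s (heatSemigroup π ν t f) := by
  rcases hs.eq_or_lt with rfl | hs
  · rw [zero_add, heatSemigroup_zero]
  rcases ht.eq_or_lt with rfl | ht
  · rw [add_zero, heatSemigroup_zero]
  have hst : 0 < s + t := by positivity
  simp only [heatSemigroup_of_pos hp hπ hν, hs, ht, hst, heatL_of_pos]
  exact (convL_convL hp hπ hadd _ _ _
    (integral_heatKernel_mul_heatKernel_sub hν hs ht) f).symm

lemma isSmoothingFamily_heatL (hp : p ≠ ∞) (hπ : Continuous π)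
    (hadd : ∀ x y, π (x + y) = π x + π y) (hν : 0 < ν) :
    IsSmoothingFamily (heatL hp hπ hν : ℝ → LVec G d p →L[ℝ] LVec G d p) 0 1 where
  eq_zero t ht := dif_neg (not_lt.2 ht)
  continuousOn f := ((continuousOn_heatSemigroup hp hπ hadd hν f).mono Ioi_subset_Ici_self).congr
    fun t ht => (heatSemigroup_of_pos hp hπ hν ht f).symm
  bound t _ f := by
    by_cases ht : 0 < t
    · rw [powKernel, if_pos ht, neg_zero, Real.rpow_zero]
      simpa [enorm_le_iff_norm_le] using norm_heatL_le hp hπ hν t f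
    · simp [heatL, ht]

/-- `v(t) = S_t u₀ + ∫₀ᵗ S_{t-s} N(s) ds`. -/
noncomputable def duhamel (π : RVec d → G) (ν : ℝ) (u₀ : LVec G d p) (N : ℝ → LVec G d p) (t : ℝ) :
    LVec G d p :=
  heatSemigroup π ν t u₀ + ∫ s in (0 : ℝ)..t, heatSemigroup π ν (t - s) (N s)

/-- For nonnegative times the two families differ only at time `0`, where one is the identity and
the other vanishes; here that is the single point `s = t`. -/
lemma ae_heatSemigroup_eq (hp : p ≠ ∞) (hπ : Continuous π) (hν : 0 < ν) (N : ℝ → LVec G d p)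
    (t : ℝ) {A : Set ℝ} (hA : MeasurableSet A) (hAt : A ⊆ Iic t) :
    ∀ᵐ s ∂(volume.restrict A), heatSemigroup π ν (t - s) (N s) = heatL hp hπ hν (t - s) (N s) := by
  filter_upwards [ae_restrict_mem hA, (Measure.ae_ne volume t).filter_mono
    (ae_mono Measure.restrict_le_self)] with s hs hst
  exact heatSemigroup_of_pos hp hπ hν (sub_pos.2 (lt_of_le_of_ne (hAt hs) hst)) _

lemma integrableOn_heatL (hp : p ≠ ∞) (hπ : Continuous π)
    (hadd : ∀ x y, π (x + y) = π x + π y) (hν : 0 < ν) {N : ℝ → LVec G d p} {A : Set ℝ} 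
    (hN : IntegrableOn N A) (t : ℝ) : IntegrableOn (fun s => heatL hp hπ hν (t - s) (N s)) A := by
  refine hN.norm.mono' ((isSmoothingFamily_heatL hp hπ hadd hν).aestronglyMeasurable_apply hN.1 t)
    (Eventually.of_forall fun s => norm_heatL_le hp hπ hν _ _)

lemma integrableOn_heatSemigroup (hp : p ≠ ∞) (hπ : Continuous π)
    (hadd : ∀ x y, π (x + y) = π x + π y) (hν : 0 < ν) {N : ℝ → LVec G d p} {A : Set ℝ} 
    (hA : MeasurableSet A)  {t : ℝ} (hAt : A ⊆ Iic t) (hN : IntegrableOn N A)  : 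
    IntegrableOn (fun s => heatSemigroup π ν (t - s) (N s)) A :=
  (integrableOn_heatL hp hπ hadd hν hN t).congr
    ((ae_heatSemigroup_eq hp hπ hν N t hA hAt).mono fun _ h => h.symm)

lemma duhamel_eq_mildPart (hp : p ≠ ∞) (hπ : Continuous π) (hadd : ∀ x y, π (x + y) = π x + π y)
    (hν : 0 < ν) (u₀ : LVec G d p) (N : ℝ → LVec G d p) (z : ℝ → LVec G d p) {t τ : ℝ} 
    (ht : t ∈ Ioc 0 τ) :
    z t + duhamel π ν u₀ N t = mildPart (heatL hp hπ hν) τ u₀ z N t := by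
  rw [duhamel, mildPart, heatSemigroup_of_pos hp hπ hν ht.1,
    (isSmoothingFamily_heatL hp hπ hadd hν).setIntegral_Ioc_eq _ ht.2,
    intervalIntegral.integral_of_le ht.1.le,
    integral_congr_ae (ae_heatSemigroup_eq hp hπ hν N t measurableSet_Ioc Ioc_subset_Iic_self)]

/-- Restarting the mild formulation at a later time. -/
lemma duhamel_add (hp : p ≠ ∞) (hπ : Continuous π) (hadd : ∀ x y, π (x + y) = π x + π y)
    (hν : 0 < ν) (u₀ : LVec G d p) {N : ℝ → LVec G d p} {t₀ r : ℝ} (ht₀ : 0 ≤ t₀) (hr : 0 ≤ r)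
    (hN : IntegrableOn N (Ioc 0 (t₀ + r))) :
    duhamel π ν u₀ N (t₀ + r) = duhamel π ν (duhamel π ν u₀ N t₀) (fun s => N (t₀ + s)) r := by
  rcases hr.eq_or_lt with rfl | hr
  · simp [duhamel, heatSemigroup_zero]
  have h1 : IntegrableOn N (Ioc 0 t₀) := hN.mono_set (Ioc_subset_Ioc_right (by linarith))
  have h2 : IntegrableOn N (Ioc t₀ (t₀ + r)) := hN.mono_set (Ioc_subset_Ioc_left ht₀)
  have i1 : IntervalIntegrable (fun s => heatSemigroup π ν (t₀ + r - s) (N s)) volume 0 t₀ :=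
    (intervalIntegrable_iff_integrableOn_Ioc_of_le ht₀).2
      (integrableOn_heatSemigroup hp hπ hadd hν measurableSet_Ioc
        (fun s hs => show s ≤ t₀ + r by linarith [hs.2]) h1)
  have i2 : IntervalIntegrable (fun s => heatSemigroup π ν (t₀ + r - s) (N s)) volume t₀ (t₀ + r) :=
    (intervalIntegrable_iff_integrableOn_Ioc_of_le (by linarith)).2
      (integrableOn_heatSemigroup hp hπ hadd hν measurableSet_Ioc
        (fun s hs => show s ≤ t₀ + r by linarith [hs.2]) h2)
  rw [duhamel, duhamel, ← intervalIntegral.integral_add_adjacent_intervals i1 i2, add_comm t₀ r,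
    heatSemigroup_add hp hπ hadd hν hr.le ht₀, ← add_assoc]
  congr 1
  · rw [duhamel, heatSemigroup_of_pos hp hπ hν hr, heatSemigroup_of_pos hp hπ hν hr, map_add]
    congr 1
    rw [intervalIntegral.integral_of_le ht₀, intervalIntegral.integral_of_le ht₀,
      ← ContinuousLinearMap.integral_comp_comm _ (integrableOn_heatSemigroup hp hπ hadd hν
        measurableSet_Ioc Ioc_subset_Iic_self h1)]
    refine setIntegral_congr_fun measurableSet_Ioc fun s hs => ?_
    rw [add_sub_assoc, heatSemigroup_add hp hπ hadd hν hr.le (sub_nonneg.2 hs.2),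
      heatSemigroup_of_pos hp hπ hν hr]
  · have h := intervalIntegral.integral_comp_add_left
      (fun s => heatSemigroup π ν (r + t₀ - s) (N s)) t₀ (a := 0) (b := r)
    rw [add_zero, add_comm t₀ r] at h
    rw [← h]
    congr 1
    ext1 s
    congr 1
    ring

/-- Extending the operators by zero keeps the domain of integration fixed. For `s < t` the integrand
is continuous in time by strong continuity, for `s > t` it vanishes nearby, and `‖N s‖` dominates
throughout. -/
lemma continuousOn_duhamel (hp : p ≠ ∞) (hπ : Continuous π) (hadd : ∀ x y, π (x + y) = π x + π y)
    (hν : 0 < ν) (u₀ : LVec G d p) {N : ℝ → LVec G d p} {τ : ℝ} 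
    (hN : IntegrableOn N (Ioc 0 τ)) : ContinuousOn (duhamel π ν u₀ N) (Icc 0 τ) := by
  have hc : ContinuousOn (fun t => ∫ s in Ioc 0 τ, heatL hp hπ hν (t - s) (N s)) (Icc 0 τ) := by
    refine continuousOn_of_forall_continuousAt fun t _ => ?_
    have hU := isSmoothingFamily_heatL (p := p) hp hπ hadd hν
    refine continuousAt_of_dominated (bound := fun s => ‖N s‖)
      (Eventually.of_forall fun t => hU.aestronglyMeasurable_apply hN.1 t)
      (Eventually.of_forall fun t => Eventually.of_forall fun s => norm_heatL_le hp hπ hν _ _)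
      hN.norm ?_
    filter_upwards [(Measure.ae_ne volume t).filter_mono
      (ae_mono Measure.restrict_le_self)] with s hs
    rcases lt_or_gt_of_ne hs with h | h
    · have h1 : ContinuousAt (fun r => heatL hp hπ hν r (N s)) (t - s) :=
        (hU.continuousOn (N s)).continuousAt (Ioi_mem_nhds (sub_pos.2 h))
      exact h1.comp (f := fun t => t - s) (by fun_prop)
    · refine continuousAt_const.congr (f := fun _ => 0) ?_
      filter_upwards [Iio_mem_nhds h] with r hr
      rw [hU.eq_zero _ (sub_nonpos.2 (le_of_lt hr))]
      rfl
  refine ((continuousOn_heatSemigroup hp hπ hadd hν u₀).mono Icc_subset_Ici_self).add ?_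
  refine hc.congr fun t ht => ?_
  beta_reduce
  rw [(isSmoothingFamily_heatL hp hπ hadd hν).setIntegral_Ioc_eq _ ht.2,
    intervalIntegral.integral_of_le ht.1,
    integral_congr_ae (ae_heatSemigroup_eq hp hπ hν N t measurableSet_Ioc Ioc_subset_Iic_self)]

end HeatSemigroup
-- Covering maps, weak derivatives and the gain of integrability.
section Covering

variable {G : Type} [AddCommGroup G] [TopologicalSpace G] [MeasureSpace G] {d : ℕ}

/-- The properties of the covering map `π : ℝᵈ → G` used below. -/
structure IsHeatCovering (π : RVec d → G) : Prop where
  map_add : ∀ x y, π (x + y) = π x + π y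
  isQuotientMap : IsQuotientMap π
  ae_eq_zero : ∀ g : G → RVec d, LocallyIntegrable g →
    (∀ φ, IsTestFunction π φ → ∫ x, φ x • g x = 0) → g =ᵐ[volume] 0
  -- The supremum bound `t^{-d/2}` of the heat kernel of `G`, periodized in the torus case. Times up
  -- to `2` are needed because the gradient at time `t ≤ 1` is dominated by the kernel at time `2t`.
  map_heatKernel_le : ∀ ν : ℝ, 0 < ν → ∃ Λ : ℝ≥0, ∀ t ∈ Ioc (0 : ℝ) 2,
    (volume.withDensity fun y => ENNReal.ofReal (heatKernel ν t y)).map π ≤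
      ((Λ : ℝ≥0∞) * powKernel (d / 2) t) • (volume : Measure G)

variable [IsTopologicalAddGroup G] [BorelSpace G] [SecondCountableTopology G]
  [LocallyCompactSpace G] [T2Space G]
  [(volume : Measure G).IsAddHaarMeasure] {p : ℝ≥0∞} [Fact (1 ≤ p)]
  {π : RVec d → G} {φ : G → ℝ}

namespace IsHeatCovering

lemma continuous (hπ : IsHeatCovering π) : Continuous π := hπ.isQuotientMap.continuous

lemma map_zero (hπ : IsHeatCovering π) : π 0 = 0 := by simpa using hπ.map_add 0 0

lemma continuous_of_isTestFunction (hπ : IsHeatCovering π) (hφ : IsTestFunction π φ) :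
    Continuous φ :=
  hπ.isQuotientMap.continuous_iff.2 hφ.2.continuous

lemma _root_.Burgers.single_eq_smul (j : Fin d) (s : ℝ) :
    (EuclideanSpace.single j s : RVec d) = s • EuclideanSpace.single j 1 := by
  ext i
  simp

lemma hasLineDerivAt (hπ : IsHeatCovering π) (hφ : IsTestFunction π φ) (j : Fin d) (x : G)
    (y : RVec d) : HasLineDerivAt ℝ (fun y => φ (x + π y)) (partialDeriv π j φ (x + π y)) y
      (EuclideanSpace.single j 1) := by
  -- Smoothness is known only for `φ ∘ π`, so the base point is lifted to `ℝᵈ`.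
  obtain ⟨y₀, hy₀⟩ := hπ.isQuotientMap.surjective (x + π y)
  have h1 : ∀ s : ℝ, φ (x + π (y + s • EuclideanSpace.single j 1)) =
      (φ ∘ π) (y₀ + s • EuclideanSpace.single j 1) := by
    intro s
    rw [Function.comp_apply, hπ.map_add, hπ.map_add, hy₀, add_assoc]
  have h2 : ∀ s : ℝ, φ (x + π y + π (EuclideanSpace.single j s)) =
      (φ ∘ π) (y₀ + s • EuclideanSpace.single j 1) := by
    intro s
    rw [Function.comp_apply, hπ.map_add, hy₀, single_eq_smul]
  have hd : DifferentiableAt ℝ (fun s : ℝ => (φ ∘ π) (y₀ + s • EuclideanSpace.single j 1)) 0 := by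
    have h3 : Differentiable ℝ (φ ∘ π) := hφ.2.differentiable (by simp)
    exact (h3.comp (g := φ ∘ π) (f := fun s : ℝ => y₀ + s • EuclideanSpace.single j 1)
      (by fun_prop)) 0
  unfold HasLineDerivAt partialDeriv
  simp only [h1, h2]
  exact hd.hasDerivAt

lemma partialDeriv_comp (hπ : IsHeatCovering π) (hφ : IsTestFunction π φ) (j : Fin d)
    (y : RVec d) :
    partialDeriv π j φ (π y) = fderiv ℝ (φ ∘ π) y (EuclideanSpace.single j 1) := by
  have h := hπ.hasLineDerivAt hφ j 0 y
  simp only [zero_add] at h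
  have h3 : Differentiable ℝ (φ ∘ π) := hφ.2.differentiable (by simp)
  rw [← (h3 y).lineDeriv_eq_fderiv]
  exact h.lineDeriv.symm

lemma continuous_partialDeriv (hπ : IsHeatCovering π) (hφ : IsTestFunction π φ) (j : Fin d) :
    Continuous (partialDeriv π j φ) := by
  rw [hπ.isQuotientMap.continuous_iff]
  have : partialDeriv π j φ ∘ π = fun y => fderiv ℝ (φ ∘ π) y (EuclideanSpace.single j 1) :=
    funext fun y => hπ.partialDeriv_comp hφ j y
  rw [this]
  have h := hφ.2.continuous_fderiv (by simp)
  fun_prop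

lemma hasCompactSupport_partialDeriv (hπ : IsHeatCovering π) (hφ : IsTestFunction π φ)
    (j : Fin d) : HasCompactSupport (partialDeriv π j φ) := by
  refine hφ.1.mono' fun x hx => ?_
  by_contra hx'
  refine hx ?_
  have h0 : φ =ᶠ[𝓝 x] 0 := notMem_tsupport_iff_eventuallyEq.1 hx'
  have hc : Tendsto (fun s : ℝ => x + π (EuclideanSpace.single j s)) (𝓝 0) (𝓝 x) := by
    have h : Continuous fun s : ℝ => x + π (EuclideanSpace.single j s) := by
      have e : (fun s : ℝ => x + π (EuclideanSpace.single j s)) =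
          fun s => x + π (s • EuclideanSpace.single j 1) :=
        funext fun s => by rw [single_eq_smul]
      rw [e]
      exact continuous_const.add (hπ.continuous.comp (by fun_prop))
    have h2 := h.tendsto 0
    rwa [single_eq_smul, zero_smul, hπ.map_zero, add_zero] at h2
  have h1 : (fun s : ℝ => φ (x + π (EuclideanSpace.single j s))) =ᶠ[𝓝 0] fun _ => 0 :=
    hc.eventually h0
  rw [partialDeriv, h1.deriv_eq]
  simp

lemma memLp (hπ : IsHeatCovering π) (hφ : IsTestFunction π φ) (q : ℝ≥0∞) : MemLp φ q :=
  (hπ.continuous_of_isTestFunction hφ).memLp_of_hasCompactSupport hφ.1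

lemma memLp_partialDeriv (hπ : IsHeatCovering π) (hφ : IsTestFunction π φ) (j : Fin d)
    (q : ℝ≥0∞) : MemLp (partialDeriv π j φ) q :=
  (hπ.continuous_partialDeriv hφ j).memLp_of_hasCompactSupport
    (hπ.hasCompactSupport_partialDeriv hφ j)

/-- A weak derivative becomes a family of identities between continuous functionals, which commute
with Bochner integrals in time. -/
lemma isWeakPartial_iff (hπ : IsHeatCovering π) {q : ℝ≥0∞} [Fact (1 ≤ q)] (j : Fin d)
    (f : LVec G d p) (g : LVec G d q) : IsWeakPartial π j f g ↔
      ∀ (φ : G → ℝ) (hφ : IsTestFunction π φ),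
        pairing (hπ.memLp_partialDeriv hφ j _) f = - pairing (hπ.memLp hφ _) g := by
  simp only [IsWeakPartial, pairing_apply]

/-- Weak derivatives are unique. -/
lemma weakPartial_unique (hπ : IsHeatCovering π) {q r r' : ℝ≥0∞} [Fact (1 ≤ q)] [Fact (1 ≤ r)]
    [Fact (1 ≤ r')] {j : Fin d} {f : LVec G d p} {g : LVec G d r} {f' : LVec G d q}
    {g' : LVec G d r'} (h : IsWeakPartial π j f g) (h' : IsWeakPartial π j f' g')
    (hff' : f =ᵐ[volume] f') : g =ᵐ[volume] g' := by
  have hg : LocallyIntegrable (g : G → RVec d) :=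
    (Lp.memLp g).locallyIntegrable Fact.out
  have hg' : LocallyIntegrable (g' : G → RVec d) :=
    (Lp.memLp g').locallyIntegrable Fact.out
  have h0 := hπ.ae_eq_zero (fun x => g x - g' x) (hg.sub hg') fun φ hφ => by
    have i1 : Integrable fun x => φ x • g x := integrable_smul_lp (hπ.memLp hφ _) g
    have i2 : Integrable fun x => φ x • g' x := integrable_smul_lp (hπ.memLp hφ _) g'
    simp only [smul_sub]
    rw [integral_sub i1 i2, sub_eq_zero, ← neg_inj, ← h φ hφ, ← h' φ hφ]
    refine integral_congr_ae ?_
    filter_upwards [hff'] with x hx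
    rw [hx]
  filter_upwards [h0] with x hx
  exact sub_eq_zero.1 hx

/-- Derivatives of a convolution fall on the kernel. -/
lemma isWeakPartial_convL (hπ : IsHeatCovering π) (hp : p ≠ ∞) {k k' : RVec d → ℝ}
    (hk : Integrable k) (hk' : Integrable k') {j : Fin d}
    (hkk' : ∀ y, HasLineDerivAt ℝ k (k' y) y (EuclideanSpace.single j 1)) (f : LVec G d p) :
    IsWeakPartial π j (convL hp hπ.continuous hk f) (convL hp hπ.continuous hk' f) := by
  intro φ hφ
  have hφc := hπ.continuous_of_isTestFunction hφ
  have hdc := hπ.continuous_partialDeriv hφ j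
  rw [integral_smul_convL hp hπ.continuous hk hdc.stronglyMeasurable
      (hπ.memLp_partialDeriv hφ j _),
    integral_smul_convL hp hπ.continuous hk' hφc.stronglyMeasurable (hπ.memLp hφ _),
    ← integral_neg]
  refine integral_congr_ae (Eventually.of_forall fun x => ?_)
  beta_reduce
  rw [← neg_smul]
  congr 1
  have hπc := hπ.continuous
  have hm1 : ∀ (ψ : G → ℝ), Continuous ψ → HasCompactSupport ψ → ∀ {l : RVec d → ℝ},
      Integrable l → Integrable fun y => l y * ψ (x + π y) := by
    intro ψ hψ hψs l hl
    obtain ⟨M, hM⟩ := hψ.bounded_above_of_compact_support hψs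
    exact hl.mul_bdd (c := M) (hψ.comp (by fun_prop)).aestronglyMeasurable
      (Eventually.of_forall fun y => hM _)
  -- Integration by parts in the variable of `ℝᵈ` for fixed `x`. The kernel has no compact support;
  -- integrability of the three products replaces it.
  exact integral_bilinear_hasLineDerivAt_right_eq_neg_left_of_integrable
    (B := ContinuousLinearMap.mul ℝ ℝ) (f := k) (g := fun y => φ (x + π y))
    (hm1 φ hφc hφ.1 hk') (hm1 _ hdc (hπ.hasCompactSupport_partialDeriv hφ j) hk)
    (hm1 φ hφc hφ.1 hk) (fun y _ => hkk' y) (fun y _ => hπ.hasLineDerivAt hφ j x y)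

end IsHeatCovering

/-- Let `J` be the average of `|f|ᵖ` along `π` for the probability density `k`. Jensen bounds the
`p`-th power of the convolution by `cᵖ J`. Moreover `J ≤ Λ ‖f‖ᵖ` pointwise by the density bound, and
`∫ J = ‖f‖ᵖ`, so `∫ J² ≤ Λ ‖f‖²ᵖ`. -/
lemma eLpNorm_convL_two_mul_le (hp : p ≠ ∞) (hπ : Continuous π) {a k : RVec d → ℝ}
    (ha : Integrable a) (hk : Measurable k) {c : ℝ≥0} (hak : ∀ y, |a y| ≤ c * k y)
    [IsProbabilityMeasure (volume.withDensity fun y => ENNReal.ofReal (k y))] {Λ : ℝ≥0∞}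
    (hΛ : (volume.withDensity fun y => ENNReal.ofReal (k y)).map π ≤ Λ • (volume : Measure G))
    (f : LVec G d p) :
    eLpNorm (convL hp hπ ha f) (2 * p) volume ≤ c * Λ ^ (1 / (2 * p.toReal)) * ‖f‖ₑ := by
  set ρ := volume.withDensity fun y => ENNReal.ofReal (k y) with hρ
  set P := p.toReal with hP
  have hp0 : p ≠ 0 := (zero_lt_one.trans_le (Fact.out : 1 ≤ p)).ne'
  have hP0 : 0 < P := ENNReal.toReal_pos hp0 hp
  have hfm : StronglyMeasurable (f : G → RVec d) := Lp.stronglyMeasurable f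
  set h : G → ℝ≥0∞ := fun x => ‖f x‖ₑ ^ P with hh
  have hhm : Measurable h := hfm.enorm.pow_const P
  set J : G → ℝ≥0∞ := fun x => ∫⁻ y, h (x - π y) ∂ρ with hJ
  have hfI : ∫⁻ x, h x = ‖f‖ₑ ^ P := by
    rw [Lp.enorm_def, eLpNorm_eq_lintegral_rpow_enorm_toReal hp0 hp, ← ENNReal.rpow_mul,
      one_div, inv_mul_cancel₀ hP0.ne', ENNReal.rpow_one]
  have hJle : ∀ x, J x ≤ Λ * ‖f‖ₑ ^ P := by
    intro x
    calc J x = ∫⁻ g, h (x - g) ∂(ρ.map π) :=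
          (lintegral_map (f := fun g => h (x - g)) (by fun_prop) hπ.measurable).symm
      _ ≤ ∫⁻ g, h (x - g) ∂(Λ • volume) := lintegral_mono' hΛ le_rfl
      _ = Λ * ∫⁻ g, h g := by
          rw [lintegral_smul_measure, smul_eq_mul, lintegral_sub_left_eq_self]
      _ = _ := by rw [hfI]
  have hπm := hπ.measurable
  have hJI : ∫⁻ x, J x = ‖f‖ₑ ^ P := by
    calc ∫⁻ x, J x = ∫⁻ y, (∫⁻ x, h (x - π y)) ∂ρ :=
          lintegral_lintegral_swap (Measurable.aemeasurable (by fun_prop))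
      _ = ∫⁻ _, ‖f‖ₑ ^ P ∂ρ := by simp only [lintegral_sub_right_eq_self, hfI]
      _ = _ := by simp
  have hpt : ∀ᵐ x, ‖convL hp hπ ha f x‖ₑ ^ P ≤ (c : ℝ≥0∞) ^ P * J x := by
    filter_upwards [convL_ae_eq hp hπ ha f] with x hx
    have hgm : StronglyMeasurable fun y => f (x - π y) := hfm.comp_measurable (by fun_prop)
    have h1 : ‖convL hp hπ ha f x‖ₑ ≤ c * J x ^ (1 / P) := by
      calc ‖convL hp hπ ha f x‖ₑ ≤ ∫⁻ y, ‖a y • f (x - π y)‖ₑ := by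
            rw [hx]
            exact enorm_integral_le_lintegral_enorm _
        _ ≤ ∫⁻ y, c * (ENNReal.ofReal (k y) * ‖f (x - π y)‖ₑ) := by
            refine lintegral_mono fun y => ?_
            rw [enorm_smul, ← mul_assoc]
            gcongr
            rw [← ofReal_norm, Real.norm_eq_abs, ← ENNReal.ofReal_coe_nnreal,
              ← ENNReal.ofReal_mul (by positivity)]
            exact ENNReal.ofReal_le_ofReal (hak y)
        _ = c * ∫⁻ y, ‖f (x - π y)‖ₑ ∂ρ := by
            rw [lintegral_const_mul' _ _ ENNReal.coe_ne_top, hρ,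
              lintegral_withDensity_eq_lintegral_mul _ (by fun_prop) hgm.enorm]
            rfl
        _ ≤ c * J x ^ (1 / P) := by
            gcongr
            -- Jensen's inequality, as monotonicity of the norms in the exponent for the probability
            -- measure `ρ`.
            have := eLpNorm_le_eLpNorm_of_exponent_le (μ := ρ) (Fact.out : 1 ≤ p)
              hgm.aestronglyMeasurable
            rwa [eLpNorm_one_eq_lintegral_enorm, eLpNorm_eq_lintegral_rpow_enorm_toReal hp0 hp]
              at this
    calc ‖convL hp hπ ha f x‖ₑ ^ P ≤ (c * J x ^ (1 / P)) ^ P := by gcongr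
      _ = _ := by
        rw [ENNReal.mul_rpow_of_nonneg _ _ hP0.le, ← ENNReal.rpow_mul, one_div,
          inv_mul_cancel₀ hP0.ne', ENNReal.rpow_one]
  have hJm : Measurable J := Measurable.lintegral_prod_right'
    (f := fun q : G × RVec d => h (q.1 - π q.2)) (by fun_prop)
  have h2P : (2 * p).toReal = 2 * P := by simp [hP]
  rw [eLpNorm_eq_lintegral_rpow_enorm_toReal (by simp [hp0]) (by finiteness), h2P]
  calc (∫⁻ x, ‖convL hp hπ ha f x‖ₑ ^ (2 * P)) ^ (1 / (2 * P))
      ≤ (∫⁻ x, ((c : ℝ≥0∞) ^ P * (c : ℝ≥0∞) ^ P * (Λ * ‖f‖ₑ ^ P)) * J x) ^ (1 / (2 * P)) := by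
        gcongr ?_ ^ _
        refine lintegral_mono_ae ?_
        filter_upwards [hpt] with x hx
        rw [two_mul, ENNReal.rpow_add_of_nonneg _ _ hP0.le hP0.le]
        calc _ ≤ ((c : ℝ≥0∞) ^ P * J x) * ((c : ℝ≥0∞) ^ P * J x) := by gcongr
          _ ≤ ((c : ℝ≥0∞) ^ P * (Λ * ‖f‖ₑ ^ P)) * ((c : ℝ≥0∞) ^ P * J x) := by
            gcongr
            exact hJle x
          _ = _ := by ring
    _ = ((c * ‖f‖ₑ) ^ (2 * P) * Λ) ^ (1 / (2 * P)) := by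
        rw [lintegral_const_mul _ hJm, hJI]
        congr 1
        rw [two_mul, ENNReal.rpow_add_of_nonneg _ _ hP0.le hP0.le,
          ENNReal.mul_rpow_of_nonneg _ _ hP0.le]
        ring
    _ = _ := by
        rw [ENNReal.mul_rpow_of_nonneg _ _ (by positivity), ← ENNReal.rpow_mul,
          mul_one_div_cancel (by positivity), ENNReal.rpow_one]
        ring

end Covering
-- The smoothing families generated by the heat semigroup.
section Families

variable {G : Type} [AddCommGroup G] [TopologicalSpace G] [MeasureSpace G] {d : ℕ}
  [IsTopologicalAddGroup G] [BorelSpace G] [SecondCountableTopology G]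
  [LocallyCompactSpace G] [T2Space G]
  [(volume : Measure G).IsAddHaarMeasure] {p : ℝ≥0∞} [Fact (1 ≤ p)]
  {π : RVec d → G} {ν : ℝ}

lemma exists_clm_of_eLpNorm_le (T : LVec G d p →L[ℝ] LVec G d p) {r : ℝ≥0∞} [Fact (1 ≤ r)]
    {C : ℝ≥0} (h : ∀ f, eLpNorm (T f) r volume ≤ C * ‖f‖ₑ) :
    ∃ T' : LVec G d p →L[ℝ] LVec G d r, ∀ f, T' f =ᵐ[volume] T f := by
  have hm : ∀ f, MemLp (T f : G → RVec d) r volume := fun f =>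
    ⟨(Lp.memLp (T f)).1, (h f).trans_lt (by finiteness)⟩
  refine ⟨LinearMap.mkContinuous
    { toFun := fun f => (hm f).toLp _
      map_add' := fun f g => ?_
      map_smul' := fun c f => ?_ } C fun f => ?_, fun f => (hm f).coeFn_toLp⟩
  · rw [← MemLp.toLp_add, MemLp.toLp_eq_toLp_iff, map_add]
    exact Lp.coeFn_add _ _
  · rw [RingHom.id_apply, ← MemLp.toLp_const_smul, MemLp.toLp_eq_toLp_iff, map_smul]
    exact Lp.coeFn_smul _ _
  · change ‖(hm f).toLp _‖ ≤ _
    rw [Lp.norm_toLp]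
    refine ENNReal.toReal_le_of_le_ofReal (by positivity) ((h f).trans_eq ?_)
    rw [ENNReal.ofReal_mul (by positivity), ENNReal.ofReal_coe_nnreal, ofReal_norm]

/-- A family of operators compatible with the heat semigroup and with values in `Lʳ` is a
smoothing family. -/
lemma exists_isSmoothingFamily (hp : p ≠ ∞) (hπ : IsHeatCovering π) (hν : 0 < ν)
    (T : ℝ → LVec G d p →L[ℝ] LVec G d p) (hT0 : ∀ t ≤ 0, T t = 0)
    (hTadd : ∀ s, 0 < s → ∀ t, 0 ≤ t → ∀ f, T (s + t) f = T s (heatSemigroup π ν t f))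
    {r : ℝ≥0∞} [Fact (1 ≤ r)] {γ : ℝ} {C : ℝ≥0}
    (hb : ∀ t ∈ Ioc (0 : ℝ) 1, ∀ f, eLpNorm (T t f) r volume ≤ C * powKernel γ t * ‖f‖ₑ) :
    ∃ U : ℝ → LVec G d p →L[ℝ] LVec G d r, IsSmoothingFamily U γ C ∧
      ∀ t f, U t f =ᵐ[volume] T t f := by
  have hpk : ∀ t, powKernel γ t ≠ ∞ := fun t => by
    unfold powKernel
    split_ifs <;> simp
  have hex : ∀ t, ∃ T' : LVec G d p →L[ℝ] LVec G d r, ∀ f, T' f =ᵐ[volume] T t f := by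
    intro t
    rcases le_or_gt t 0 with ht | ht
    · refine ⟨0, fun f => ?_⟩
      rw [hT0 t ht]
      exact (Lp.coeFn_zero _ _ _).trans (Lp.coeFn_zero _ _ _).symm
    -- The bound is assumed only up to time `1`; later times factor through `T 1`, the remaining
    -- time being taken by the contraction semigroup.
    · have h1 : min t 1 ∈ Ioc (0 : ℝ) 1 := ⟨by positivity, min_le_right _ _⟩
      refine exists_clm_of_eLpNorm_le (C := C * (powKernel γ (min t 1)).toNNReal) _ fun f => ?_
      have e : T t f = T (min t 1) (heatSemigroup π ν (t - min t 1) f) := by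
        rw [← hTadd _ h1.1 _ (sub_nonneg.2 (min_le_left _ _)), add_sub_cancel]
      rw [e, ENNReal.coe_mul, ENNReal.coe_toNNReal (hpk _)]
      refine (hb _ h1 _).trans ?_
      gcongr
      rw [enorm_le_iff_norm_le]
      exact norm_heatSemigroup_le hp hπ.continuous hν (sub_nonneg.2 (min_le_left _ _)) f
  choose U hU using hex
  refine ⟨U, ⟨fun t ht => ?_, fun f => ?_, fun t ht f => ?_⟩, hU⟩
  · ext1 f
    refine Lp.ext ((hU t f).trans ?_)
    rw [hT0 t ht]
    exact (Lp.coeFn_zero _ _ _).trans (Lp.coeFn_zero _ _ _).symm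
  · refine continuousOn_of_forall_continuousAt fun t₀ ht₀ => ?_
    have ht₀' : 0 < t₀ := ht₀
    have hδ : 0 < t₀ / 2 := by positivity
    -- Near `t₀` the operator factors as the fixed bounded map `U (t₀/2)` into `Lʳ` after the
    -- strongly continuous semigroup, so continuity in `Lᵖ` upgrades to continuity in `Lʳ`.
    have hc : ContinuousAt (fun t => U (t₀ / 2) (heatSemigroup π ν (t - t₀ / 2) f)) t₀ := by
      refine (U (t₀ / 2)).continuous.continuousAt.comp ?_
      have h1 : ContinuousAt (fun t => heatSemigroup π ν t f) (t₀ - t₀ / 2) :=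
        (continuousOn_heatSemigroup hp hπ.continuous hπ.map_add hν f).continuousAt
          (Ici_mem_nhds (by linarith))
      exact h1.comp (f := fun t => t - t₀ / 2) (by fun_prop)
    refine hc.congr ?_
    filter_upwards [Ioi_mem_nhds (show t₀ / 2 < t₀ by linarith)] with t ht
    refine Lp.ext ((hU _ _).trans ?_)
    rw [← hTadd _ hδ _ (sub_nonneg.2 (le_of_lt ht)), add_sub_cancel]
    exact (hU t f).symm
  · rcases le_or_gt t 0 with h0 | h0
    · have : U t f = 0 := by
        refine Lp.ext ((hU t f).trans ?_)
        rw [hT0 t h0]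
        exact (Lp.coeFn_zero _ _ _).trans (Lp.coeFn_zero _ _ _).symm
      simp [this]
    · rw [Lp.enorm_def, eLpNorm_congr_ae (hU t f)]
      exact hb t ⟨h0, ht⟩ f

/-- The derivative `∂ⱼ S_t` of the heat semigroup for positive times, extended by zero. -/
noncomputable def heatDerivL (hp : p ≠ ∞) (hπ : Continuous π) (hν : 0 < ν) (j : Fin d) (t : ℝ) :
    LVec G d p →L[ℝ] LVec G d p :=
  if h : 0 < t then convL hp hπ (integrable_heatKernelDeriv hν h j) else 0

lemma heatDerivL_of_pos (hp : p ≠ ∞) (hπ : Continuous π) (hν : 0 < ν) (j : Fin d) {t : ℝ}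
    (ht : 0 < t) : (heatDerivL hp hπ hν j t : LVec G d p →L[ℝ] LVec G d p) =
      convL hp hπ (integrable_heatKernelDeriv hν ht j) := dif_pos ht

lemma isWeakPartial_heatL (hp : p ≠ ∞) (hπ : IsHeatCovering π) (hν : 0 < ν) (j : Fin d) (t : ℝ)
    (f : LVec G d p) :
    IsWeakPartial π j (heatL hp hπ.continuous hν t f) (heatDerivL hp hπ.continuous hν j t f) := by
  by_cases ht : 0 < t
  · rw [heatL_of_pos _ _ _ ht, heatDerivL_of_pos _ _ _ _ ht]
    exact hπ.isWeakPartial_convL hp _ _ (fun y => hasLineDerivAt_heatKernel hν ht j y) f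
  · rw [heatL, heatDerivL, dif_neg ht, dif_neg ht, hπ.isWeakPartial_iff]
    simp

lemma heatL_add (hp : p ≠ ∞) (hπ : IsHeatCovering π) (hν : 0 < ν) {s t : ℝ} (hs : 0 < s)
    (ht : 0 ≤ t) (f : LVec G d p) : heatL hp hπ.continuous hν (s + t) f =
      heatL hp hπ.continuous hν s (heatSemigroup π ν t f) := by
  rw [← heatSemigroup_of_pos hp hπ.continuous hν hs, ← heatSemigroup_add hp hπ.continuous
    hπ.map_add hν hs.le ht, heatSemigroup_of_pos hp hπ.continuous hν (by positivity)]

/-- Both sides are the weak `j`-th derivative of `S_{s+t} f`, so uniqueness of weak derivatives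
replaces a computation with kernels. -/
lemma heatDerivL_add (hp : p ≠ ∞) (hπ : IsHeatCovering π) (hν : 0 < ν) (j : Fin d) {s t : ℝ}
    (hs : 0 < s) (ht : 0 ≤ t) (f : LVec G d p) : heatDerivL hp hπ.continuous hν j (s + t) f =
      heatDerivL hp hπ.continuous hν j s (heatSemigroup π ν t f) := by
  refine Lp.ext (hπ.weakPartial_unique (isWeakPartial_heatL hp hπ hν j _ f)
    (isWeakPartial_heatL hp hπ hν j _ _) ?_)
  rw [heatL_add hp hπ hν hs ht]

lemma isProbabilityMeasure_heatKernel (hν : 0 < ν) {t : ℝ} (ht : 0 < t) :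
    IsProbabilityMeasure ((volume : Measure (RVec d)).withDensity
      fun y => ENNReal.ofReal (heatKernel ν t y)) := by
  refine ⟨?_⟩
  rw [withDensity_apply _ MeasurableSet.univ, Measure.restrict_univ,
    ← ofReal_integral_eq_lintegral_ofReal (integrable_heatKernel hν ht)
      (Eventually.of_forall fun y => heatKernel_nonneg hν ht y), integral_heatKernel hν ht,
    ENNReal.ofReal_one]

/-- The `Lᵖ`–`L²ᵖ` estimate for operators whose kernel is dominated by a heat kernel. -/
lemma exists_eLpNorm_convL_le (hp : p ≠ ∞) (hπ : IsHeatCovering π) (hν : 0 < ν) :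
    ∃ C : ℝ≥0, ∀ t ∈ Ioc (0 : ℝ) 2, ∀ (a : RVec d → ℝ) (ha : Integrable a) (c : ℝ≥0),
      (∀ y, |a y| ≤ c * heatKernel ν t y) → ∀ f : LVec G d p,
        eLpNorm (convL hp hπ.continuous ha f) (2 * p) volume ≤
          c * (C * powKernel (d / (4 * p.toReal)) t) * ‖f‖ₑ := by
  obtain ⟨Λ, hΛ⟩ := hπ.map_heatKernel_le ν hν
  have hp0 : p ≠ 0 := (zero_lt_one.trans_le (Fact.out : 1 ≤ p)).ne'
  have hP0 : 0 < p.toReal := ENNReal.toReal_pos hp0 hp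
  -- The supremum bound `Λ t^{-d/2}` enters with power `1/(2p)`, which gives `t^{-d/(4p)}`.
  refine ⟨Λ ^ (1 / (2 * p.toReal)), fun t ht a ha c hac f => ?_⟩
  have := isProbabilityMeasure_heatKernel (d := d) hν ht.1
  refine (eLpNorm_convL_two_mul_le hp hπ.continuous ha (continuous_heatKernel ν t).measurable hac
    (hΛ t ht) f).trans_eq ?_
  congr 2
  rw [ENNReal.mul_rpow_of_nonneg _ _ (by positivity), ENNReal.coe_rpow_of_nonneg _ (by positivity)]
  congr 1
  rw [powKernel, powKernel, if_pos ht.1, if_pos ht.1,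
    ENNReal.ofReal_rpow_of_nonneg (Real.rpow_nonneg ht.1.le _) (by positivity),
    ← Real.rpow_mul ht.1.le]
  congr 2
  field_simp
  norm_num

lemma powKernel_two_mul_le {γ t : ℝ} (hγ : 0 ≤ γ) (ht : 0 < t) :
    powKernel γ (2 * t) ≤ powKernel γ t :=
  powKernel_antitone_of_pos hγ ht (by linarith)

lemma powKernel_mono_exponent {γ γ' t : ℝ} (h : γ ≤ γ') (ht : t ≤ 1) :
    powKernel γ t ≤ powKernel γ' t := by
  unfold powKernel
  split_ifs with h0
  · exact ENNReal.ofReal_le_ofReal (Real.rpow_le_rpow_of_exponent_ge h0 ht (by linarith))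
  · exact le_rfl

lemma IsSmoothingFamily.mono {E F : Type*} [NormedAddCommGroup E] [NormedSpace ℝ E]
    [NormedAddCommGroup F] [NormedSpace ℝ F] {U : ℝ → E →L[ℝ] F} {γ : ℝ} {C C' : ℝ≥0}
    (hU : IsSmoothingFamily U γ C) (h : C ≤ C') : IsSmoothingFamily U γ C' :=
  ⟨hU.eq_zero, hU.continuousOn, fun t ht f => (hU.bound t ht f).trans (by gcongr)⟩

lemma IsSmoothingFamily.pi {E F : Type*} [NormedAddCommGroup E] [NormedSpace ℝ E]
    [NormedAddCommGroup F] [NormedSpace ℝ F] {ι : Type*} [Fintype ι] {U : ι → ℝ → E →L[ℝ] F}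
    {γ : ℝ} {C : ℝ≥0} (hU : ∀ i, IsSmoothingFamily (U i) γ C) :
    IsSmoothingFamily (fun t => ContinuousLinearMap.pi fun i => U i t) γ C where
  eq_zero t ht := by
    ext f i
    simp [(hU i).eq_zero t ht]
  continuousOn f := continuousOn_pi.2 fun i => (hU i).continuousOn f
  bound t ht f := by
    rw [← edist_zero_right, edist_pi_le_iff]
    intro i
    rw [Pi.zero_apply, edist_zero_right]
    exact (hU i).bound t ht f

lemma IsSmoothingFamily.prod {E F F' : Type*} [NormedAddCommGroup E] [NormedSpace ℝ E]
    [NormedAddCommGroup F] [NormedSpace ℝ F] [NormedAddCommGroup F'] [NormedSpace ℝ F']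
    {U : ℝ → E →L[ℝ] F} {U' : ℝ → E →L[ℝ] F'}
    {γ : ℝ} {C : ℝ≥0} (hU : IsSmoothingFamily U γ C) (hU' : IsSmoothingFamily U' γ C) :
    IsSmoothingFamily (fun t => (U t).prod (U' t)) γ C where
  eq_zero t ht := by
    ext f <;> simp [hU.eq_zero t ht, hU'.eq_zero t ht]
  continuousOn f := (hU.continuousOn f).prodMk (hU'.continuousOn f)
  bound t ht f := by
    rw [ContinuousLinearMap.prod_apply, ← edist_zero_right, Prod.edist_eq, Prod.fst_zero,
      Prod.snd_zero, edist_zero_right, edist_zero_right]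
    exact max_le (hU.bound t ht f) (hU'.bound t ht f)

end Families
-- The convection term as a bounded bilinear map.
section Nonlinearity

variable {G : Type} [MeasureSpace G] {d : ℕ} {p : ℝ≥0∞} [Fact (1 ≤ p)]

/-- The space of first-order derivatives in `L²ᵖ ∩ Lᵖ`. -/
abbrev GradSpace (G : Type) [MeasureSpace G] (d : ℕ) (p : ℝ≥0∞) : Type :=
  (Fin d → LVec G d (2 * p)) × (Fin d → LVec G d p)

instance holderTriple_two_mul (p : ℝ≥0∞) : ENNReal.HolderTriple (2 * p) (2 * p) p := by
  refine ⟨?_⟩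
  rw [ENNReal.mul_inv (by simp) (by simp), ← add_mul, ENNReal.inv_two_add_inv_two, one_mul]

/-- `(v, w) ↦ vⱼ w` as a bilinear map. -/
noncomputable def coordSMul (d : ℕ) (j : Fin d) : RVec d →L[ℝ] RVec d →L[ℝ] RVec d :=
  (ContinuousLinearMap.lsmul ℝ ℝ).comp (EuclideanSpace.proj j)

/-- The bilinear map `(f, D) ↦ ∑ⱼ fⱼ Dⱼ` from `L²ᵖ × L²ᵖ` to `Lᵖ`. -/
noncomputable def convection (G : Type) [MeasureSpace G] (d : ℕ) (p : ℝ≥0∞) [Fact (1 ≤ p)] :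
    LVec G d (2 * p) →L[ℝ] GradSpace G d p →L[ℝ] LVec G d p :=
  ∑ j, ((coordSMul d j).holderL volume (2 * p) (2 * p) p).bilinearComp
    (ContinuousLinearMap.id ℝ _)
    ((ContinuousLinearMap.proj j).comp (ContinuousLinearMap.fst ℝ _ _))

lemma convection_apply (f : LVec G d (2 * p)) (D : GradSpace G d p) :
    convection G d p f D = ∑ j, (coordSMul d j).holder p f (D.1 j) := by
  simp only [convection, sum_apply]
  rfl

lemma coeFn_lp_sum (f : Fin d → LVec G d p) :
    (∑ j, f j : LVec G d p) =ᵐ[volume] fun x => ∑ j, f j x := by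
  have h : ∀ s : Finset (Fin d), (∑ j ∈ s, f j : LVec G d p) =ᵐ[volume] fun x => ∑ j ∈ s, f j x := by
    intro s
    induction s using Finset.induction_on with
    | empty =>
      simp only [Finset.sum_empty]
      exact Lp.coeFn_zero _ _ _
    | insert j s hj ih =>
      rw [Finset.sum_insert hj]
      filter_upwards [Lp.coeFn_add (f j) (∑ j ∈ s, f j), ih] with x h1 h2
      rw [h1, Pi.add_apply, h2, Finset.sum_insert hj]
  exact h Finset.univ

lemma coeFn_convection (f : LVec G d (2 * p)) (D : GradSpace G d p) :
    convection G d p f D =ᵐ[volume] fun x => ∑ j, (f x) j • D.1 j x := by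
  rw [convection_apply]
  refine (coeFn_lp_sum _).trans ?_
  have h : ∀ᵐ x, ∀ j, (coordSMul d j).holder p f (D.1 j) x = (f x) j • D.1 j x :=
    ae_all_iff.2 fun j => (coordSMul d j).coeFn_holder f (D.1 j)
  filter_upwards [h] with x hx
  simp [hx]

end Nonlinearity

/-! ### Semigroup, gradient and convection term together. -/

section Link

variable {G : Type} [AddCommGroup G] [TopologicalSpace G] [MeasureSpace G] {d : ℕ}
  [IsTopologicalAddGroup G] [BorelSpace G] [SecondCountableTopology G]
  [LocallyCompactSpace G] [T2Space G]
  [(volume : Measure G).IsAddHaarMeasure] {p : ℝ≥0∞} [Fact (1 ≤ p)]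
  {π : RVec d → G} {ν : ℝ}

/-- `D` consists of the weak derivatives of `f`. -/
def IsGradient (π : RVec d → G) (f : LVec G d p) (D : GradSpace G d p) : Prop :=
  ∀ j, IsWeakPartial π j f (D.1 j) ∧ IsWeakPartial π j f (D.2 j)

/-- The `L²ᵖ` copy of the gradient enters the Hölder product, while the `Lᵖ` copy witnesses
membership in the Sobolev space. Uniqueness of weak derivatives identifies the two copies with each
other and with any other choice. -/
lemma isConvection_iff (hπ : IsHeatCovering π) {f w : LVec G d p} {g : LVec G d (2 * p)}
    {D : GradSpace G d p} (hfg : g =ᵐ[volume] f) (hD : IsGradient π f D) :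
    IsConvection π f w ↔ w = convection G d p g D := by
  constructor
  · rintro ⟨E, hE, hw⟩
    refine Lp.ext (hw.trans (EventuallyEq.trans ?_ (coeFn_convection g D).symm))
    have h : ∀ᵐ x, ∀ j, E j x = D.1 j x :=
      ae_all_iff.2 fun j => hπ.weakPartial_unique (hE j) (hD j).1 (ae_eq_refl _)
    filter_upwards [h, hfg] with x hx hx'
    simp only [hx, hx']
  · rintro rfl
    refine ⟨D.2, fun j => (hD j).2, (coeFn_convection g D).trans ?_⟩
    have h : ∀ᵐ x, ∀ j, D.1 j x = D.2 j x :=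
      ae_all_iff.2 fun j => hπ.weakPartial_unique (hD j).1 (hD j).2 (ae_eq_refl _)
    filter_upwards [h, hfg] with x hx hx'
    simp only [hx, hx']

/-- The heat semigroup and its gradient as smoothing families. -/
lemma exists_smoothingFamilies (hp : p ≠ ∞) (hπ : IsHeatCovering π) (hν : 0 < ν) :
    ∃ (UA : ℝ → LVec G d p →L[ℝ] LVec G d (2 * p)) (UB : ℝ → LVec G d p →L[ℝ] GradSpace G d p)
      (C : ℝ≥0), 1 ≤ C ∧ IsSmoothingFamily UA (d / (4 * p.toReal)) C ∧
      IsSmoothingFamily UB (1 / 2 + d / (4 * p.toReal)) C ∧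
      (∀ t f, UA t f =ᵐ[volume] heatL hp hπ.continuous hν t f) ∧
      ∀ t f, IsGradient π (heatL hp hπ.continuous hν t f) (UB t f) := by
  obtain ⟨C, hC⟩ := exists_eLpNorm_convL_le (p := p) hp hπ hν
  set α := (d : ℝ) / (4 * p.toReal) with hα
  have hα0 : 0 ≤ α := by positivity
  obtain ⟨UA, hUA, hUA'⟩ := exists_isSmoothingFamily hp hπ hν (heatL hp hπ.continuous hν)
    (isSmoothingFamily_heatL hp hπ.continuous hπ.map_add hν).eq_zero
    (fun s hs t ht f => heatL_add hp hπ hν hs ht f) (r := 2 * p) (γ := α) (C := C)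
    (fun t ht f => by
      rw [heatL_of_pos _ _ _ ht.1]
      have := hC t ⟨ht.1, ht.2.trans one_le_two⟩ _ (integrable_heatKernel hν ht.1) 1
        (fun y => by rw [abs_of_nonneg (heatKernel_nonneg hν ht.1 y), NNReal.coe_one, one_mul]) f
      simpa using this)
  set c : ℝ≥0 := (heatDerivConst d ν).toNNReal with hc
  have hcc : (c : ℝ) = heatDerivConst d ν :=
    Real.coe_toNNReal _ (by unfold heatDerivConst; positivity)
  have hpk : ∀ t : ℝ, 0 < t → powKernel (1 / 2) t = ((t ^ (-(1 / 2) : ℝ)).toNNReal : ℝ≥0) := by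
    intro t ht
    rw [powKernel, if_pos ht]
    rfl
  have hder : ∀ (j : Fin d) (t : ℝ), 0 < t → ∀ y : RVec d, |heatKernelDeriv ν j t y| ≤
      ((c * (t ^ (-(1 / 2) : ℝ)).toNNReal : ℝ≥0) : ℝ) * heatKernel ν (2 * t) y := by
    intro j t ht y
    rw [NNReal.coe_mul, hcc, Real.coe_toNNReal _ (by positivity)]
    exact abs_heatKernelDeriv_le hν ht j y
  have h0 : ∀ (j : Fin d) (t : ℝ), t ≤ 0 →
      (heatDerivL hp hπ.continuous hν j t : LVec G d p →L[ℝ] LVec G d p) = 0 :=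
    fun j t ht => dif_neg (not_lt.2 ht)
  -- The kernel of `∂ⱼ S_t` is at most `c t^{-1/2}` times the heat kernel at time `2t`, so the gain
  -- of integrability is applied at time `2t`.
  have hB1 := fun j : Fin d => exists_isSmoothingFamily hp hπ hν
    (heatDerivL hp hπ.continuous hν j) (h0 j)
    (fun s hs t ht f => heatDerivL_add hp hπ hν j hs ht f) (r := 2 * p) (γ := 1 / 2 + α)
    (C := c * C)
    (fun t ht f => by
      rw [heatDerivL_of_pos _ _ _ _ ht.1]
      refine (hC (2 * t) ⟨by linarith [ht.1], by linarith [ht.2]⟩ _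
        (integrable_heatKernelDeriv hν ht.1 j) _ (hder j t ht.1) f).trans ?_
      rw [← powKernel_mul, hpk t ht.1, ENNReal.coe_mul, ENNReal.coe_mul]
      calc _ ≤ (c : ℝ≥0∞) * ((t ^ (-(1 / 2) : ℝ)).toNNReal : ℝ≥0) * (C * powKernel α t) * ‖f‖ₑ := by
            gcongr
            exact powKernel_two_mul_le hα0 ht.1
        _ = _ := by ring)
  -- In `Lᵖ` the singularity is only `t^{-1/2}`; for `t ≤ 1` it is weakened to the exponent of the
  -- `L²ᵖ` component so that both share one bound.
  have hB2 := fun j : Fin d => exists_isSmoothingFamily hp hπ hν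
    (heatDerivL hp hπ.continuous hν j) (h0 j)
    (fun s hs t ht f => heatDerivL_add hp hπ hν j hs ht f) (r := p) (γ := 1 / 2 + α)
    (C := c)
    (fun t ht f => by
      rw [heatDerivL_of_pos _ _ _ _ ht.1, ← Lp.enorm_def]
      have h2t : 0 < 2 * t := by linarith [ht.1]
      have h1 : ‖convL hp hπ.continuous (integrable_heatKernelDeriv hν ht.1 j) f‖ ≤
          ((c * (t ^ (-(1 / 2) : ℝ)).toNNReal : ℝ≥0) : ℝ) * ‖f‖ := by
        refine (norm_convL_le _ _ _ _).trans (mul_le_mul_of_nonneg_right ?_ (norm_nonneg _))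
        refine (integral_mono (integrable_heatKernelDeriv hν ht.1 j).norm
          ((integrable_heatKernel hν h2t).const_mul _) (hder j t ht.1)).trans_eq ?_
        rw [integral_const_mul, integral_heatKernel hν h2t, mul_one]
      have h2 : ‖convL hp hπ.continuous (integrable_heatKernelDeriv hν ht.1 j) f‖ₑ ≤
          ((c * (t ^ (-(1 / 2) : ℝ)).toNNReal : ℝ≥0) : ℝ≥0∞) * ‖f‖ₑ := by
        rw [← ofReal_norm, ← ofReal_norm, ← ENNReal.ofReal_coe_nnreal,
          ← ENNReal.ofReal_mul (by positivity)]
        exact ENNReal.ofReal_le_ofReal h1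
      refine h2.trans ?_
      rw [ENNReal.coe_mul, ← hpk t ht.1]
      gcongr
      exact powKernel_mono_exponent (by linarith) ht.2)
  choose U1 hU1 hU1' using hB1
  choose U2 hU2 hU2' using hB2
  set C' : ℝ≥0 := max 1 (max C (max (c * C) c)) with hC'
  refine ⟨UA, fun t => (ContinuousLinearMap.pi fun j => U1 j t).prod
    (ContinuousLinearMap.pi fun j => U2 j t), C', le_max_left _ _,
    hUA.mono (by simp [hC']), ?_, hUA', ?_⟩
  · refine IsSmoothingFamily.prod (IsSmoothingFamily.pi fun j => (hU1 j).mono ?_)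
      (IsSmoothingFamily.pi fun j => (hU2 j).mono ?_)
    · exact ((le_max_left _ _).trans (le_max_right _ _)).trans (le_max_right _ _)
    · exact ((le_max_right _ _).trans (le_max_right _ _)).trans (le_max_right _ _)
  · intro t f j
    have hw := isWeakPartial_heatL hp hπ hν j t f
    refine ⟨fun φ hφ => ?_, fun φ hφ => ?_⟩
    · rw [hw φ hφ]
      congr 1
      refine integral_congr_ae ?_
      filter_upwards [hU1' j t f] with x hx
      simp [hx]
    · rw [hw φ hφ]
      congr 1
      refine integral_congr_ae ?_
      filter_upwards [hU2' j t f] with x hx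
      simp [hx]

lemma isGradient_iff (hπ : IsHeatCovering π) (f : LVec G d p) (D : GradSpace G d p) :
    IsGradient π f D ↔ ∀ (j : Fin d) (φ : G → ℝ) (hφ : IsTestFunction π φ),
      pairing (hπ.memLp_partialDeriv hφ j _) f = - pairing (hπ.memLp hφ _) (D.1 j) ∧
      pairing (hπ.memLp_partialDeriv hφ j _) f = - pairing (hπ.memLp hφ _) (D.2 j) := by
  simp only [IsGradient, hπ.isWeakPartial_iff, forall_and]

/-- Linear relations between smoothing families carry over to the mild formulation. -/
lemma mildPart_relation {E F F' W : Type*} [NormedAddCommGroup E] [NormedSpace ℝ E]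
    [NormedAddCommGroup F] [NormedSpace ℝ F] [CompleteSpace F] [NormedAddCommGroup F']
    [NormedSpace ℝ F'] [CompleteSpace F'] [NormedAddCommGroup W] [NormedSpace ℝ W]
    [CompleteSpace W] {U : ℝ → E →L[ℝ] F} {U' : ℝ → E →L[ℝ] F'} (ℓ : F →L[ℝ] W) (ℓ' : F' →L[ℝ] W)
    (h : ∀ t f, ℓ (U t f) = ℓ' (U' t f)) {τ t : ℝ} {v₀ : E} {z : ℝ → F} {z' : ℝ → F'} {N : ℝ → E}
    (hz : ℓ (z t) = ℓ' (z' t)) (hi : IntegrableOn (fun s => U (t - s) (N s)) (Ioc 0 τ))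
    (hi' : IntegrableOn (fun s => U' (t - s) (N s)) (Ioc 0 τ)) :
    ℓ (mildPart U τ v₀ z N t) = ℓ' (mildPart U' τ v₀ z' N t) := by
  simp only [mildPart, map_add, hz, h]
  rw [← ContinuousLinearMap.integral_comp_comm _ hi, ← ContinuousLinearMap.integral_comp_comm _ hi']
  simp only [h]

end Link
-- Shifts in time.
section Shift

lemma measurePreserving_add_restrict_Ioc (a b c : ℝ) :
    MeasurePreserving (fun r : ℝ => a + r) (volume.restrict (Ioc b c))
      (volume.restrict (Ioc (a + b) (a + c))) := by
  have h := (measurePreserving_add_left (volume : Measure ℝ) a).restrict_preimage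
    (measurableSet_Ioc (a := a + b) (b := a + c))
  have e : (fun r : ℝ => a + r) ⁻¹' Ioc (a + b) (a + c) = Ioc b c := by
    ext r
    simp
  rwa [e] at h

lemma integrableOn_comp_add {E : Type*} [NormedAddCommGroup E] {f : ℝ → E} (a b c : ℝ) :
    IntegrableOn (fun r => f (a + r)) (Ioc b c) ↔ IntegrableOn f (Ioc (a + b) (a + c)) :=
  (measurePreserving_add_restrict_Ioc a b c).integrable_comp_emb (measurableEmbedding_addLeft a)

lemma ae_comp_add {P : ℝ → Prop} (a b c : ℝ) :
    (∀ᵐ r ∂(volume.restrict (Ioc b c)), P (a + r)) ↔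
      ∀ᵐ s ∂(volume.restrict (Ioc (a + b) (a + c))), P s := by
  rw [← (measurePreserving_add_restrict_Ioc a b c).map_eq,
    (measurableEmbedding_addLeft a).ae_map_iff]

end Shift

/-! ### The mild equation as a fixed point equation for the nonlinearity. -/

section Blowup

variable {G : Type} [AddCommGroup G] [TopologicalSpace G] [MeasureSpace G] {d : ℕ}
  [IsTopologicalAddGroup G] [BorelSpace G] [SecondCountableTopology G]
  [LocallyCompactSpace G] [T2Space G]
  [(volume : Measure G).IsAddHaarMeasure] {p : ℝ≥0∞} [Fact (1 ≤ p)]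
  {π : RVec d → G} {ν : ℝ}

/-- The driving path as a bounded measurable path of functions in `L²ᵖ` with gradients. -/
lemma exists_path_of_memLinftySobolev {T : ℝ} {z : ℝ → LVec G d p}
    (h2 : MemLinftySobolev π T (2 * p) fun t => (z t : G → RVec d))
    (h1 : MemLinftySobolev π T p fun t => (z t : G → RVec d)) :
    ∃ (zA : ℝ → LVec G d (2 * p)) (zB : ℝ → GradSpace G d p) (Z : ℝ≥0),
      AEStronglyMeasurable zA (volume.restrict (Ioo 0 T)) ∧
      AEStronglyMeasurable zB (volume.restrict (Ioo 0 T)) ∧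
      ∀ᵐ t ∂(volume.restrict (Ioo 0 T)), ‖zA t‖ₑ ≤ Z ∧ ‖zB t‖ₑ ≤ Z ∧ zA t =ᵐ[volume] z t ∧
        IsGradient π (z t) (zB t) := by
  obtain ⟨w2, D2, hw2, hD2, hz2⟩ := h2
  obtain ⟨w1, D1, hw1, hD1, hz1⟩ := h1
  have hbd : ∀ {F : Type} [NormedAddCommGroup F] (g : ℝ → F),
      MemLp g ∞ (volume.restrict (Ioo 0 T)) →
      ∀ᵐ t ∂(volume.restrict (Ioo 0 T)),
        ‖g t‖ₑ ≤ (eLpNorm g ∞ (volume.restrict (Ioo 0 T))).toNNReal := by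
    intro F _ g hg
    rw [ENNReal.coe_toNNReal hg.2.ne, eLpNorm_exponent_top]
    exact ae_le_eLpNormEssSup
  have hzB : MemLp (fun t => ((fun j => D2 j t, fun j => D1 j t) : GradSpace G d p)) ∞
      (volume.restrict (Ioo 0 T)) := by
    exact MemLp.of_fst_snd ⟨memLp_pi_iff.2 hD2, memLp_pi_iff.2 hD1⟩
  refine ⟨w2, fun t => (fun j => D2 j t, fun j => D1 j t),
    max (eLpNorm w2 ∞ (volume.restrict (Ioo 0 T))).toNNReal
    (eLpNorm (fun t => ((fun j => D2 j t, fun j => D1 j t) : GradSpace G d p)) ∞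
      (volume.restrict (Ioo 0 T))).toNNReal, hw2.1, hzB.1, ?_⟩
  filter_upwards [hbd _ hw2, hbd _ hzB, hz2, hz1] with t b1 b2 e2 e1
  refine ⟨b1.trans (by exact_mod_cast le_max_left _ _),
    b2.trans (by exact_mod_cast le_max_right _ _), e2.1, fun j => ⟨fun φ hφ => ?_, fun φ hφ => ?_⟩⟩
  · rw [← e2.2 j φ hφ]
    refine integral_congr_ae ?_
    filter_upwards [e2.1] with x hx
    rw [hx]
  · rw [← e1.2 j φ hφ]
    refine integral_congr_ae ?_
    filter_upwards [e1.1] with x hx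
    rw [hx]

/-- The mild formulation of the Burgers equation as a fixed point equation for the
nonlinearity. -/
lemma ae_isConvection_iff (hp : p ≠ ∞) (hπ : IsHeatCovering π) (hν : 0 < ν)
    {UA : ℝ → LVec G d p →L[ℝ] LVec G d (2 * p)} {UB : ℝ → LVec G d p →L[ℝ] GradSpace G d p}
    {α β : ℝ} {C : ℝ≥0} (hα : 0 ≤ α) (hβ : 0 ≤ β) (hαβ : α + β < 1)
    (hUA : IsSmoothingFamily UA α C) (hUB : IsSmoothingFamily UB β C)
    (hA : ∀ t f, UA t f =ᵐ[volume] heatL hp hπ.continuous hν t f)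
    (hB : ∀ t f, IsGradient π (heatL hp hπ.continuous hν t f) (UB t f))
    {τ : ℝ} (hτ : τ ∈ Ioc (0 : ℝ) 1) (v₀ : LVec G d p) {z : ℝ → LVec G d p}
    {zA : ℝ → LVec G d (2 * p)} {zB : ℝ → GradSpace G d p}
    (hz : ∀ᵐ t ∂(volume.restrict (Ioc 0 τ)), zA t =ᵐ[volume] z t ∧ IsGradient π (z t) (zB t))
    {N : ℝ → LVec G d p} (hN : IntegrableOn N (Ioc 0 τ)) :
    ∀ᵐ t ∂(volume.restrict (Ioc 0 τ)), ∀ w,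
      IsConvection π (z t + duhamel π ν v₀ N t) w ↔
        w = picardMap (convection G d p) UA UB τ v₀ zA zB N t := by
  filter_upwards [hz, hUA.ae_integrable hα (by linarith) hτ hN,
    hUB.ae_integrable hβ (by linarith) hτ hN, ae_restrict_mem measurableSet_Ioc]
    with t ht hiA hiB htτ w
  have hi := integrableOn_heatL hp hπ.continuous hπ.map_add hν hN t
  rw [duhamel_eq_mildPart hp hπ.continuous hπ.map_add hν v₀ N z htτ]
  refine isConvection_iff hπ ?_ ?_
  -- The same Duhamel integral is taken once in `L²ᵖ` and once in `Lᵖ`; functionals defined on both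
  -- spaces show that the values agree.
  · refine ae_eq_of_forall_setIntegral_eq_of_lp _ _ fun s hs hμ => ?_
    have hcongr : ∀ (g : LVec G d (2 * p)) (f : LVec G d p), g =ᵐ[volume] f →
        pairing (memLp_indicator_one hs hμ.ne _) g = pairing (memLp_indicator_one hs hμ.ne _) f := by
      intro g f h
      rw [pairing_indicator hs hμ.ne, pairing_indicator hs hμ.ne]
      exact setIntegral_congr_ae hs (h.mono fun x hx _ => hx)
    rw [← pairing_indicator hs hμ.ne, ← pairing_indicator hs hμ.ne]
    exact mildPart_relation _ _ (fun t f => hcongr _ _ (hA t f)) (hcongr _ _ ht.1) hiA hi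
  -- The exceptional null set of times comes only from integrability and from `z`, hence it does not
  -- depend on the test function.
  · rw [isGradient_iff hπ]
    intro j φ hφ
    have hB' := fun t f => (isGradient_iff hπ _ _).1 (hB t f) j φ hφ
    have hz' := (isGradient_iff hπ _ _).1 ht.2 j φ hφ
    constructor
    · exact mildPart_relation (pairing (hπ.memLp_partialDeriv hφ j _))
        (-((pairing (hπ.memLp hφ _)).comp ((ContinuousLinearMap.proj j).comp
          (ContinuousLinearMap.fst ℝ (Fin d → LVec G d (2 * p)) (Fin d → LVec G d p)))))
        (fun t f => (hB' t f).1) hz'.1 hi hiB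
    · exact mildPart_relation (pairing (hπ.memLp_partialDeriv hφ j _))
        (-((pairing (hπ.memLp hφ _)).comp ((ContinuousLinearMap.proj j).comp
          (ContinuousLinearMap.snd ℝ (Fin d → LVec G d (2 * p)) (Fin d → LVec G d p)))))
        (fun t f => (hB' t f).2) hz'.2 hi hiB

lemma isConvection_unique (hπ : IsHeatCovering π) {f w w' : LVec G d p}
    (h : IsConvection π f w) (h' : IsConvection π f w') : w = w' := by
  obtain ⟨D, hD, hw⟩ := h
  obtain ⟨D', hD', hw'⟩ := h'
  refine Lp.ext (hw.trans (EventuallyEq.trans ?_ hw'.symm))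
  have h : ∀ᵐ x, ∀ j, D j x = D' j x :=
    ae_all_iff.2 fun j => hπ.weakPartial_unique (hD j) (hD' j) (ae_eq_refl _)
  filter_upwards [h] with x hx
  simp only [hx]

/-- The nonlinearity of a local mild solution on `[0,Tmax)`. -/
lemma exists_nonlinearity (hπ : IsHeatCovering π) {Tmax : ℝ} {u₀ : LVec G d p}
    {z u : ℝ → LVec G d p} (hT : 0 < Tmax)
    (hu : ∀ T' ∈ Ioo 0 Tmax, IsMildSolution π ν T' u₀ z u) :
    ∃ N : ℝ → LVec G d p, (∀ T' < Tmax, IntegrableOn N (Ioc 0 T')) ∧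
      (∀ᵐ s ∂(volume.restrict (Ioo 0 Tmax)), IsConvection π (u s) (N s)) ∧
      ∀ t ∈ Ico 0 Tmax, u t - z t = duhamel π ν u₀ N t := by
  classical
  -- Each `T'` comes with its own nonlinearity; uniqueness of the convection term lets one choice
  -- serve all of them up to null sets.
  let N : ℝ → LVec G d p := fun s =>
    if h : ∃ w, IsConvection π (u s) w then h.choose else 0
  have hN : ∀ s w, IsConvection π (u s) w → w = N s := by
    intro s w hw
    have h : ∃ w, IsConvection π (u s) w := ⟨w, hw⟩
    simp only [N, dif_pos h]
    exact isConvection_unique hπ hw h.choose_spec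
  have key : ∀ T' ∈ Ioo 0 Tmax, IntegrableOn N (Ioc 0 T') ∧
      (∀ᵐ s ∂(volume.restrict (Ioc 0 T')), IsConvection π (u s) (N s)) ∧
      ∀ t ∈ Icc 0 T', u t - z t = duhamel π ν u₀ N t := by
    intro T' hT'
    obtain ⟨-, N', hN'i, hN'c, hN'e⟩ := hu T' hT'
    have hae : N' =ᵐ[volume.restrict (Ioc 0 T')] N := hN'c.mono fun s hs => hN s _ hs
    refine ⟨hN'i.congr hae, ?_, fun t ht => ?_⟩
    · filter_upwards [hN'c, hae] with s hs hs'
      rwa [← hs']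
    · rw [hN'e t ht, duhamel, intervalIntegral.integral_of_le ht.1,
        intervalIntegral.integral_of_le ht.1]
      congr 1
      refine integral_congr_ae ?_
      filter_upwards [ae_restrict_of_ae_restrict_of_subset (Ioc_subset_Ioc_right ht.2) hae]
        with s hs
      rw [hs]
  refine ⟨N, fun T' hT' => ?_, ?_, fun t ht => ?_⟩
  · rcases le_or_gt T' 0 with h | h
    · simp [Ioc_eq_empty_of_le h]
    · exact (key T' ⟨h, hT'⟩).1
  -- The property is known on each `(0,T']` with `T' < Tmax`, and countably many of these exhaust
  -- the interval.
  · refine ae_restrict_of_ae_restrict_inter_Ioo fun a b ha hb hab => ?_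
    refine ae_restrict_of_ae_restrict_of_subset ?_ (key b hb).2.1
    exact fun x hx => ⟨hx.1.1, hx.2.2.le⟩
  · exact (key ((t + Tmax) / 2) ⟨by linarith [ht.1], by linarith [ht.2]⟩).2.2 t
      ⟨ht.1, by linarith [ht.2]⟩

end Blowup
-- Integrability up to the maximal time, continuation and blow-up.
section Blowup

variable {G : Type} [AddCommGroup G] [TopologicalSpace G] [MeasureSpace G] {d : ℕ}
  [IsTopologicalAddGroup G] [BorelSpace G] [SecondCountableTopology G]
  [LocallyCompactSpace G] [T2Space G]
  [(volume : Measure G).IsAddHaarMeasure] {p : ℝ≥0∞} [Fact (1 ≤ p)]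
  {π : RVec d → G} {ν : ℝ}

/-- The nonlinearity of a mild solution which is bounded in `Lᵖ` near `Tmax` is integrable up to
`Tmax`. -/
lemma integrableOn_nonlinearity_of_bounded (hp : p ≠ ∞) (hπ : IsHeatCovering π) (hν : 0 < ν)
    {UA : ℝ → LVec G d p →L[ℝ] LVec G d (2 * p)} {UB : ℝ → LVec G d p →L[ℝ] GradSpace G d p}
    {α β : ℝ} {C : ℝ≥0} (hα : 0 ≤ α) (hβ : 0 ≤ β) (hαβ : α + β < 1) (hC : 1 ≤ C)
    (hUA : IsSmoothingFamily UA α C) (hUB : IsSmoothingFamily UB β C)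
    (hA : ∀ t f, UA t f =ᵐ[volume] heatL hp hπ.continuous hν t f)
    (hB : ∀ t f, IsGradient π (heatL hp hπ.continuous hν t f) (UB t f))
    {Tmax : ℝ} (hT : 0 < Tmax) {u₀ : LVec G d p} {z u N : ℝ → LVec G d p}
    {zA : ℝ → LVec G d (2 * p)} {zB : ℝ → GradSpace G d p} {Z M : ℝ≥0}
    (hz : ∀ᵐ t ∂(volume.restrict (Ioo 0 Tmax)), ‖zA t‖ₑ ≤ Z ∧ ‖zB t‖ₑ ≤ Z ∧
      zA t =ᵐ[volume] z t ∧ IsGradient π (z t) (zB t))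
    (hN : ∀ T' < Tmax, IntegrableOn N (Ioc 0 T'))
    (hNc : ∀ᵐ s ∂(volume.restrict (Ioo 0 Tmax)), IsConvection π (u s) (N s))
    (huN : ∀ t ∈ Ico 0 Tmax, u t - z t = duhamel π ν u₀ N t)
    {t₁ : ℝ} (ht₁ : t₁ < Tmax) (hM : ∀ t ∈ Ioo t₁ Tmax, ‖u t - z t‖₊ ≤ M) :
    IntegrableOn N (Ioc 0 Tmax) := by
  -- The length `τ` depends on the bounds `Z` and `M` but not on the restart time, so `t₀` can be
  -- taken within `τ` of `Tmax`.
  obtain ⟨τ, hτ, hκ⟩ := exists_bilinConst_mul_le (convection G d p) C hαβ (Z + M)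
  obtain ⟨t₀, ht₀, ht₀T⟩ := exists_between (show max (max 0 t₁) (Tmax - τ) < Tmax from
    max_lt (max_lt hT ht₁) (by linarith [hτ.1]))
  have ht₀0 : 0 < t₀ := ((le_max_left _ _).trans (le_max_left _ _)).trans_lt ht₀
  have ht₀1 : t₁ < t₀ := ((le_max_right _ _).trans (le_max_left _ _)).trans_lt ht₀
  have ht₀τ : Tmax - τ < t₀ := (le_max_right _ _).trans_lt ht₀
  set v₀ := duhamel π ν u₀ N t₀ with hv₀
  have hv₀M : Z + ‖v₀‖₊ ≤ Z + M := by
    rw [hv₀, ← huN t₀ ⟨ht₀0.le, ht₀T⟩]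
    gcongr
    exact hM t₀ ⟨ht₀1, ht₀T⟩
  have hbound : ∀ r, 0 ≤ r → r < Tmax - t₀ → ∫⁻ s in Ioc 0 r, ‖N (t₀ + s)‖ₑ ≤ ((Z + M : ℝ≥0) : ℝ≥0∞) + 1 := by
    intro r hr hrT
    have hint : ∀ t, t < Tmax - t₀ → IntegrableOn (fun s => N (t₀ + s)) (Ioc 0 t) := fun t ht => by
      rw [integrableOn_comp_add, add_zero]
      exact (hN (t₀ + t) (by linarith)).mono_set (Ioc_subset_Ioc_left ht₀0.le)
    refine lintegral_le_of_forall_le_sq (K := Z + M)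
      (κ := bilinConst (convection G d p) C α β τ) hr (hint r hrT) hκ fun t ht => ?_
    rcases ht.1.eq_or_lt with rfl | ht0
    · simp
    have htT : t < Tmax - t₀ := ht.2.trans_lt hrT
    have hsub : Ioc (t₀ + 0) (t₀ + t) ⊆ Ioo 0 Tmax := fun s hs =>
      ⟨by linarith [hs.1], by linarith [hs.2]⟩
    have hz' := (ae_comp_add t₀ 0 t).2 (ae_restrict_of_ae_restrict_of_subset hsub hz)
    have hNc' := (ae_comp_add t₀ 0 t).2 (ae_restrict_of_ae_restrict_of_subset hsub hNc)
    have hτ' : t ∈ Ioc (0 : ℝ) 1 := ⟨ht0, by linarith [hτ.2]⟩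
    have hiff := ae_isConvection_iff hp hπ hν hα hβ hαβ hUA hUB hA hB hτ' v₀
      (z := fun s => z (t₀ + s)) (zA := fun s => zA (t₀ + s)) (zB := fun s => zB (t₀ + s))
      (hz'.mono fun s hs => hs.2.2) (hint t htT)
    have hfix : ∀ᵐ s ∂(volume.restrict (Ioc 0 t)), N (t₀ + s) =
        picardMap (convection G d p) UA UB t v₀ (fun s => zA (t₀ + s)) (fun s => zB (t₀ + s))
          (fun s => N (t₀ + s)) s := by
      -- Restarted at `t₀`, the given solution makes the shifted nonlinearity a fixed point of the
      -- Picard map with datum `v₀`.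
      filter_upwards [hiff, hNc', ae_restrict_mem measurableSet_Ioc] with s h1 h2 hs
      refine (h1 _).1 ?_
      have h3 : u (t₀ + s) = z (t₀ + s) + duhamel π ν v₀ (fun s => N (t₀ + s)) s := by
        rw [hv₀, ← duhamel_add hp hπ.continuous hπ.map_add hν u₀ ht₀0.le hs.1.le
          (hN _ (by linarith [hs.2])), ← huN _ ⟨by linarith [hs.1], by linarith [hs.2]⟩]
        abel
      rwa [← h3]
    calc ∫⁻ s in Ioc 0 t, ‖N (t₀ + s)‖ₑ = ∫⁻ s in Ioc 0 t, ‖picardMap (convection G d p) UA UB t v₀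
          (fun s => zA (t₀ + s)) (fun s => zB (t₀ + s)) (fun s => N (t₀ + s)) s‖ₑ := by
          refine lintegral_congr_ae ?_
          filter_upwards [hfix] with s hs
          rw [← hs]
      _ ≤ _ := lintegral_picardMap_le _ hα hβ hαβ hC hUA hUB ⟨hτ'.1.le, hτ'.2⟩ hv₀M
          (hz'.mono fun s hs => hs.1) (hz'.mono fun s hs => hs.2.1) (hint t htT).1
      _ ≤ _ := by
          gcongr
          exact bilinConst_mono _ C hαβ ht.1 (by linarith)
  have h2 : IntegrableOn (fun s => N (t₀ + s)) (Ioc 0 (Tmax - t₀)) := by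
    have hpos : 0 < Tmax - t₀ := by linarith
    -- The bound `Z + M + 1` is uniform over the exhausting intervals, so integrability extends to
    -- the closed end.
    refine integrableOn_Ioc_of_intervalIntegral_norm_bounded_right (l := atTop)
      (b := fun n : ℕ => (Tmax - t₀) - (Tmax - t₀) * (1 / ((n : ℝ) + 1)))
      (I := ((Z + M : ℝ≥0) : ℝ) + 1) (fun n => ?_) ?_ (Eventually.of_forall fun n => ?_)
    · rw [integrableOn_comp_add, add_zero]
      have : 0 < (Tmax - t₀) * (1 / ((n : ℝ) + 1)) := by positivity
      exact (hN _ (by linarith)).mono_set (Ioc_subset_Ioc_left ht₀0.le)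
    · have := (tendsto_one_div_add_atTop_nhds_zero_nat (𝕜 := ℝ)).const_mul (Tmax - t₀)
      simpa using this.const_sub (Tmax - t₀)
    · have h1 : 0 < (Tmax - t₀) * (1 / ((n : ℝ) + 1)) := by positivity
      have h1' : (Tmax - t₀) * (1 / ((n : ℝ) + 1)) ≤ Tmax - t₀ := by
        refine mul_le_of_le_one_right hpos.le ?_
        rw [div_le_one (by positivity)]
        linarith [(Nat.cast_nonneg n : (0 : ℝ) ≤ n)]
      have hi : IntegrableOn (fun s => N (t₀ + s))
          (Ioc 0 ((Tmax - t₀) - (Tmax - t₀) * (1 / ((n : ℝ) + 1)))) := by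
        rw [integrableOn_comp_add, add_zero]
        exact (hN _ (by linarith)).mono_set (Ioc_subset_Ioc_left ht₀0.le)
      rw [integral_norm_eq_lintegral_enorm hi.1]
      refine (ENNReal.toReal_mono (by finiteness) (hbound _ (by linarith) (by linarith))).trans_eq ?_
      rw [ENNReal.toReal_add (by finiteness) (by finiteness), ENNReal.coe_toReal,
        ENNReal.toReal_one]
  rw [integrableOn_comp_add, add_zero, add_sub_cancel] at h2
  rw [← Ioc_union_Ioc_eq_Ioc ht₀0.le ht₀T.le]
  exact (hN t₀ ht₀T).union h2

/-- A mild solution with integrable nonlinearity up to `Tmax < T` can be continued. -/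
lemma exists_continuation (hp : p ≠ ∞) (hπ : IsHeatCovering π) (hν : 0 < ν)
    {UA : ℝ → LVec G d p →L[ℝ] LVec G d (2 * p)} {UB : ℝ → LVec G d p →L[ℝ] GradSpace G d p}
    {α β : ℝ} {C : ℝ≥0} (hα : 0 ≤ α) (hβ : 0 ≤ β) (hαβ : α + β < 1) (hC : 1 ≤ C)
    (hUA : IsSmoothingFamily UA α C) (hUB : IsSmoothingFamily UB β C)
    (hA : ∀ t f, UA t f =ᵐ[volume] heatL hp hπ.continuous hν t f)
    (hB : ∀ t f, IsGradient π (heatL hp hπ.continuous hν t f) (UB t f))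
    {T Tmax : ℝ} (hT : 0 < Tmax) (hTT : Tmax < T) {u₀ : LVec G d p} {z u N : ℝ → LVec G d p}
    {zA : ℝ → LVec G d (2 * p)} {zB : ℝ → GradSpace G d p} {Z : ℝ≥0}
    (hzAm : AEStronglyMeasurable zA (volume.restrict (Ioo 0 T)))
    (hzBm : AEStronglyMeasurable zB (volume.restrict (Ioo 0 T)))
    (hz : ∀ᵐ t ∂(volume.restrict (Ioo 0 T)), ‖zA t‖ₑ ≤ Z ∧ ‖zB t‖ₑ ≤ Z ∧
      zA t =ᵐ[volume] z t ∧ IsGradient π (z t) (zB t))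
    (hzc : ContinuousOn z (Ico 0 T))
    (hN : IntegrableOn N (Ioc 0 Tmax))
    (hNc : ∀ᵐ s ∂(volume.restrict (Ioo 0 Tmax)), IsConvection π (u s) (N s))
    (huN : ∀ t ∈ Ico 0 Tmax, u t - z t = duhamel π ν u₀ N t) :
    ∃ T' ∈ Ioc Tmax T, ∃ u' : ℝ → LVec G d p,
      IsMildSolution π ν T' u₀ z u' ∧ EqOn u' u (Ico 0 Tmax) := by
  set v₁ := duhamel π ν u₀ N Tmax with hv₁
  obtain ⟨τ₀, hτ₀, hκ₀⟩ := exists_bilinConst_mul_le (convection G d p) C hαβ (Z + ‖v₁‖₊)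
  -- Half of the distance keeps the new end strictly below `T`, where `z` is still continuous.
  set τ := min τ₀ ((T - Tmax) / 2) with hτdef
  have hτ : τ ∈ Ioc (0 : ℝ) 1 :=
    ⟨lt_min hτ₀.1 (by linarith), (min_le_left _ _).trans hτ₀.2⟩
  have hτT : Tmax + τ < T := by linarith [min_le_right τ₀ ((T - Tmax) / 2)]
  have hκ : bilinConst (convection G d p) C α β τ * (16 * ((Z + ‖v₁‖₊ : ℝ≥0) + 1)) ≤ 1 :=
    (mul_le_mul_left (bilinConst_mono _ C hαβ hτ.1.le (min_le_left _ _)) _).trans hκ₀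
  have hsub : Ioc (Tmax + 0) (Tmax + τ) ⊆ Ioo 0 T := fun s hs =>
    ⟨by linarith [hs.1], by linarith [hs.2]⟩
  have hz' := (ae_comp_add Tmax 0 τ).2 (ae_restrict_of_ae_restrict_of_subset hsub hz)
  have hmp := measurePreserving_add_restrict_Ioc Tmax 0 τ
  have hzAm' := (hzAm.mono_set hsub).comp_measurePreserving hmp
  have hzBm' := (hzBm.mono_set hsub).comp_measurePreserving hmp
  obtain ⟨N₁, hN₁, hfix⟩ := exists_picardMap_fixedPoint (v₀ := v₁) (convection G d p) hα hβ hαβ hC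
    hUA hUB hτ le_rfl hκ (hz'.mono fun s hs => hs.1) (hz'.mono fun s hs => hs.2.1) hzAm' hzBm'
  -- Gluing is done on the nonlinearities: their concatenation is integrable, so continuity of the
  -- extended solution across `Tmax` follows from that of the Duhamel formula.
  let N' : ℝ → LVec G d p := fun s => if s ≤ Tmax then N s else N₁ (s - Tmax)
  have hN'1 : EqOn N' N (Iic Tmax) := fun s hs => if_pos hs
  have hN'2 : ∀ r, 0 < r → N' (Tmax + r) = N₁ r := fun r hr => by
    simp only [N', if_neg (show ¬ Tmax + r ≤ Tmax by linarith), add_sub_cancel_left]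
  have hN'i : IntegrableOn N' (Ioc 0 (Tmax + τ)) := by
    rw [← Ioc_union_Ioc_eq_Ioc hT.le (show Tmax ≤ Tmax + τ by linarith [hτ.1])]
    refine IntegrableOn.union ?_ ?_
    · exact hN.congr_fun (fun s hs => (hN'1 hs.2).symm) measurableSet_Ioc
    · have h : IntegrableOn (fun r => N' (Tmax + r)) (Ioc 0 τ) :=
        hN₁.congr_fun (fun r hr => (hN'2 r hr.1).symm) measurableSet_Ioc
      rwa [integrableOn_comp_add, add_zero] at h
  have hd1 : ∀ t ∈ Icc 0 Tmax, duhamel π ν u₀ N' t = duhamel π ν u₀ N t := by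
    intro t ht
    rw [duhamel, duhamel, intervalIntegral.integral_of_le ht.1,
      intervalIntegral.integral_of_le ht.1]
    congr 1
    refine setIntegral_congr_fun measurableSet_Ioc fun s hs => ?_
    rw [hN'1 (hs.2.trans ht.2)]
  have hd2 : ∀ r ∈ Icc 0 τ, duhamel π ν u₀ N' (Tmax + r) = duhamel π ν v₁ N₁ r := by
    intro r hr
    rw [duhamel_add hp hπ.continuous hπ.map_add hν u₀ hT.le hr.1
      (hN'i.mono_set (Ioc_subset_Ioc_right (by linarith [hr.2]))), hd1 _ ⟨hT.le, le_rfl⟩, ← hv₁,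
      duhamel, duhamel, intervalIntegral.integral_of_le hr.1,
      intervalIntegral.integral_of_le hr.1]
    congr 1
    refine setIntegral_congr_fun measurableSet_Ioc fun s hs => ?_
    rw [hN'2 s hs.1]
  have heq : EqOn (fun t => z t + duhamel π ν u₀ N' t) u (Ico 0 Tmax) := by
    intro t ht
    beta_reduce
    rw [hd1 t ⟨ht.1, ht.2.le⟩, ← huN t ht]
    abel
  refine ⟨Tmax + τ, ⟨by linarith [hτ.1], hτT.le⟩, fun t => z t + duhamel π ν u₀ N' t,
    ⟨?_, N', hN'i, ?_, fun t ht => ?_⟩, heq⟩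
  · exact (hzc.mono fun t ht => ⟨ht.1, ht.2.trans_lt hτT⟩).add
      (continuousOn_duhamel hp hπ.continuous hπ.map_add hν u₀ hN'i)
  -- The value of `u` at `Tmax` is not controlled; the single point is dropped as a null set.
  · rw [← Ioc_union_Ioc_eq_Ioc hT.le (show Tmax ≤ Tmax + τ by linarith [hτ.1]),
      ae_restrict_union_iff, ← Measure.restrict_congr_set Ioo_ae_eq_Ioc]
    constructor
    · filter_upwards [hNc, ae_restrict_mem measurableSet_Ioo] with s hs hsT
      have h1 := heq ⟨hsT.1.le, hsT.2⟩
      beta_reduce at h1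
      rwa [h1, hN'1 hsT.2.le]
    · have h : ∀ᵐ r ∂(volume.restrict (Ioc 0 τ)), IsConvection π
          (z (Tmax + r) + duhamel π ν u₀ N' (Tmax + r)) (N' (Tmax + r)) := by
        have hiff := ae_isConvection_iff hp hπ hν hα hβ hαβ hUA hUB hA hB hτ v₁
          (z := fun s => z (Tmax + s)) (zA := fun s => zA (Tmax + s))
          (zB := fun s => zB (Tmax + s)) (hz'.mono fun s hs => hs.2.2) hN₁
        filter_upwards [hiff, hfix, ae_restrict_mem measurableSet_Ioc] with r h1 h2 hr
        rw [hd2 r ⟨hr.1.le, hr.2⟩, hN'2 r hr.1]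
        exact (h1 _).2 h2
      have h' := (ae_comp_add (P := fun s => IsConvection π (z s + duhamel π ν u₀ N' s) (N' s))
        Tmax 0 τ).1 h
      rwa [add_zero] at h'
  · rw [add_sub_cancel_left, duhamel]

theorem limsup_enorm_sq_eq_top (hdp : (d : ℝ≥0∞) < p) (hp : p ≠ ∞)
    (hπ : IsHeatCovering π) (hν : 0 < ν) {θ : ℝ≥0} (hθ : 0 < θ) {T Tmax : ℝ} (hT : Tmax < T)
    (u₀ : LVec G d p) (z u : ℝ → LVec G d p)
    (hz2 : MemLinftySobolev π T (2 * p) fun t => (z t : G → RVec d))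
    (hz1 : MemLinftySobolev π T p fun t => (z t : G → RVec d))
    (hzH : ∃ C : ℝ≥0, HolderOnWith C θ z (Ioo 0 T))
    (hu : IsMaximalMildSolution π ν T Tmax u₀ z u) :
    limsup (fun t => ‖u t‖ₑ ^ 2) (𝓝[<] Tmax) = ∞ := by
  obtain ⟨hT0, hsol, hmax⟩ := hu
  by_contra hlim
  obtain ⟨UA, UB, C, hC, hUA, hUB, hA, hB⟩ := exists_smoothingFamilies (p := p) hp hπ hν
  have hP : (d : ℝ) < p.toReal := by
    have := (ENNReal.toReal_lt_toReal (by simp) hp).2 hdp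
    simpa using this
  have hP0 : 0 < p.toReal := (Nat.cast_nonneg d).trans_lt hP
  have hα : 0 ≤ (d : ℝ) / (4 * p.toReal) := by positivity
  -- The sum is `1/2 + d/(2p)`; this is where `d < p` is decisive.
  have hαβ : (d : ℝ) / (4 * p.toReal) + (1 / 2 + d / (4 * p.toReal)) < 1 := by
    have : (d : ℝ) / (4 * p.toReal) < 1 / 4 := by
      rw [div_lt_iff₀ (by positivity)]
      linarith
    linarith
  obtain ⟨zA, zB, Z, hzAm, hzBm, hz⟩ := exists_path_of_memLinftySobolev hz2 hz1
  obtain ⟨N, hN, hNc, huN⟩ := exists_nonlinearity hπ hT0 hsol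
  obtain ⟨Ch, hzH⟩ := hzH
  have hzc0 : ContinuousOn z (Ioo 0 T) := hzH.continuousOn hθ
  -- Hölder continuity on the open interval says nothing at `0`. Continuity there comes from `z = u
  -- - v`, where both `u` and the Duhamel formula are continuous.
  have hzc : ContinuousOn z (Ico 0 T) := by
    intro t ht
    rcases ht.1.eq_or_lt with rfl | h0
    · have hmem : Tmax / 2 ∈ Ioo 0 Tmax := ⟨by linarith, by linarith⟩
      have h1 : ContinuousOn (fun t => u t - duhamel π ν u₀ N t) (Icc 0 (Tmax / 2)) :=
        (hsol _ hmem).1.sub (continuousOn_duhamel hp hπ.continuous hπ.map_add hν u₀ (hN _ hmem.2))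
      have h2 : ContinuousOn z (Icc 0 (Tmax / 2)) := h1.congr fun t ht => by
        beta_reduce
        rw [← huN t ⟨ht.1, by linarith [ht.2]⟩]
        abel
      refine (h2 0 ⟨le_rfl, by linarith⟩).mono_of_mem_nhdsWithin ?_
      rw [← Ici_inter_Iio]
      refine mem_of_superset (inter_mem_nhdsWithin _ (Iio_mem_nhds hmem.1)) ?_
      exact fun x hx => ⟨hx.1.1, le_of_lt hx.2⟩
    · exact (hzc0.continuousAt (Ioo_mem_nhds h0 ht.2)).continuousWithinAt
  -- A finite limsup bounds `‖u‖²` by some `b` near `Tmax`, hence `‖u‖ ≤ b + 1`; continuity of `z`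
  -- at `Tmax < T` bounds the rest.
  obtain ⟨M, hM⟩ : ∃ M : ℝ≥0, ∀ᶠ t in 𝓝[<] Tmax, ‖u t - z t‖₊ ≤ M := by
    obtain ⟨b, hb1, hb2⟩ := exists_between (lt_top_iff_ne_top.2 hlim)
    have h1 := eventually_lt_of_limsup_lt hb1
    have h2 : ∀ᶠ t in 𝓝[<] Tmax, ‖z t‖ < ‖z Tmax‖ + 1 := by
      have hc : ContinuousAt z Tmax := hzc0.continuousAt (Ioo_mem_nhds hT0 hT)
      exact (hc.norm.eventually_lt_const (lt_add_one _)).filter_mono nhdsWithin_le_nhds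
    refine ⟨(b.toNNReal + 1) + (‖z Tmax‖₊ + 1), ?_⟩
    filter_upwards [h1, h2] with t ht1 ht2
    refine (nnnorm_sub_le _ _).trans (add_le_add ?_ ?_)
    · have h3 : (‖u t‖₊ ^ 2 : ℝ≥0) ≤ b.toNNReal := by
        rw [← ENNReal.coe_le_coe, ENNReal.coe_toNNReal hb2.ne]
        exact_mod_cast ht1.le
      rw [← NNReal.coe_le_coe] at h3 ⊢
      push_cast at h3 ⊢
      nlinarith [sq_nonneg (‖u t‖ - 1), norm_nonneg (u t), b.toNNReal.coe_nonneg]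
    · rw [← NNReal.coe_le_coe]
      push_cast
      exact ht2.le
  obtain ⟨t₁, ht₁, hM⟩ := (mem_nhdsLT_iff_exists_Ioo_subset).1 hM
  have hNi := integrableOn_nonlinearity_of_bounded hp hπ hν hα (by positivity) hαβ hC hUA hUB hA hB
    hT0 (ae_restrict_of_ae_restrict_of_subset (Ioo_subset_Ioo_right hT.le) hz) hN hNc huN ht₁
    (fun t ht => hM ht)
  obtain ⟨T', hT', u', hu', he⟩ := exists_continuation hp hπ hν hα (by positivity) hαβ hC hUA hUB
    hA hB hT0 hT hzAm hzBm hz hzc hNi hNc huN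
  exact hmax T' hT' u' hu' he

end Blowup
-- The whole space and the torus as heat coverings.
section Instances

variable {d : ℕ}

lemma heatKernel_eq_mul_mul {ν t : ℝ} (hν : 0 < ν) (ht : 0 < t) (y : RVec d) :
    ENNReal.ofReal (heatKernel ν t y) =
      ENNReal.ofReal ((4 * Real.pi * ν) ^ (-(d : ℝ) / 2)) * powKernel (d / 2) t *
        ENNReal.ofReal (Real.exp (-(4 * ν * t)⁻¹ * ‖y‖ ^ 2)) := by
  rw [heatKernel_eq, powKernel, if_pos ht, ENNReal.ofReal_mul (by positivity),
    Real.mul_rpow (by positivity) ht.le, ENNReal.ofReal_mul (by positivity), neg_div]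

lemma isHeatCovering_id : IsHeatCovering (id : RVec d → RVec d) where
  map_add _ _ := rfl
  isQuotientMap := IsQuotientMap.id
  ae_eq_zero g hg h := ae_eq_zero_of_integral_contDiff_smul_eq_zero hg fun φ h1 h2 => h φ ⟨h2, h1⟩
  map_heatKernel_le ν hν := by
    refine ⟨((4 * Real.pi * ν) ^ (-(d : ℝ) / 2)).toNNReal, fun t ht => ?_⟩
    rw [Measure.map_id, ← withDensity_const]
    refine withDensity_mono (Eventually.of_forall fun y => ?_)
    beta_reduce
    rw [heatKernel_eq_mul_mul hν ht.1, ENNReal.ofReal]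
    refine mul_le_of_le_one_right zero_le ?_
    rw [ENNReal.ofReal_le_one, Real.exp_le_one_iff]
    have : 0 ≤ (4 * ν * t)⁻¹ * ‖y‖ ^ 2 := by
      have := ht.1
      positivity
    linarith

variable (L : ℝ)

lemma torusProj_add (x y : RVec d) : torusProj L d (x + y) = torusProj L d x + torusProj L d y := by
  ext i
  simp [torusProj]

lemma isQuotientMap_torusProj : IsQuotientMap (torusProj L d) := by
  have h1 : IsOpenMap (Pi.map fun (_ : Fin d) (x : ℝ) => (x : AddCircle L)) :=
    IsOpenMap.piMap (fun _ => QuotientAddGroup.isOpenMap_coe)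
      (Eventually.of_forall fun _ => QuotientAddGroup.mk_surjective)
  have h2 : IsOpenMap (torusProj L d) :=
    h1.comp (PiLp.homeomorph 2 (fun _ : Fin d => ℝ)).isOpenMap
  refine h2.isQuotientMap ?_ fun x => ?_
  · exact continuous_pi fun i => (AddCircle.continuous_mk' L).comp (by fun_prop)
  · choose y hy using fun i => QuotientAddGroup.mk_surjective (x i)
    exact ⟨WithLp.toLp 2 y, funext hy⟩

variable [hL : Fact (0 < L)]

/-- The fundamental domain `(0,L]ᵈ` of the torus. -/
def torusCell (d : ℕ) : Set (RVec d) := WithLp.ofLp ⁻¹' univ.pi fun _ => Ioc 0 L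

omit hL in
lemma measurableSet_torusCell : MeasurableSet (torusCell L d) :=
  (MeasurableSet.univ_pi fun _ => measurableSet_Ioc).preimage (by fun_prop)

lemma measurePreserving_torusProj :
    MeasurePreserving (torusProj L d) (volume.restrict (torusCell L d)) volume := by
  have h1 := (PiLp.volume_preserving_ofLp (Fin d)).restrict_preimage
    (s := univ.pi fun _ => Ioc 0 L) (MeasurableSet.univ_pi fun _ => measurableSet_Ioc)
  rw [volume_pi, Measure.restrict_pi_pi] at h1
  have h2 := measurePreserving_pi (fun _ : Fin d => (volume : Measure ℝ).restrict (Ioc 0 L))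
    (fun _ => (volume : Measure (AddCircle L))) (f := fun _ x => (x : AddCircle L))
    fun _ => by simpa using AddCircle.measurePreserving_mk L 0
  exact h2.comp h1

lemma sq_norm_le_of_mem_torusCell {w : RVec d} (hw : w ∈ torusCell L d) :
    ‖w‖ ^ 2 ≤ d * L ^ 2 := by
  rw [EuclideanSpace.norm_sq_eq]
  refine (Finset.sum_le_card_nsmul _ _ (L ^ 2) fun i _ => ?_).trans_eq (by simp)
  have := hw i (mem_univ i)
  rw [Real.norm_eq_abs, sq_abs]
  exact pow_le_pow_left₀ this.1.le this.2 2

/-- The periodization of an integrable density on `ℝᵈ` is bounded if the oscillation of the density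
on the cells is controlled by an integrable function. -/
lemma map_withDensity_torusProj_le {k κ : RVec d → ℝ≥0∞} (hκ : Measurable κ)
    (h : ∀ y, ∀ w ∈ torusCell L d, k y ≤ κ (y - w)) :
    (volume.withDensity k).map (torusProj L d) ≤
      ((∫⁻ x, κ x) / volume (univ : Set (Torus L d))) • (volume : Measure (Torus L d)) := by
  have hπ : Measurable (torusProj L d) := (isQuotientMap_torusProj L).continuous.measurable
  refine Measure.le_iff.2 fun A hA => ?_
  rw [Measure.map_apply hπ hA, withDensity_apply _ (hπ hA), Measure.smul_apply, smul_eq_mul,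
    ENNReal.div_eq_inv_mul, mul_assoc, ← ENNReal.mul_le_iff_le_inv
      (isOpen_univ.measure_ne_zero _ univ_nonempty) (by simp)]
  have hcell : volume (univ : Set (Torus L d)) = volume (torusCell L d) := by
    rw [← (measurePreserving_torusProj L).measure_preimage MeasurableSet.univ.nullMeasurableSet]
    simp
  -- The cell projects onto the torus preserving measure, so by translation invariance the average
  -- over the cell does not see `x`.
  have hind : ∀ x, ∫⁻ w in torusCell L d, A.indicator 1 (torusProj L d (x + w)) = volume A := by
    intro x
    simp only [torusProj_add]
    have hm : Measurable (A.indicator (1 : Torus L d → ℝ≥0∞)) := measurable_one.indicator hA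
    rw [(measurePreserving_torusProj L).lintegral_comp
      (f := fun v => A.indicator 1 (torusProj L d x + v)) (by fun_prop),
      lintegral_add_left_eq_self (fun v => A.indicator 1 v), lintegral_indicator_one hA]
  have hm : Measurable (A.indicator (1 : Torus L d → ℝ≥0∞)) := measurable_one.indicator hA
  -- Multiplying by the volume of the torus introduces an integral over `w` in the cell; after
  -- bounding `k y` by `κ (y - w)` and substituting `y = x + w`, the integral over `w` yields the
  -- measure of `A`.
  calc volume (univ : Set (Torus L d)) * ∫⁻ y in torusProj L d ⁻¹' A, k y
      = ∫⁻ w in torusCell L d, ∫⁻ y, A.indicator 1 (torusProj L d y) * k y := by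
        rw [lintegral_const, Measure.restrict_apply MeasurableSet.univ, univ_inter, hcell, mul_comm,
          ← lintegral_indicator (hπ hA)]
        congr 2 with y
        by_cases hy : torusProj L d y ∈ A <;> simp [indicator, hy]
    _ ≤ ∫⁻ w in torusCell L d, ∫⁻ y, A.indicator 1 (torusProj L d y) * κ (y - w) := by
        refine setLIntegral_mono' (measurableSet_torusCell L) fun w hw => lintegral_mono fun y => ?_
        gcongr
        exact h y w hw
    _ = ∫⁻ w in torusCell L d, ∫⁻ x, A.indicator 1 (torusProj L d (x + w)) * κ x := by
        congr 1 with w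
        rw [← lintegral_sub_right_eq_self (fun x => A.indicator 1 (torusProj L d (x + w)) * κ x) w]
        simp
    _ = ∫⁻ x, ∫⁻ w in torusCell L d, A.indicator 1 (torusProj L d (x + w)) * κ x := by
        refine lintegral_lintegral_swap (Measurable.aemeasurable ?_)
        unfold Function.uncurry
        fun_prop
    _ = ∫⁻ x, volume A * κ x := by
        congr 1 with x
        rw [lintegral_mul_const _ (by fun_prop), hind]
    _ = (∫⁻ x, κ x) * volume A := by rw [lintegral_const_mul _ hκ, mul_comm]

lemma exists_map_heatKernel_torusProj_le {ν : ℝ} (hν : 0 < ν) :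
    ∃ Λ : ℝ≥0, ∀ t ∈ Ioc (0 : ℝ) 2,
      (volume.withDensity fun y => ENNReal.ofReal (heatKernel ν t y)).map (torusProj L d) ≤
        ((Λ : ℝ≥0∞) * powKernel (d / 2) t) • (volume : Measure (Torus L d)) := by
  set c := ENNReal.ofReal ((4 * Real.pi * ν) ^ (-(d : ℝ) / 2))
  -- For `t ≤ 2` the exponential is at most `exp(-‖y‖²/(8ν))`. From `‖y - w‖² ≤ 2‖y‖² + 2‖w‖²` and
  -- `‖w‖² ≤ d L²` on the cell, this is at most `exp(dL²/(8ν)) exp(-‖y - w‖²/(16ν))`, a bound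
  -- independent of `t`.
  let κ : RVec d → ℝ≥0∞ := fun x =>
    ENNReal.ofReal (Real.exp (d * L ^ 2 / (8 * ν)) * Real.exp (-(16 * ν)⁻¹ * ‖x‖ ^ 2))
  have hκ : Measurable κ := by fun_prop
  have hfin : ∫⁻ x, κ x ≠ ∞ :=
    ((integrable_exp_neg_mul_sq_norm (by positivity)).const_mul _).lintegral_lt_top.ne
  have hvol : volume (univ : Set (Torus L d)) ≠ 0 := isOpen_univ.measure_ne_zero _ univ_nonempty
  refine ⟨(c * ((∫⁻ x, κ x) / volume (univ : Set (Torus L d)))).toNNReal, fun t ht => ?_⟩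
  rw [ENNReal.coe_toNNReal (by finiteness)]
  refine (map_withDensity_torusProj_le L (κ := fun x => c * powKernel (d / 2) t * κ x)
    (by fun_prop) fun y w hw => ?_).trans_eq ?_
  · rw [heatKernel_eq_mul_mul hν ht.1]
    refine mul_le_mul_right (ENNReal.ofReal_le_ofReal ?_) _
    rw [← Real.exp_add, Real.exp_le_exp]
    have h1 := sq_norm_le_of_mem_torusCell L hw
    have h2 : ‖y - w‖ ^ 2 ≤ 2 * ‖y‖ ^ 2 + 2 * ‖w‖ ^ 2 := by
      have := norm_sub_le y w
      nlinarith [sq_nonneg (‖y‖ - ‖w‖), norm_nonneg (y - w)]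
    have h3 : (8 * ν)⁻¹ ≤ (4 * ν * t)⁻¹ := by
      have := ht.1
      refine inv_anti₀ (by positivity) ?_
      nlinarith [ht.2]
    have h4 : (8 * ν)⁻¹ * ‖y‖ ^ 2 ≤ (4 * ν * t)⁻¹ * ‖y‖ ^ 2 := by gcongr
    have h5 : (16 * ν)⁻¹ = (8 * ν)⁻¹ / 2 := by field_simp; norm_num
    have h6 : 0 < (8 * ν)⁻¹ := by positivity
    rw [h5, div_eq_mul_inv (_ * _) (8 * ν)]
    nlinarith
  · rw [lintegral_const_mul _ hκ, mul_div_assoc, mul_right_comm]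

/-- Continuous functions on the torus are uniform limits of test functions. -/
lemma exists_isTestFunction_dist_le {h : Torus L d → ℝ} (hh : Continuous h) {ε : ℝ} (hε : 0 < ε) :
    ∃ φ, IsTestFunction (torusProj L d) φ ∧ ∀ x, dist (φ x) (h x) ≤ ε := by
  have hπ := isQuotientMap_torusProj (d := d) L
  let π' : RVec d →+ Torus L d := AddMonoidHom.mk' (torusProj L d) (torusProj_add L)
  have hπu : UniformContinuous (torusProj L d) :=
    uniformContinuous_addMonoidHom_of_continuous (f := π') hπ.continuous
  have hunif := (CompactSpace.uniformContinuous_of_continuous hh).comp hπu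
  obtain ⟨δ, hδ, hhδ⟩ := Metric.uniformContinuous_iff.1 hunif ε hε
  let b : ContDiffBump (0 : RVec d) := ⟨δ / 2, δ, half_pos hδ, half_lt_self hδ⟩
  -- Mollification at a scale `δ` from the uniform continuity of the lift of `h`; lifted to `ℝᵈ` it
  -- is an ordinary convolution with a smooth bump, hence smooth.
  let φ : Torus L d → ℝ := fun x => ∫ y, b.normed volume y • h (x - torusProj L d y)
  have hφ : φ ∘ torusProj L d =
      convolution (b.normed volume) (h ∘ torusProj L d) (ContinuousLinearMap.lsmul ℝ ℝ) volume := by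
    ext x
    refine integral_congr_ae (Eventually.of_forall fun y => ?_)
    have h1 : torusProj L d (x - y) = torusProj L d x - torusProj L d y := map_sub π' x y
    simp [h1]
  have hloc : LocallyIntegrable (h ∘ torusProj L d) := (hh.comp hπ.continuous).locallyIntegrable
  refine ⟨φ, ⟨HasCompactSupport.of_compactSpace _, ?_⟩, fun x => ?_⟩
  · rw [hφ]
    exact b.hasCompactSupport_normed.contDiff_convolution_left _ b.contDiff_normed hloc
  · obtain ⟨y, rfl⟩ := hπ.surjective x
    have h1 := b.dist_normed_convolution_le (x₀ := y) (ε := ε) hloc.aestronglyMeasurable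
      fun z hz => (hhδ hz).le
    rwa [← hφ] at h1

lemma integral_smul_eq_zero_of_isTestFunction {g : Torus L d → RVec d} (hg : Integrable g)
    (h0 : ∀ φ, IsTestFunction (torusProj L d) φ → ∫ x, φ x • g x = 0) {h : Torus L d → ℝ}
    (hh : Continuous h) : ∫ x, h x • g x = 0 := by
  choose φ hφ hφh using fun n : ℕ =>
    exists_isTestFunction_dist_le L hh (Nat.one_div_pos_of_nat (α := ℝ) (n := n))
  have hφc : ∀ n, Continuous (φ n) := fun n =>
    (isQuotientMap_torusProj L).continuous_iff.2 (hφ n).2.continuous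
  refine tendsto_nhds_unique (f := fun n => ∫ x, φ n x • g x) (l := atTop) ?_
    (by simp [fun n => h0 _ (hφ n)])
  refine tendsto_integral_of_dominated_convergence (fun x => (‖h x‖ + 1) * ‖g x‖)
    (fun n => (hφc n).aestronglyMeasurable.smul hg.1) ?_ (fun n => ?_) ?_
  · obtain ⟨c, hc⟩ := (isCompact_range hh).isBounded.exists_norm_le
    have h1 := hg.norm.bdd_smul (φ := fun x => ‖h x‖ + 1) (c + 1) (by fun_prop)
      (Eventually.of_forall fun x => ?_)
    · exact h1
    · have := hc _ (mem_range_self x)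
      rw [Real.norm_of_nonneg (by positivity)]
      linarith
  · refine Eventually.of_forall fun x => ?_
    rw [norm_smul]
    gcongr
    have h1 := hφh n x
    rw [dist_eq_norm] at h1
    have h2 : (1 : ℝ) / (n + 1) ≤ 1 := by
      rw [div_le_one (by positivity)]
      linarith [(Nat.cast_nonneg n : (0 : ℝ) ≤ n)]
    linarith [norm_le_norm_add_norm_sub (h x) (φ n x), norm_sub_rev (h x) (φ n x)]
  · refine Eventually.of_forall fun x => Tendsto.smul_const ?_ _
    rw [tendsto_iff_dist_tendsto_zero]
    exact squeeze_zero (fun _ => dist_nonneg) (fun n => hφh n x)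
      tendsto_one_div_add_atTop_nhds_zero_nat

lemma isHeatCovering_torusProj : IsHeatCovering (torusProj L d) where
  map_add := torusProj_add L
  isQuotientMap := isQuotientMap_torusProj L
  map_heatKernel_le _ hν := exists_map_heatKernel_torusProj_le L hν
  ae_eq_zero g hg h := by
    have hg' : Integrable g := integrableOn_univ.1 (hg.integrableOn_isCompact isCompact_univ)
    -- Integrals over closed sets determine `g`, and their indicators are bounded pointwise limits
    -- of continuous functions, against which `g` integrates to zero by density of test functions.
    refine ae_eq_zero_of_forall_setIntegral_isClosed_eq_zero hg' fun s hs => ?_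
    have hδ : ∀ n : ℕ, (0 : ℝ) < 1 / (n + 1) := fun n => Nat.one_div_pos_of_nat
    refine tendsto_nhds_unique (l := atTop)
      (f := fun n => ∫ x, (thickenedIndicator (hδ n) s x : ℝ) • g x) ?_ ?_
    · rw [← integral_indicator hs.measurableSet]
      refine tendsto_integral_of_dominated_convergence (fun x => ‖g x‖)
        (fun n => ?_) hg'.norm (fun n => Eventually.of_forall fun x => ?_)
        (Eventually.of_forall fun x => ?_)
      · exact (NNReal.continuous_coe.comp (map_continuous _)).aestronglyMeasurable.smul hg'.1
      · rw [norm_smul]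
        refine mul_le_of_le_one_left (norm_nonneg _) ?_
        rw [NNReal.norm_eq]
        exact_mod_cast thickenedIndicator_le_one (hδ n) s x
      · have h1 := tendsto_pi_nhds.1 (thickenedIndicator_tendsto_indicator_closure hδ
          tendsto_one_div_add_atTop_nhds_zero_nat s) x
        have h2 := (NNReal.tendsto_coe.2 h1).smul_const (g x)
        have h3 : NNReal.toReal (s.indicator (fun _ => (1 : ℝ≥0)) x) • g x = s.indicator g x := by
          by_cases hx : x ∈ s <;> simp [hx]
        rwa [hs.closure_eq, h3] at h2
    · exact tendsto_const_nhds.congr fun n => (integral_smul_eq_zero_of_isTestFunction L hg' h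
        (NNReal.continuous_coe.comp (map_continuous (thickenedIndicator (hδ n) s)))).symm

end Instances

end Burgers

theorem mainTheorem8 (d : ℕ) (hd : 1 ≤ d) (p : ℝ≥0∞) [Fact (1 ≤ p)] (hdp : (d : ℝ≥0∞) < p)
    (hp : p ≠ ∞) (ν : ℝ) (hν : 0 < ν) (θ : ℝ≥0) (hθ : θ ∈ Ioo (0 : ℝ≥0) 1)
    (T Tmax : ℝ) (hT : Tmax < T) :
    -- the whole space
    (∀ (u₀ : Burgers.LVec (Burgers.RVec d) d p) (z u : ℝ → Burgers.LVec (Burgers.RVec d) d p),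
      Burgers.MemLinftySobolev (id : Burgers.RVec d → Burgers.RVec d) T (2 * p)
        (fun t => (z t : Burgers.RVec d → Burgers.RVec d)) →
      Burgers.MemLinftySobolev (id : Burgers.RVec d → Burgers.RVec d) T p
        (fun t => (z t : Burgers.RVec d → Burgers.RVec d)) →
      (∃ C : ℝ≥0, HolderOnWith C θ z (Ioo 0 T)) →
      Burgers.IsMaximalMildSolution (id : Burgers.RVec d → Burgers.RVec d) ν T Tmax u₀ z u →
      limsup (fun t => ‖u t‖ₑ ^ 2) (𝓝[<] Tmax) = ∞) ∧
    -- the torus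
    (∀ (L : ℝ) [Fact (0 < L)] (u₀ : Burgers.LVec (Burgers.Torus L d) d p)
        (z u : ℝ → Burgers.LVec (Burgers.Torus L d) d p),
      Burgers.MemLinftySobolev (Burgers.torusProj L d) T (2 * p)
        (fun t => (z t : Burgers.Torus L d → Burgers.RVec d)) →
      Burgers.MemLinftySobolev (Burgers.torusProj L d) T p
        (fun t => (z t : Burgers.Torus L d → Burgers.RVec d)) →
      (∃ C : ℝ≥0, HolderOnWith C θ z (Ioo 0 T)) →
      Burgers.IsMaximalMildSolution (Burgers.torusProj L d) ν T Tmax u₀ z u →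
      limsup (fun t => ‖u t‖ₑ ^ 2) (𝓝[<] Tmax) = ∞) := by
  exact ⟨fun u₀ z u hz2 hz1 hzH hu => Burgers.limsup_enorm_sq_eq_top hdp hp
      Burgers.isHeatCovering_id hν hθ.1 hT u₀ z u hz2 hz1 hzH hu,
    fun L _ u₀ z u hz2 hz1 hzH hu => Burgers.limsup_enorm_sq_eq_top hdp hp
      (Burgers.isHeatCovering_torusProj L) hν hθ.1 hT u₀ z u hz2 hz1 hzH hu⟩
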